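/- Let $(M^4,g)$ be a smooth oriented Riemannian four-manifold. Let $\nabla$ be the Levi-Civita connection, with curvature convention $(\nabla_a\nabla_b-\nabla_b\nabla_a)v^c=R_{ab}{}^c{}_d v^d$, $R_{abcd}=g_{ce}R_{ab}{}^e{}_d$, Ricci tensor $R_{bc}=R_{ab}{}^a{}_c$ and scalar curvature $R$. Let $P_{ab}=\tfrac12\left(R_{ab}-\tfrac{R}{6}g_{ab}\right)$ be the Schouten tensor, $J=g^{ab}P_{ab}$ its trace, and $W_{abcd}=R_{abcd}-\left(g_{ca}P_{bd}-g_{cb}P_{ad}+g_{db}P_{ac}-g_{da}P_{bc}\right)$ the Weyl tensor. Let $\mathcal W^{+}$ be the bundle of algebraic Weyl tensors $U_{ijk\ell}$ (covariant four-tensors with the symmetries of a curvature tensor, all of whose contractions vanish) that are self-dual, i.e. $\tfrac12\,\varepsilon_{ij}{}^{pq}U_{pqk\ell}=U_{ijk\ell}$. For a smooth section $U$ of $\mathcal W^{+}$ put $$(\delta U)_{kij}=\nabla^m U_{mkij},\qquad (\mathcal D^{*}U)_{ij}=2\left(\nabla^k\nabla^\ell U_{ikj\ell}+P^{k\ell}U_{ikj\ell}\right),$$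 where $\mathcal D^{*}$ is the $L^2$-formal adjoint of the linearization $\mathcal D$ at $g$ of $g\mapsto W^{+}$, given by this explicit formula when $g$ is anti-self-dual. Let $\Delta=\nabla^a\nabla_a$ be the rough Laplacian on tensors. Theorem. Suppose that $(M^4,g)$ is anti-self-dual, i.e. the self-dual part $W^{+}$ of its Weyl tensor vanishes, and that $U$ is a smooth section of $\mathcal W^{+}$ with $\mathcal D^{*}U=0$. Then, everywhere on $M$, $$\Delta(\delta U)_{\ell ij}=-2\,\nabla^m U_{ijk\ell}\,P^k{}_m-U_{ijk\ell}\,\nabla^k J+3J\,(\delta U)_{\ell ij},$$ $$\tfrac12\,\Delta U_{ijk\ell}=\nabla_k(\delta U)_{\ell ij}-\nabla_\ell(\delta U)_{kij}+U_{ijkm}P_\ell{}^m-U_{ij\ell m}P_k{}^m+J\,U_{ijk\ell}.$$ -/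

import Mathlib

open scoped Manifold ContDiff Matrix

noncomputable section

/-- The model space `ℝ⁴`. -/
abbrev E4 : Type := EuclideanSpace ℝ (Fin 4)

/-! ### Riemannian geometry of a metric written in coordinates

`G y` is the matrix `(g_{ij})` of the metric at the point with coordinates `y`. A covariant tensor
field of rank `k` is given by its components `T y I`, where `I : Fin k → Fin 4` lists the indices
in order, so that `T_{ijkl}` at `y` is `T y ![i, j, k, l]`. -/

/-- Components, in coordinates, of a covariant tensor field of rank `k`. -/
abbrev CoordTensor (k : ℕ) : Type := E4 → (Fin k → Fin 4) → ℝ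

/-- The partial derivative `∂_m f` at `y`. -/
def pderiv4 (m : Fin 4) (f : E4 → ℝ) (y : E4) : ℝ :=
  fderiv ℝ f y (EuclideanSpace.single m 1)

namespace Coord

variable (G : E4 → Matrix (Fin 4) (Fin 4) ℝ)

/-- The Christoffel symbol `Γ^p_{ij}` of the Levi-Civita connection. -/
def christoffel (p i j : Fin 4) (y : E4) : ℝ :=
  (1 / 2) * ∑ q, (G y)⁻¹ p q *
    (pderiv4 i (fun z => G z j q) y + pderiv4 j (fun z => G z i q) y
      - pderiv4 q (fun z => G z i j) y)

/-- The covariant derivative of a covariant tensor field; the new index comes first: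
`covDeriv G T y ![m, i, j, …]` is `∇_m T_{ij…}`. -/
def covDeriv {k : ℕ} (T : CoordTensor k) : CoordTensor (k + 1) := fun y I =>
  pderiv4 (I 0) (fun z => T z (Fin.tail I)) y
    - ∑ s, ∑ p, christoffel G p (I 0) (Fin.tail I s) y * T y (Function.update (Fin.tail I) s p)

/-- The rough Laplacian `Δ T = g^{ab} ∇_a ∇_b T`. -/
def roughLaplacian {k : ℕ} (T : CoordTensor k) : CoordTensor k := fun y I =>
  ∑ a, ∑ b, (G y)⁻¹ a b *
    covDeriv G (covDeriv G T) y (Fin.cons a (Fin.cons b I : Fin (k + 1) → Fin 4))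

/-- `R_{ab}{}^c{}_d`, with the convention `(∇_a ∇_b - ∇_b ∇_a) v^c = R_{ab}{}^c{}_d v^d`. -/
def riemannUp (a b c d : Fin 4) (y : E4) : ℝ :=
  pderiv4 a (christoffel G c b d) y - pderiv4 b (christoffel G c a d) y
    + ∑ e, (christoffel G c a e y * christoffel G e b d y
      - christoffel G c b e y * christoffel G e a d y)

/-- `R_{abcd} = g_{ce} R_{ab}{}^e{}_d`. -/
def riemann (a b c d : Fin 4) (y : E4) : ℝ := ∑ e, G y c e * riemannUp G a b e d y

/-- The Ricci tensor `R_{bc} = R_{ab}{}^a{}_c`. -/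
def ricci (b c : Fin 4) (y : E4) : ℝ := ∑ a, riemannUp G a b a c y

/-- The scalar curvature `R = g^{ab} R_{ab}`. -/
def scalarCurv (y : E4) : ℝ := ∑ a, ∑ b, (G y)⁻¹ a b * ricci G a b y

/-- The Schouten tensor in dimension four, `P_{ab} = ½ (R_{ab} - (R / 6) g_{ab})`. -/
def schouten (a b : Fin 4) (y : E4) : ℝ :=
  (1 / 2) * (ricci G a b y - scalarCurv G y / 6 * G y a b)

/-- `P_a{}^b`; the Schouten tensor is symmetric, so the order of the two slots is immaterial. -/
def schoutenMixed (a b : Fin 4) (y : E4) : ℝ := ∑ c, schouten G a c y * (G y)⁻¹ c b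

/-- `P^{ab}`. -/
def schoutenUp (a b : Fin 4) (y : E4) : ℝ :=
  ∑ c, ∑ d, (G y)⁻¹ a c * (G y)⁻¹ b d * schouten G c d y

/-- The trace `J = g^{ab} P_{ab}` of the Schouten tensor. -/
def traceJ (y : E4) : ℝ := ∑ a, ∑ b, (G y)⁻¹ a b * schouten G a b y

/-- The Weyl tensor: `R_{abcd} = W_{abcd} + g_{ca} P_{bd} - g_{cb} P_{ad} + g_{db} P_{ac}
- g_{da} P_{bc}`. -/
def weyl : CoordTensor 4 := fun y I =>
  riemann G (I 0) (I 1) (I 2) (I 3) y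
    - (G y (I 2) (I 0) * schouten G (I 1) (I 3) y - G y (I 2) (I 1) * schouten G (I 0) (I 3) y
      + G y (I 3) (I 1) * schouten G (I 0) (I 2) y - G y (I 3) (I 0) * schouten G (I 1) (I 2) y)

/-- The Riemannian volume form `ε_{ijkl}` in positively oriented coordinates: `√(det g)` times the
sign of `(i, j, k, l)` as a permutation of `(0, 1, 2, 3)`, and `0` if two indices agree. -/
def volForm : CoordTensor 4 := fun y I =>
  Real.sqrt (G y).det * (Matrix.of fun s t => if I s = t then (1 : ℝ) else 0).det

/-- The Hodge star on the first pair of indices,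
`(⋆T)_{ijkl} = ½ ε_{ij}{}^{pq} T_{pqkl}`, in positively oriented coordinates. -/
def hodgeStar (T : CoordTensor 4) : CoordTensor 4 := fun y I =>
  (1 / 2) * ∑ a, ∑ b, ∑ p, ∑ q,
    volForm G y ![I 0, I 1, a, b] * (G y)⁻¹ a p * (G y)⁻¹ b q * T y ![p, q, I 2, I 3]

/-- The self-dual Weyl tensor `W⁺ = ½ (W + ⋆W)`. -/
def weylPlus : CoordTensor 4 := fun y I => (1 / 2) * (weyl G y I + hodgeStar G (weyl G) y I)

/-- At the point `y` the rank four tensor `T` is an algebraic Weyl tensor (it has the symmetries of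
a curvature tensor and is totally trace-free) which is self-dual: it lies in `𝒲⁺`. -/
structure IsSelfDualWeylAt (T : CoordTensor 4) (y : E4) : Prop where
  skew_left : ∀ i j k l, T y ![j, i, k, l] = - T y ![i, j, k, l]
  skew_right : ∀ i j k l, T y ![i, j, l, k] = - T y ![i, j, k, l]
  pair_symm : ∀ i j k l, T y ![k, l, i, j] = T y ![i, j, k, l]
  bianchi : ∀ i j k l, T y ![i, j, k, l] + T y ![j, k, i, l] + T y ![k, i, j, l] = 0
  trace_free : ∀ j l, ∑ i, ∑ k, (G y)⁻¹ i k * T y ![i, j, k, l] = 0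
  self_dual : ∀ I, hodgeStar G T y I = T y I

/-- The divergence `(δT)_{kij} = ∇^m T_{mkij}`. -/
def divergence (T : CoordTensor 4) : CoordTensor 3 := fun y I =>
  ∑ m, ∑ n, (G y)⁻¹ m n * covDeriv G T y ![n, m, I 0, I 1, I 2]

/-- The operator `(𝒟*T)_{ij} = 2 (∇^k ∇^l T_{ikjl} + P^{kl} T_{ikjl})`. -/
def Dstar (T : CoordTensor 4) : CoordTensor 2 := fun y I =>
  2 * ((∑ k, ∑ l, ∑ a, ∑ b, (G y)⁻¹ k a * (G y)⁻¹ l b *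
      covDeriv G (covDeriv G T) y ![a, b, I 0, k, I 1, l])
    + ∑ k, ∑ l, schoutenUp G k l y * T y ![I 0, k, I 1, l])

end Coord

/-! ### Oriented Riemannian four-manifolds -/

section Manifold

variable (M : Type*) [TopologicalSpace M] [ChartedSpace E4 M] [IsManifold (𝓡 4) ∞ M]

/-- An orientation of a smooth four-manifold, given by an oriented atlas: a family of smooth charts
covering `M` all of whose coordinate changes have positive Jacobian determinant. -/
structure OrientedAtlas where
  /-- The positively oriented charts. -/
  charts : Set (OpenPartialHomeomorph M E4)
  smooth : charts ⊆ IsManifold.maximalAtlas (𝓡 4) ∞ M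
  cover : ∀ x : M, ∃ e ∈ charts, x ∈ e.source
  det_pos : ∀ e ∈ charts, ∀ e' ∈ charts, ∀ y ∈ (e.symm.trans e').source,
    0 < (fderiv ℝ (e.symm.trans e') y).det

/-- A smooth Riemannian metric on a four-manifold. -/
abbrev Metric4 : Type _ :=
  Bundle.ContMDiffRiemannianMetric (𝓡 4) ∞ E4 (fun x : M => TangentSpace (𝓡 4) x)

/-- A (not necessarily smooth) covariant tensor field of rank four. -/
abbrev TensorField4 : Type _ :=
  ∀ x : M, MultilinearMap ℝ (fun _ : Fin 4 => TangentSpace (𝓡 4) x) ℝ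

variable {M}

/-- The coordinate vector `∂_i` of the chart `e` at the point with coordinates `y`. -/
def coordVec (e : OpenPartialHomeomorph M E4) (y : E4) (i : Fin 4) :
    TangentSpace (𝓡 4) (e.symm y) :=
  mfderiv 𝓘(ℝ, E4) (𝓡 4) e.symm y (EuclideanSpace.single i 1 : E4)

/-- The components `g_{ij}` of the metric in the chart `e`. -/
def Metric4.inChart (g : Metric4 M) (e : OpenPartialHomeomorph M E4) :
    E4 → Matrix (Fin 4) (Fin 4) ℝ :=
  fun y => Matrix.of fun i j => g.inner (e.symm y) (coordVec e y i) (coordVec e y j)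

/-- The components `U_{ijkl}` of a tensor field in the chart `e`. -/
def TensorField4.inChart (U : TensorField4 M) (e : OpenPartialHomeomorph M E4) : CoordTensor 4 :=
  fun y I => U (e.symm y) fun s => coordVec e y (I s)

/-- `(M, g)` is anti-self-dual: the self-dual Weyl tensor vanishes. -/
def IsASD (A : OrientedAtlas M) (g : Metric4 M) : Prop :=
  ∀ e ∈ A.charts, ∀ y ∈ e.target, ∀ I, Coord.weylPlus (g.inChart e) y I = 0

/-- `U` is a smooth section of `𝒲⁺`. -/
structure IsSelfDualWeylSection (A : OrientedAtlas M) (g : Metric4 M) (U : TensorField4 M) :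
    Prop where
  smooth : ∀ e ∈ A.charts, ∀ I, ContDiffOn ℝ ∞ (fun y => U.inChart e y I) e.target
  algebraic : ∀ e ∈ A.charts, ∀ y ∈ e.target,
    Coord.IsSelfDualWeylAt (g.inChart e) (U.inChart e) y

/-- `U ∈ ker 𝒟*`: `U` is a smooth section of `𝒲⁺` with `𝒟*U = 0`. -/
structure IsInKerDstar (A : OrientedAtlas M) (g : Metric4 M) (U : TensorField4 M) : Prop where
  isSection : IsSelfDualWeylSection A g U
  eq_zero : ∀ e ∈ A.charts, ∀ y ∈ e.target, ∀ i j,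
    Coord.Dstar (g.inChart e) (U.inChart e) y ![i, j] = 0

end Manifold

end

/-! # The Laplacian of self-dual Weyl tensors in the kernel of `𝒟*`

On an anti-self-dual four-manifold, the rough Laplacian of a section of `𝒲⁺` in the kernel of
`𝒟*`, and that of its divergence, are computed in coordinates by passing to an oriented
orthonormal frame at each point. -/

noncomputable section

/-! ### Partial derivatives of smooth functions on an open set -/

/-! Both identities are tensorial, so at each point they may be checked on components in an oriented
orthonormal frame (`exists_isOrthonormalFrame`, `eq_zero_of_pull_eq_zero`). There `⋆` has constant
coefficients and a self-dual two-form is three numbers. What remains is linear algebra in the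
components of `U`, `P`, `W` and their derivatives: `laplacian_formula_orthonormal` and
`laplacian_divergence_formula_orthonormal`. Coordinates supply the analytic input: `g` and `ε` are
parallel, so `∇` preserves the conditions defining `𝒲⁺`; the Ricci identity; the differential
Bianchi identity.

Write `w = δU`. For a self-dual two-form, `dψ` is dual to `δψ`. Applied to the first pair of `U` and
differentiated once more (`cyclic_trace_eq_epsContract`), this gives `ΔU_{klij} = ε_{kl}{}^{ad} ∇_a
w_{dij} + ∇_k w_{lij} - ∇_l w_{kij} + 3J U_{klij}`, where the last term is the commutator of
derivatives (`curvAct4_trace`). Removing the `ε` term requires the anti-self-dual part in `kl` of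
`∇_k w_l - ∇_l w_k`. It lies in `Λ⁻ ⊗ Λ⁺`, which is isomorphic to the trace-free symmetric
two-tensors, so it is determined by a contraction. As `w` is trace-free, that contraction is `∇^l
w_{kil}`, which `𝒟*U = 0` identifies with `P^{ab} U_{kaib}` (`sub_epsContract_eq`).

For `Δw`, the same identity is differentiated and contracted with `∇^c` at the pair `(c,l)`. This
produces `Δw_l`, a term `∇^c ∇_l w_c`, and an `ε` term that sees only commutators. Commuting
derivatives turns the second into `∇_l (∇^c w_c)`, which vanishes by `trace_eq_zero_of_symm`; the
curvature terms are summed in `curvAct3_trace`. On the other side `∇P` appears. Since `W⁺ = 0`, the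
Cotton tensor is anti-self-dual (`isDuality_cotton`), hence pairs to zero with `U`, and `∇^c P_{cm}
= ∇_m J` accounts for the rest. -/

/-- A real function is smooth on `Ω`. -/
abbrev SmoothOn4 (Ω : Set E4) (f : E4 → ℝ) : Prop := ContDiffOn ℝ ∞ f Ω

section pderiv

variable {Ω : Set E4} {f h : E4 → ℝ} {y : E4}

lemma SmoothOn4.contDiffAt (hf : SmoothOn4 Ω f) (hΩ : IsOpen Ω) (hy : y ∈ Ω) :
    ContDiffAt ℝ ∞ f y := ContDiffOn.contDiffAt hf (hΩ.mem_nhds hy)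

lemma SmoothOn4.differentiableAt (hf : SmoothOn4 Ω f) (hΩ : IsOpen Ω) (hy : y ∈ Ω) :
    DifferentiableAt ℝ f y := (hf.contDiffAt hΩ hy).differentiableAt (by simp)

lemma SmoothOn4.pderiv4 (hf : SmoothOn4 Ω f) (hΩ : IsOpen Ω) (m : Fin 4) :
    SmoothOn4 Ω (pderiv4 m f) := by
  have h1 : ContDiffOn ℝ ∞ (fderiv ℝ f) Ω := hf.fderiv_of_isOpen hΩ (by simp)
  exact h1.clm_apply contDiffOn_const

lemma pderiv4_congr (hΩ : IsOpen Ω) (hy : y ∈ Ω) (hfh : ∀ z ∈ Ω, f z = h z) (m : Fin 4) :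
    pderiv4 m f y = pderiv4 m h y := by
  have : f =ᶠ[nhds y] h := Filter.eventually_of_mem (hΩ.mem_nhds hy) hfh
  simp only [pderiv4, this.fderiv_eq]

lemma pderiv4_const (m : Fin 4) (c : ℝ) : pderiv4 m (fun _ => c) y = 0 := by
  simp [pderiv4]

lemma pderiv4_add (hf : DifferentiableAt ℝ f y) (hh : DifferentiableAt ℝ h y) (m : Fin 4) :
    pderiv4 m (fun z => f z + h z) y = pderiv4 m f y + pderiv4 m h y := by
  simp [pderiv4, fderiv_fun_add hf hh]

lemma pderiv4_sub (hf : DifferentiableAt ℝ f y) (hh : DifferentiableAt ℝ h y) (m : Fin 4) :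
    pderiv4 m (fun z => f z - h z) y = pderiv4 m f y - pderiv4 m h y := by
  simp [pderiv4, fderiv_fun_sub hf hh]

lemma pderiv4_mul (hf : DifferentiableAt ℝ f y) (hh : DifferentiableAt ℝ h y) (m : Fin 4) :
    pderiv4 m (fun z => f z * h z) y = pderiv4 m f y * h y + f y * pderiv4 m h y := by
  simp [pderiv4, fderiv_fun_mul hf hh]; ring

lemma pderiv4_const_mul (c : ℝ) (hf : DifferentiableAt ℝ f y) (m : Fin 4) :
    pderiv4 m (fun z => c * f z) y = c * pderiv4 m f y := by
  rw [pderiv4_mul (by fun_prop) hf, pderiv4_const]; ring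

lemma pderiv4_sum {ι : Type*} (s : Finset ι) {F : ι → E4 → ℝ}
    (hF : ∀ i ∈ s, DifferentiableAt ℝ (F i) y) (m : Fin 4) :
    pderiv4 m (fun z => ∑ i ∈ s, F i z) y = ∑ i ∈ s, pderiv4 m (F i) y := by
  simp [pderiv4, fderiv_fun_sum hF]

lemma pderiv4_comm (hf : SmoothOn4 Ω f) (hΩ : IsOpen Ω) (hy : y ∈ Ω) (a b : Fin 4) :
    pderiv4 a (pderiv4 b f) y = pderiv4 b (pderiv4 a f) y := by
  have hd : DifferentiableAt ℝ (fderiv ℝ f) y :=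
    ((hf.fderiv_of_isOpen hΩ (m := ∞) (by simp)).contDiffAt (hΩ.mem_nhds hy)).differentiableAt
      (by simp)
  have key : ∀ a b : Fin 4, pderiv4 a (pderiv4 b f) y =
      fderiv ℝ (fderiv ℝ f) y (EuclideanSpace.single a 1) (EuclideanSpace.single b 1) := by
    intro a b
    unfold pderiv4
    rw [fderiv_clm_apply hd (by fun_prop)]
    simp
  rw [key, key]
  have hs : IsSymmSndFDerivAt ℝ f y :=
    ContDiffAt.isSymmSndFDerivAt (n := ∞) (hf.contDiffAt hΩ hy)
      (by simpa using (WithTop.coe_le_coe.2 (le_top : (2 : ℕ∞) ≤ ⊤)))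
  exact hs _ _

end pderiv

/-! ### Index-wise operations on arrays -/

/-- The derivation of covariant arrays induced by the endomorphism `N` acting on every slot. -/
def slotAct (N : Fin 4 → Fin 4 → ℝ) {k : ℕ} (T : (Fin k → Fin 4) → ℝ) : (Fin k → Fin 4) → ℝ :=
  fun I => ∑ s, ∑ p, N p (I s) * T (Function.update I s p)

lemma slotAct_zero_rank (N : Fin 4 → Fin 4 → ℝ) (T : (Fin 0 → Fin 4) → ℝ) (I) :
    slotAct N T I = 0 := by simp [slotAct]

/-- Peeling off the first slot is the recursion behind inductions on the rank and behind the
explicit low-rank formulas. -/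
lemma slotAct_cons (N : Fin 4 → Fin 4 → ℝ) {k : ℕ} (T : (Fin (k + 1) → Fin 4) → ℝ) (a : Fin 4)
    (I : Fin k → Fin 4) :
    slotAct N T (Fin.cons a I : Fin (k + 1) → Fin 4) =
      ∑ p, N p a * T (Fin.cons p I : Fin (k + 1) → Fin 4) +
        slotAct N (fun J => T (Fin.cons a J : Fin (k + 1) → Fin 4)) I := by
  simp only [slotAct, Fin.sum_univ_succ (n := k), Fin.cons_zero, Fin.cons_succ,
    Fin.update_cons_zero, ← Fin.cons_update]

lemma slotAct_add_right (N : Fin 4 → Fin 4 → ℝ) {k : ℕ} (S T : (Fin k → Fin 4) → ℝ) (I) :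
    slotAct N (fun J => S J + T J) I = slotAct N S I + slotAct N T I := by
  simp only [slotAct, mul_add, Finset.sum_add_distrib]

lemma slotAct_sub_right (N : Fin 4 → Fin 4 → ℝ) {k : ℕ} (S T : (Fin k → Fin 4) → ℝ) (I) :
    slotAct N (fun J => S J - T J) I = slotAct N S I - slotAct N T I := by
  simp only [slotAct, mul_sub, Finset.sum_sub_distrib]

lemma slotAct_const_mul (N : Fin 4 → Fin 4 → ℝ) {k : ℕ} (c : ℝ) (T : (Fin k → Fin 4) → ℝ) (I) :
    slotAct N (fun J => c * T J) I = c * slotAct N T I := by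
  simp only [slotAct, Finset.mul_sum]
  refine Finset.sum_congr rfl fun s _ => Finset.sum_congr rfl fun p _ => by ring

lemma slotAct_sum {ι : Type*} (s : Finset ι) (N : Fin 4 → Fin 4 → ℝ) {k : ℕ}
    (T : ι → (Fin k → Fin 4) → ℝ) (I) :
    slotAct N (fun J => ∑ i ∈ s, T i J) I = ∑ i ∈ s, slotAct N (T i) I := by
  simp only [slotAct, Finset.mul_sum]
  rw [Finset.sum_comm (s := s)]
  exact Finset.sum_congr rfl fun s _ => Finset.sum_comm

lemma slotAct_sub_left (N M : Fin 4 → Fin 4 → ℝ) {k : ℕ} (T : (Fin k → Fin 4) → ℝ) (I) :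
    slotAct (fun p i => N p i - M p i) T I = slotAct N T I - slotAct M T I := by
  simp only [slotAct, sub_mul, Finset.sum_sub_distrib]

lemma slotAct_const_mul_left (c : ℝ) (N : Fin 4 → Fin 4 → ℝ) {k : ℕ} (T : (Fin k → Fin 4) → ℝ)
    (I) : slotAct (fun p i => c * N p i) T I = c * slotAct N T I := by
  simp only [slotAct, Finset.mul_sum, mul_assoc]

lemma slotAct_sum_left {ι : Type*} (s : Finset ι) (N : ι → Fin 4 → Fin 4 → ℝ) {k : ℕ}
    (T : (Fin k → Fin 4) → ℝ) (I) :
    slotAct (fun p i => ∑ x ∈ s, N x p i) T I = ∑ x ∈ s, slotAct (N x) T I := by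
  simp only [slotAct, Finset.sum_mul]
  rw [Finset.sum_comm (s := s)]
  exact Finset.sum_congr rfl fun s _ => Finset.sum_comm

/-- The commutator of two derivations is the derivation of the commutator. -/
lemma slotAct_commutator (N M : Fin 4 → Fin 4 → ℝ) {k : ℕ} (T : (Fin k → Fin 4) → ℝ) (I) :
    slotAct N (slotAct M T) I - slotAct M (slotAct N T) I =
      slotAct (fun p i => ∑ e, (M p e * N e i - N p e * M e i)) T I := by
  induction k with
  | zero => simp [slotAct_zero_rank]
  | succ k ih =>
    obtain ⟨a, I, rfl⟩ : ∃ a J, I = (Fin.cons a J : Fin (k + 1) → Fin 4) :=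
      ⟨I 0, Fin.tail I, (Fin.cons_self_tail I).symm⟩
    -- The two middle terms, where `N` and `M` act on different slots, are exchanged by swapping `N`
    -- and `M`, so they cancel in the commutator.
    have key : ∀ N M : Fin 4 → Fin 4 → ℝ,
        slotAct N (slotAct M T) (Fin.cons a I : Fin (k + 1) → Fin 4) =
        ∑ p, (∑ e, M p e * N e a) * T (Fin.cons p I : Fin (k + 1) → Fin 4)
        + ∑ p, N p a * slotAct M (fun J => T (Fin.cons p J : Fin (k + 1) → Fin 4)) I
        + ∑ p, M p a * slotAct N (fun J => T (Fin.cons p J : Fin (k + 1) → Fin 4)) I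
        + slotAct N (slotAct M (fun J => T (Fin.cons a J : Fin (k + 1) → Fin 4))) I := by
      intro N M
      rw [slotAct_cons]
      simp only [slotAct_cons M]
      rw [slotAct_add_right, slotAct_sum]
      simp only [slotAct_const_mul, mul_add, Finset.sum_add_distrib, Finset.mul_sum,
        Finset.sum_mul]
      rw [Finset.sum_comm]
      have : ∀ x y : Fin 4, N y a * (M x y * T (Fin.cons x I : Fin (k + 1) → Fin 4)) =
        M x y * N y a * T (Fin.cons x I : Fin (k + 1) → Fin 4) := fun x y => by ring
      simp only [this]
      ring
    rw [key, key, slotAct_cons, ← ih]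
    simp only [Finset.sum_sub_distrib, sub_mul]
    ring

lemma slotAct_reindex (N : Fin 4 → Fin 4 → ℝ) {k : ℕ} (T : (Fin k → Fin 4) → ℝ)
    (σ : Equiv.Perm (Fin k)) (I : Fin k → Fin 4) :
    slotAct N (fun J => T (J ∘ σ)) I = slotAct N T (I ∘ σ) := by
  simp only [slotAct]
  rw [← Equiv.sum_comp σ]
  refine Finset.sum_congr rfl fun s _ => Finset.sum_congr rfl fun p _ => ?_
  rw [Function.update_comp_equiv]
  simp

/-! ### Smooth metrics in coordinates and the Levi-Civita connection. -/

namespace Coord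

/-- The matrix-valued function `G` is a smooth Riemannian metric on the open set `Ω`. -/
structure IsMetricOn (G : E4 → Matrix (Fin 4) (Fin 4) ℝ) (Ω : Set E4) : Prop where
  isOpen : IsOpen Ω
  smooth : ∀ i j, SmoothOn4 Ω (fun y => G y i j)
  posDef : ∀ y ∈ Ω, (G y).PosDef

/-- All components of the coordinate tensor `T` are smooth on `Ω`. -/
def SmoothTensor (Ω : Set E4) {k : ℕ} (T : CoordTensor k) : Prop :=
  ∀ I, SmoothOn4 Ω (fun y => T y I)

variable {G : E4 → Matrix (Fin 4) (Fin 4) ℝ} {Ω : Set E4} {y : E4}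

namespace IsMetricOn

lemma symm (hG : IsMetricOn G Ω) (hy : y ∈ Ω) (i j : Fin 4) : G y i j = G y j i := by
  have := (hG.posDef y hy).isHermitian.apply j i
  simpa using this

lemma det_pos (hG : IsMetricOn G Ω) (hy : y ∈ Ω) : 0 < (G y).det := (hG.posDef y hy).det_pos

lemma isUnit_det (hG : IsMetricOn G Ω) (hy : y ∈ Ω) : IsUnit (G y).det :=
  (hG.det_pos hy).ne'.isUnit

lemma inv_symm (hG : IsMetricOn G Ω) (hy : y ∈ Ω) (i j : Fin 4) : (G y)⁻¹ i j = (G y)⁻¹ j i := by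
  have := (hG.posDef y hy).isHermitian.inv.apply j i
  simpa using this

lemma mul_inv_apply (hG : IsMetricOn G Ω) (hy : y ∈ Ω) (i j : Fin 4) :
    ∑ p, G y i p * (G y)⁻¹ p j = if i = j then 1 else 0 := by
  rw [← Matrix.mul_apply, Matrix.mul_nonsing_inv _ (hG.isUnit_det hy), Matrix.one_apply]

lemma inv_mul_apply (hG : IsMetricOn G Ω) (hy : y ∈ Ω) (i j : Fin 4) :
    ∑ p, (G y)⁻¹ i p * G y p j = if i = j then 1 else 0 := by
  rw [← Matrix.mul_apply, Matrix.nonsing_inv_mul _ (hG.isUnit_det hy), Matrix.one_apply]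

end IsMetricOn

lemma smoothOn4_det {A : E4 → Matrix (Fin 4) (Fin 4) ℝ}
    (hA : ∀ i j, SmoothOn4 Ω (fun y => A y i j)) : SmoothOn4 Ω (fun y => (A y).det) := by
  simp only [Matrix.det_apply']
  refine ContDiffOn.sum fun σ _ => contDiffOn_const.mul ?_
  exact contDiffOn_prod fun i _ => hA _ _

namespace IsMetricOn

lemma smooth_det (hG : IsMetricOn G Ω) : SmoothOn4 Ω (fun y => (G y).det) :=
  smoothOn4_det hG.smooth

/-- Cramer's rule: cofactors are polynomial in the entries, and the determinant does not vanish on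
`Ω`. -/
lemma smooth_inv (hG : IsMetricOn G Ω) (i j : Fin 4) : SmoothOn4 Ω (fun y => (G y)⁻¹ i j) := by
  have h1 : SmoothOn4 Ω (fun y => ((G y).det)⁻¹ * (G y).adjugate i j) := by
    refine ContDiffOn.mul (hG.smooth_det.inv fun y hy => (hG.det_pos hy).ne') ?_
    simp only [Matrix.adjugate_apply]
    refine smoothOn4_det fun a b => ?_
    simp only [Matrix.updateRow_apply]
    split_ifs
    · exact contDiffOn_const
    · exact hG.smooth a b
  refine h1.congr fun y _ => ?_
  simp [Matrix.inv_def]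

lemma smooth_christoffel (hG : IsMetricOn G Ω) (p i j : Fin 4) :
    SmoothOn4 Ω (christoffel G p i j) := by
  unfold christoffel
  refine contDiffOn_const.mul (ContDiffOn.sum fun q _ => (hG.smooth_inv p q).mul ?_)
  exact (((hG.smooth j q).pderiv4 hG.isOpen i).add ((hG.smooth i q).pderiv4 hG.isOpen j)).sub
    ((hG.smooth i j).pderiv4 hG.isOpen q)

lemma christoffel_symm (hG : IsMetricOn G Ω) (hy : y ∈ Ω) (p i j : Fin 4) :
    christoffel G p i j y = christoffel G p j i y := by
  unfold christoffel
  congr 1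
  refine Finset.sum_congr rfl fun q _ => ?_
  rw [pderiv4_congr (f := fun z => G z i j) hG.isOpen hy (fun z hz => hG.symm hz i j) q]
  ring

/-- `Γ_{kij} = ½ (∂_i g_{jk} + ∂_j g_{ik} - ∂_k g_{ij})`. -/
lemma lower_christoffel (hG : IsMetricOn G Ω) (hy : y ∈ Ω) (k i j : Fin 4) :
    ∑ p, G y k p * christoffel G p i j y =
      (1 / 2) * (pderiv4 i (fun z => G z j k) y + pderiv4 j (fun z => G z i k) y
        - pderiv4 k (fun z => G z i j) y) := by
  unfold christoffel
  have : ∀ F : Fin 4 → ℝ, ∑ p, G y k p * ((1 / 2) * ∑ q, (G y)⁻¹ p q * F q) = (1 / 2) * F k := by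
    intro F
    have h1 : ∀ p, G y k p * ((1 / 2) * ∑ q, (G y)⁻¹ p q * F q) =
        ∑ q, (1 / 2) * (G y k p * (G y)⁻¹ p q * F q) := fun p => by
      simp only [Finset.mul_sum]
      exact Finset.sum_congr rfl fun q _ => by ring
    simp only [h1]
    rw [Finset.sum_comm]
    simp only [← Finset.mul_sum, ← Finset.sum_mul, hG.mul_inv_apply hy]
    simp
  exact this _

/-- The Levi-Civita connection is metric. -/
lemma pderiv4_metric (hG : IsMetricOn G Ω) (hy : y ∈ Ω) (m i j : Fin 4) :
    pderiv4 m (fun z => G z i j) y =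
      ∑ p, christoffel G p m i y * G y p j + ∑ p, christoffel G p m j y * G y i p := by
  have h1 := hG.lower_christoffel hy j m i
  have h2 := hG.lower_christoffel hy i m j
  have h3 : ∑ p, christoffel G p m i y * G y p j = ∑ p, G y j p * christoffel G p m i y :=
    Finset.sum_congr rfl fun p _ => by rw [hG.symm hy p j]; ring
  have h4 : ∑ p, christoffel G p m j y * G y i p = ∑ p, G y i p * christoffel G p m j y :=
    Finset.sum_congr rfl fun p _ => by ring
  rw [h3, h4, h1, h2,
    pderiv4_congr (f := fun z => G z j i) hG.isOpen hy (fun z hz => hG.symm hz j i) m]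
  ring

/-- The inverse metric is parallel. Differentiating `G⁻¹ G = 1` and inserting `∂G = Cᵀ G + G C`,
with `C` the connection matrix, gives `∂G⁻¹ = -C G⁻¹ - G⁻¹ Cᵀ`. -/
lemma pderiv4_inv (hG : IsMetricOn G Ω) (hy : y ∈ Ω) (m a b : Fin 4) :
    pderiv4 m (fun z => (G z)⁻¹ a b) y =
      - ∑ p, christoffel G a m p y * (G y)⁻¹ p b - ∑ p, christoffel G b m p y * (G y)⁻¹ a p := by
  have hd : ∀ i j, DifferentiableAt ℝ (fun z => G z i j) y :=
    fun i j => (hG.smooth i j).differentiableAt hG.isOpen hy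
  have hdi : ∀ i j, DifferentiableAt ℝ (fun z => (G z)⁻¹ i j) y :=
    fun i j => (hG.smooth_inv i j).differentiableAt hG.isOpen hy
  have h0 : ∀ i j, ∑ p, (pderiv4 m (fun z => (G z)⁻¹ i p) y * G y p j
      + (G y)⁻¹ i p * pderiv4 m (fun z => G z p j) y) = 0 := by
    intro i j
    have h1 := pderiv4_congr (h := fun _ => if i = j then (1 : ℝ) else 0) hG.isOpen hy
      (fun z hz => hG.inv_mul_apply hz i j) m
    rw [pderiv4_const, pderiv4_sum _ (fun p _ => (hdi i p).fun_mul (hd p j))] at h1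
    rw [← h1]
    exact Finset.sum_congr rfl fun p _ => (pderiv4_mul (hdi i p) (hd p j) m).symm
  let X : Matrix (Fin 4) (Fin 4) ℝ := Matrix.of fun a b => pderiv4 m (fun z => (G z)⁻¹ a b) y
  let D : Matrix (Fin 4) (Fin 4) ℝ := Matrix.of fun a b => pderiv4 m (fun z => G z a b) y
  let C : Matrix (Fin 4) (Fin 4) ℝ := Matrix.of fun p i => christoffel G p m i y
  have hX : X * G y + (G y)⁻¹ * D = 0 := by
    ext i j
    simpa [Matrix.mul_apply, X, D, Finset.sum_add_distrib] using h0 i j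
  have hD : D = Cᵀ * G y + G y * C := by
    ext i j
    simp only [Matrix.mul_apply, Matrix.add_apply, D, C, Matrix.of_apply, Matrix.transpose_apply,
      hG.pderiv4_metric hy]
    congr 1
    exact Finset.sum_congr rfl fun p _ => by ring
  have hu := hG.isUnit_det hy
  have hX2 : X = - (C * (G y)⁻¹) - (G y)⁻¹ * Cᵀ := by
    have h2 : X * G y * (G y)⁻¹ = X := by
      rw [Matrix.mul_assoc, Matrix.mul_nonsing_inv _ hu, Matrix.mul_one]
    rw [← h2, eq_neg_of_add_eq_zero_left hX, hD, Matrix.mul_add, ← Matrix.mul_assoc,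
      ← Matrix.mul_assoc, Matrix.nonsing_inv_mul _ hu, Matrix.one_mul, Matrix.neg_mul,
      Matrix.add_mul, Matrix.mul_assoc _ (G y), Matrix.mul_nonsing_inv _ hu, Matrix.mul_one]
    abel
  have := congrFun (congrFun hX2 a) b
  simp only [X, C, Matrix.of_apply, Matrix.sub_apply, Matrix.neg_apply, Matrix.mul_apply,
    Matrix.transpose_apply] at this
  rw [this]
  congr 1
  exact Finset.sum_congr rfl fun p _ => by ring

end IsMetricOn

/-! ### Covariant derivatives -/

lemma covDeriv_cons {k : ℕ} (T : CoordTensor k) (m : Fin 4) (I : Fin k → Fin 4) :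
    covDeriv G T y (Fin.cons m I : Fin (k + 1) → Fin 4) =
      pderiv4 m (fun z => T z I) y - slotAct (fun p i => christoffel G p m i y) (T y) I := rfl

section smooth

variable {k : ℕ} {S T : CoordTensor k}

lemma SmoothTensor.differentiableAt (hT : SmoothTensor Ω T) (hΩ : IsOpen Ω) (hy : y ∈ Ω) (I) :
    DifferentiableAt ℝ (fun z => T z I) y := (hT I).differentiableAt hΩ hy

lemma SmoothTensor.covDeriv (hT : SmoothTensor Ω T) (hG : IsMetricOn G Ω) :
    SmoothTensor Ω (covDeriv G T) := by
  intro I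
  unfold Coord.covDeriv
  refine ContDiffOn.sub ((hT _).pderiv4 hG.isOpen _) ?_
  exact ContDiffOn.sum fun s _ => ContDiffOn.sum fun p _ =>
    (hG.smooth_christoffel _ _ _).mul (hT _)

lemma covDeriv_congr (hΩ : IsOpen Ω) (hy : y ∈ Ω) (h : ∀ z ∈ Ω, ∀ I, S z I = T z I) (I) :
    covDeriv G S y I = covDeriv G T y I := by
  unfold covDeriv
  rw [pderiv4_congr hΩ hy (fun z hz => h z hz _)]
  simp only [h y hy]

lemma covDeriv_reindex (T : CoordTensor k) (σ : Equiv.Perm (Fin k)) (m : Fin 4)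
    (I : Fin k → Fin 4) :
    covDeriv G (fun y J => T y (J ∘ σ)) y (Fin.cons m I : Fin (k + 1) → Fin 4) =
      covDeriv G T y (Fin.cons m (I ∘ σ) : Fin (k + 1) → Fin 4) := by
  rw [covDeriv_cons, covDeriv_cons, slotAct_reindex]

lemma covDeriv_const_mul (c : ℝ) (hT : SmoothTensor Ω T) (hΩ : IsOpen Ω) (hy : y ∈ Ω)
    (m : Fin 4) (I : Fin k → Fin 4) :
    covDeriv G (fun y J => c * T y J) y (Fin.cons m I : Fin (k + 1) → Fin 4) =
      c * covDeriv G T y (Fin.cons m I : Fin (k + 1) → Fin 4) := by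
  simp only [covDeriv_cons]
  rw [pderiv4_const_mul _ (hT.differentiableAt hΩ hy I), slotAct_const_mul]
  ring

lemma covDeriv_zero (m : Fin 4) (I : Fin k → Fin 4) :
    covDeriv G (fun _ _ => 0 : CoordTensor k) y (Fin.cons m I : Fin (k + 1) → Fin 4) = 0 := by
  rw [covDeriv_cons, pderiv4_const]
  simp [slotAct]

end smooth

/-- Contraction of the first two indices with the inverse metric. -/
def traceHead (G : E4 → Matrix (Fin 4) (Fin 4) ℝ) {k : ℕ} (T : CoordTensor (k + 2)) :
    CoordTensor k := fun y I =>
  ∑ a, ∑ b, (G y)⁻¹ a b * T y (Fin.cons a (Fin.cons b I : Fin (k + 1) → Fin 4))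

lemma SmoothTensor.traceHead {k : ℕ} {T : CoordTensor (k + 2)} (hT : SmoothTensor Ω T)
    (hG : IsMetricOn G Ω) : SmoothTensor Ω (traceHead G T) := fun _ =>
  ContDiffOn.sum fun _ _ => ContDiffOn.sum fun _ _ => (hG.smooth_inv _ _).mul (hT _)

/-- Contraction commutes with `∇` because `g⁻¹` is parallel: the Christoffel terms of `∂g⁻¹`
reproduce the slot actions on the two contracted indices. -/
lemma covDeriv_traceHead {k : ℕ} {T : CoordTensor (k + 2)} (hT : SmoothTensor Ω T)
    (hG : IsMetricOn G Ω) (hy : y ∈ Ω) (m : Fin 4) (I : Fin k → Fin 4) :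
    covDeriv G (traceHead G T) y (Fin.cons m I : Fin (k + 1) → Fin 4) =
      ∑ a, ∑ b, (G y)⁻¹ a b * covDeriv G T y
        (Fin.cons m (Fin.cons a (Fin.cons b I : Fin (k + 1) → Fin 4) : Fin (k + 2) → Fin 4)) := by
  have hd := fun I => hT.differentiableAt hG.isOpen hy I
  have hdi : ∀ i j, DifferentiableAt ℝ (fun z => (G z)⁻¹ i j) y :=
    fun i j => (hG.smooth_inv i j).differentiableAt hG.isOpen hy
  simp only [covDeriv_cons, slotAct_cons]
  unfold traceHead
  rw [pderiv4_sum _ (fun a _ => DifferentiableAt.fun_sum fun b _ => (hdi a b).fun_mul (hd _))]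
  simp only [slotAct_sum, slotAct_const_mul]
  have h1 : ∀ a, pderiv4 m (fun z => ∑ b, (G z)⁻¹ a b *
      T z (Fin.cons a (Fin.cons b I : Fin (k + 1) → Fin 4))) y =
      ∑ b, (pderiv4 m (fun z => (G z)⁻¹ a b) y *
        T y (Fin.cons a (Fin.cons b I : Fin (k + 1) → Fin 4)) + (G y)⁻¹ a b *
        pderiv4 m (fun z => T z (Fin.cons a (Fin.cons b I : Fin (k + 1) → Fin 4))) y) := by
    intro a
    rw [pderiv4_sum _ (fun b _ => (hdi a b).fun_mul (hd _))]
    exact Finset.sum_congr rfl fun b _ => pderiv4_mul (hdi a b) (hd _) m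
  simp only [h1, hG.pderiv4_inv hy, Finset.sum_add_distrib, mul_sub, mul_add, sub_mul,
    Finset.sum_sub_distrib, Finset.mul_sum, Finset.sum_mul, neg_mul, Finset.sum_neg_distrib]
  have e1 : ∑ a, ∑ b, ∑ p, christoffel G a m p y * (G y)⁻¹ p b *
      T y (Fin.cons a (Fin.cons b I : Fin (k + 1) → Fin 4)) =
      ∑ a, ∑ b, ∑ p, (G y)⁻¹ a b * (christoffel G p m a y *
        T y (Fin.cons p (Fin.cons b I : Fin (k + 1) → Fin 4))) := by
    rw [Finset.sum_comm]
    conv_rhs => rw [Finset.sum_comm]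
    refine Finset.sum_congr rfl fun b _ => ?_
    rw [Finset.sum_comm]
    exact Finset.sum_congr rfl fun a _ => Finset.sum_congr rfl fun p _ => by ring
  have e2 : ∑ a, ∑ b, ∑ p, christoffel G b m p y * (G y)⁻¹ a p *
      T y (Fin.cons a (Fin.cons b I : Fin (k + 1) → Fin 4)) =
      ∑ a, ∑ b, ∑ p, (G y)⁻¹ a b * (christoffel G p m b y *
        T y (Fin.cons a (Fin.cons p I : Fin (k + 1) → Fin 4))) := by
    refine Finset.sum_congr rfl fun a _ => ?_
    rw [Finset.sum_comm]
    exact Finset.sum_congr rfl fun b _ => Finset.sum_congr rfl fun p _ => by ring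
  rw [e1, e2]
  ring

/-- The product of a rank two tensor, whose indices come first, with a tensor. -/
def prodHead (S : CoordTensor 2) {k : ℕ} (T : CoordTensor k) : CoordTensor (k + 2) := fun y I =>
  S y ![I 0, I 1] * T y (Fin.tail (Fin.tail I))

lemma SmoothTensor.prodHead {S : CoordTensor 2} {k : ℕ} {T : CoordTensor k}
    (hS : SmoothTensor Ω S) (hT : SmoothTensor Ω T) : SmoothTensor Ω (prodHead S T) := fun _ =>
  (hS _).mul (hT _)

lemma prodHead_cons (S : CoordTensor 2) {k : ℕ} (T : CoordTensor k) (a b : Fin 4)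
    (I : Fin k → Fin 4) :
    prodHead S T y (Fin.cons a (Fin.cons b I : Fin (k + 1) → Fin 4)) = S y ![a, b] * T y I := rfl

lemma slotAct_two (N : Fin 4 → Fin 4 → ℝ) (T : (Fin 2 → Fin 4) → ℝ) (a b : Fin 4) :
    slotAct N T ![a, b] = ∑ p, N p a * T ![p, b] + ∑ p, N p b * T ![a, p] := by
  have h := slotAct_cons N T a ![b]
  have h2 := slotAct_cons N (fun J => T (Fin.cons a J : Fin 2 → Fin 4)) b ![]
  rw [slotAct_zero_rank, add_zero] at h2
  change slotAct N (fun J => T (Fin.cons a J : Fin 2 → Fin 4)) ![b] = _ at h2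
  rw [h2] at h
  exact h

lemma covDeriv_prodHead {S : CoordTensor 2} {k : ℕ} {T : CoordTensor k}
    (hS : SmoothTensor Ω S) (hT : SmoothTensor Ω T) (hΩ : IsOpen Ω) (hy : y ∈ Ω) (m a b : Fin 4)
    (I : Fin k → Fin 4) :
    covDeriv G (prodHead S T) y
      (Fin.cons m (Fin.cons a (Fin.cons b I : Fin (k + 1) → Fin 4) : Fin (k + 2) → Fin 4)) =
      covDeriv G S y ![m, a, b] * T y I +
        S y ![a, b] * covDeriv G T y (Fin.cons m I : Fin (k + 1) → Fin 4) := by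
  have hS2 := covDeriv_cons (G := G) (y := y) S m ![a, b]
  change covDeriv G S y ![m, a, b] = _ at hS2
  rw [hS2, slotAct_two, covDeriv_cons, covDeriv_cons, slotAct_cons, slotAct_cons]
  simp only [prodHead_cons]
  rw [pderiv4_mul (hS.differentiableAt hΩ hy _) (hT.differentiableAt hΩ hy _), slotAct_const_mul]
  simp only [sub_mul, add_mul, Finset.sum_mul, mul_assoc]
  ring

/-- The metric as a covariant tensor field. -/
def metricTensor (G : E4 → Matrix (Fin 4) (Fin 4) ℝ) : CoordTensor 2 := fun y I => G y (I 0) (I 1)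

lemma IsMetricOn.smooth_metricTensor (hG : IsMetricOn G Ω) : SmoothTensor Ω (metricTensor G) :=
  fun _ => hG.smooth _ _

lemma IsMetricOn.covDeriv_metricTensor (hG : IsMetricOn G Ω) (hy : y ∈ Ω) (m a b : Fin 4) :
    covDeriv G (metricTensor G) y ![m, a, b] = 0 := by
  have h := covDeriv_cons (G := G) (y := y) (metricTensor G) m ![a, b]
  change covDeriv G (metricTensor G) y ![m, a, b] = _ at h
  rw [h, slotAct_two]
  simp only [metricTensor, Matrix.cons_val_zero, Matrix.cons_val_one]
  rw [hG.pderiv4_metric hy]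
  ring

/-- The Ricci identity. -/
lemma covDeriv_covDeriv_sub {k : ℕ} {T : CoordTensor k} (hT : SmoothTensor Ω T)
    (hG : IsMetricOn G Ω) (hy : y ∈ Ω) (a b : Fin 4) (I : Fin k → Fin 4) :
    covDeriv G (covDeriv G T) y
        (Fin.cons a (Fin.cons b I : Fin (k + 1) → Fin 4) : Fin (k + 2) → Fin 4) -
      covDeriv G (covDeriv G T) y
        (Fin.cons b (Fin.cons a I : Fin (k + 1) → Fin 4) : Fin (k + 2) → Fin 4) =
      - slotAct (fun p i => riemannUp G a b p i y) (T y) I := by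
  have hd := fun I => hT.differentiableAt hG.isOpen hy I
  have hdp := fun I m => ((hT I).pderiv4 hG.isOpen m).differentiableAt hG.isOpen hy
  have hdc : ∀ p i j, DifferentiableAt ℝ (fun z => christoffel G p i j z) y :=
    fun p i j => (hG.smooth_christoffel p i j).differentiableAt hG.isOpen hy
  -- On swapping `a` and `b`, the second partials agree, the `Γ^p_{ab}` term is symmetric by
  -- torsion-freeness, and the two terms mixing `Γ` with `∂T` are exchanged. Only `∂Γ` and the
  -- double action of `Γ` survive; together they are the curvature.
  have key : ∀ a b, covDeriv G (covDeriv G T) y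
        (Fin.cons a (Fin.cons b I : Fin (k + 1) → Fin 4) : Fin (k + 2) → Fin 4) =
      pderiv4 a (pderiv4 b (fun z => T z I)) y
      - slotAct (fun p i => pderiv4 a (christoffel G p b i) y) (T y) I
      - slotAct (fun p i => christoffel G p b i y) (fun J => pderiv4 a (fun z => T z J) y) I
      - ∑ p, christoffel G p a b y * covDeriv G T y (Fin.cons p I : Fin (k + 1) → Fin 4)
      - slotAct (fun p i => christoffel G p a i y) (fun J => pderiv4 b (fun z => T z J) y) I
      + slotAct (fun p i => christoffel G p a i y)
        (slotAct (fun p i => christoffel G p b i y) (T y)) I := by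
    intro a b
    rw [covDeriv_cons, slotAct_cons]
    simp only [covDeriv_cons (T := T) (m := b)]
    rw [slotAct_sub_right, pderiv4_sub (hdp I b)]
    · have h1 : pderiv4 a (fun z => slotAct (fun p i => christoffel G p b i z) (T z) I) y =
          slotAct (fun p i => pderiv4 a (christoffel G p b i) y) (T y) I +
          slotAct (fun p i => christoffel G p b i y) (fun J => pderiv4 a (fun z => T z J) y) I := by
        simp only [slotAct]
        rw [pderiv4_sum _ (fun s _ => DifferentiableAt.fun_sum fun p _ => (hdc _ _ _).fun_mul (hd
          _)),
          ← Finset.sum_add_distrib]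
        refine Finset.sum_congr rfl fun s _ => ?_
        rw [pderiv4_sum _ (fun p _ => (hdc _ _ _).fun_mul (hd _)), ← Finset.sum_add_distrib]
        exact Finset.sum_congr rfl fun p _ => pderiv4_mul (f :=
          fun z => christoffel G _ _ _ z) (hdc _ _ _) (hd _) a
      rw [h1]
      ring
    · exact DifferentiableAt.fun_sum fun s _ => DifferentiableAt.fun_sum fun p _ =>
        (hdc _ _ _).fun_mul (hd _)
  have hcomm := slotAct_commutator (fun p i => christoffel G p a i y)
    (fun p i => christoffel G p b i y) (T y) I
  have hR : slotAct (fun p i => riemannUp G a b p i y) (T y) I =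
      slotAct (fun p i => pderiv4 a (christoffel G p b i) y) (T y) I
      - slotAct (fun p i => pderiv4 b (christoffel G p a i) y) (T y) I
      - slotAct (fun p i => ∑ e, (christoffel G p b e y * christoffel G e a i y
        - christoffel G p a e y * christoffel G e b i y)) (T y) I := by
    rw [← slotAct_sub_left, ← slotAct_sub_left]
    congr 1
    funext p i
    simp only [riemannUp, Finset.sum_sub_distrib]
    ring
  rw [key, key, hR, ← hcomm, pderiv4_comm (hT I) hG.isOpen hy a b]
  simp only [hG.christoffel_symm hy _ a b]
  ring

end Coord

namespace Coord

variable {G : E4 → Matrix (Fin 4) (Fin 4) ℝ} {Ω : Set E4} {y : E4}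

/-- `slotAct_cons` again, in the syntactic form that `simp` meets in `![…]` notation. -/
lemma slotAct_vecCons (N : Fin 4 → Fin 4 → ℝ) {k : ℕ} (T : (Fin (k + 1) → Fin 4) → ℝ) (a : Fin 4)
    (I : Fin k → Fin 4) :
    slotAct N T (Matrix.vecCons a I) =
      ∑ p, N p a * T (Matrix.vecCons p I) + slotAct N (fun J => T (Matrix.vecCons a J)) I :=
  slotAct_cons N T a I

lemma covDeriv_vecCons {k : ℕ} (T : CoordTensor k) (m : Fin 4) (I : Fin k → Fin 4) :
    covDeriv G T y (Matrix.vecCons m I) =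
      pderiv4 m (fun z => T z I) y - slotAct (fun p i => christoffel G p m i y) (T y) I := rfl

/-! ### Symmetries of the curvature -/

namespace IsMetricOn

lemma smooth_riemannUp (hG : IsMetricOn G Ω) (a b c d : Fin 4) :
    SmoothOn4 Ω (riemannUp G a b c d) := by
  unfold riemannUp
  refine ContDiffOn.add (ContDiffOn.sub ?_ ?_) ?_
  · exact (hG.smooth_christoffel _ _ _).pderiv4 hG.isOpen _
  · exact (hG.smooth_christoffel _ _ _).pderiv4 hG.isOpen _
  · exact ContDiffOn.sum fun e _ => ((hG.smooth_christoffel _ _ _).mul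
      (hG.smooth_christoffel _ _ _)).sub ((hG.smooth_christoffel _ _ _).mul
      (hG.smooth_christoffel _ _ _))

lemma smooth_riemann (hG : IsMetricOn G Ω) (a b c d : Fin 4) :
    SmoothOn4 Ω (riemann G a b c d) :=
  ContDiffOn.sum fun _ _ => (hG.smooth _ _).mul (hG.smooth_riemannUp _ _ _ _)

lemma smooth_ricci (hG : IsMetricOn G Ω) (b c : Fin 4) : SmoothOn4 Ω (ricci G b c) :=
  ContDiffOn.sum fun _ _ => hG.smooth_riemannUp _ _ _ _

lemma smooth_scalarCurv (hG : IsMetricOn G Ω) : SmoothOn4 Ω (scalarCurv G) :=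
  ContDiffOn.sum fun _ _ => ContDiffOn.sum fun _ _ => (hG.smooth_inv _ _).mul (hG.smooth_ricci _ _)

lemma smooth_schouten (hG : IsMetricOn G Ω) (a b : Fin 4) : SmoothOn4 Ω (schouten G a b) :=
  contDiffOn_const.mul ((hG.smooth_ricci _ _).sub
    ((hG.smooth_scalarCurv.div_const _).mul (hG.smooth _ _)))

end IsMetricOn

lemma riemannUp_antisymm (a b c d : Fin 4) : riemannUp G a b c d y = - riemannUp G b a c d y := by
  simp only [riemannUp, Finset.sum_sub_distrib]; ring

lemma riemann_antisymm (a b c d : Fin 4) : riemann G a b c d y = - riemann G b a c d y := by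
  simp only [riemann, riemannUp_antisymm a b, mul_neg, Finset.sum_neg_distrib]

namespace IsMetricOn

/-- The index held fixed is the third, since it is the raised one. Symmetry of `Γ` in its lower
indices cancels both the `∂Γ` and the `ΓΓ` terms in pairs. -/
lemma riemannUp_cyclic (hG : IsMetricOn G Ω) (hy : y ∈ Ω) (a b c d : Fin 4) :
    riemannUp G a b c d y + riemannUp G b d c a y + riemannUp G d a c b y = 0 := by
  have h : ∀ m p i j, pderiv4 m (christoffel G p i j) y = pderiv4 m (christoffel G p j i) y :=
    fun m p i j => pderiv4_congr hG.isOpen hy (fun z hz => hG.christoffel_symm hz p i j) m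
  simp only [riemannUp, Finset.sum_sub_distrib]
  rw [h a c b d, h b c a d, h d c a b]
  simp only [fun e => hG.christoffel_symm hy e b d, fun e => hG.christoffel_symm hy e a d,
    fun e => hG.christoffel_symm hy e a b]
  ring

lemma riemann_cyclic (hG : IsMetricOn G Ω) (hy : y ∈ Ω) (a b c d : Fin 4) :
    riemann G a b c d y + riemann G b d c a y + riemann G d a c b y = 0 := by
  simp only [riemann, ← Finset.sum_add_distrib, ← mul_add, hG.riemannUp_cyclic hy]
  simp

/-- This is the Ricci identity for the metric itself, whose covariant derivatives vanish. -/
lemma riemann_antisymm_right (hG : IsMetricOn G Ω) (hy : y ∈ Ω) (a b c d : Fin 4) :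
    riemann G a b c d y = - riemann G a b d c y := by
  have h0 : ∀ z ∈ Ω, ∀ I, covDeriv G (metricTensor G) z I = (fun _ _ => 0 : CoordTensor 3) z I := by
    intro z hz I
    have : I = ![I 0, I 1, I 2] := by ext s; fin_cases s <;> rfl
    rw [this, hG.covDeriv_metricTensor hz]
  have h1 : ∀ a b, covDeriv G (covDeriv G (metricTensor G)) y
      (Fin.cons a (Fin.cons b ![c, d] : Fin 3 → Fin 4) : Fin 4 → Fin 4) = 0 := fun a b => by
    rw [covDeriv_congr hG.isOpen hy h0, covDeriv_zero]
  have h2 := covDeriv_covDeriv_sub hG.smooth_metricTensor hG hy a b ![c, d]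
  rw [h1, h1, slotAct_two] at h2
  have e1 : ∑ p, riemannUp G a b p c y * metricTensor G y ![p, d] = riemann G a b d c y :=
    Finset.sum_congr rfl fun p _ => by
      rw [mul_comm]; congr 1; exact hG.symm hy _ _
  have e2 : ∑ p, riemannUp G a b p d y * metricTensor G y ![c, p] = riemann G a b c d y :=
    Finset.sum_congr rfl fun p _ => by rw [mul_comm]; rfl
  rw [e1, e2] at h2
  linarith

/-- The classical octahedron argument: four cyclic identities combined with both skew-symmetries. -/
lemma riemann_pair_symm (hG : IsMetricOn G Ω) (hy : y ∈ Ω) (a b c d : Fin 4) :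
    riemann G a b c d y = riemann G c d a b y := by
  have r := fun a b c d => hG.riemann_antisymm_right hy a b c d
  have l := fun a b c d => riemann_antisymm (G := G) (y := y) a b c d
  have h1 := hG.riemann_cyclic hy a b c d
  have h2 := hG.riemann_cyclic hy b c d a
  have h3 := hG.riemann_cyclic hy c d a b
  have h4 := hG.riemann_cyclic hy d a b c
  linarith [r a b c d, r b d c a, r d a c b, r b c d a, r c a d b, r a b d c, r c d a b, r d b a c,
    r b c a d, r d a b c, r a c b d, r c d b a, l a b c d, l b d c a, l d a c b, l b c d a,
    l c a d b, l a b d c, l c d a b, l d b a c, l b c a d, l d a b c, l a c b d, l c d b a,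
    r a c d b, r c a b d, r a d b c, r a d c b, l a c d b, l c a b d, r b d a c, l b d a c,
    l d b c a]

end IsMetricOn

/-- The curvature tensor as a covariant tensor field. -/
def riemannTensor (G : E4 → Matrix (Fin 4) (Fin 4) ℝ) : CoordTensor 4 := fun y I =>
  riemann G (I 0) (I 1) (I 2) (I 3) y

/-- The differential Bianchi identity for `R_{ab}{}^c{}_d`. -/
lemma IsMetricOn.riemannUp_bianchi (hG : IsMetricOn G Ω) (hy : y ∈ Ω) (e a b c d : Fin 4) :
    (pderiv4 e (riemannUp G a b c d) y + ∑ p, (christoffel G c e p y * riemannUp G a b p d y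
        - riemannUp G a b c p y * christoffel G p e d y)) +
    (pderiv4 a (riemannUp G b e c d) y + ∑ p, (christoffel G c a p y * riemannUp G b e p d y
        - riemannUp G b e c p y * christoffel G p a d y)) +
    (pderiv4 b (riemannUp G e a c d) y + ∑ p, (christoffel G c b p y * riemannUp G e a p d y
        - riemannUp G e a c p y * christoffel G p b d y)) = 0 := by
  have hdc : ∀ p i j, DifferentiableAt ℝ (fun z => christoffel G p i j z) y :=
    fun p i j => (hG.smooth_christoffel p i j).differentiableAt hG.isOpen hy
  have hdp : ∀ m p i j, DifferentiableAt ℝ (pderiv4 m (christoffel G p i j)) y :=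
    fun m p i j => ((hG.smooth_christoffel p i j).pderiv4 hG.isOpen m).differentiableAt hG.isOpen hy
  -- With the connection as a matrix-valued one-form `A`, the curvature is `R_{ab} = ∂_a A_b - ∂_b
  -- A_a + [A_a, A_b]`. Second partials cancel by symmetry, and the remaining terms form the
  -- noncommutative identity `hM`, whose cubic part is the Jacobi identity.
  let A : Fin 4 → Matrix (Fin 4) (Fin 4) ℝ := fun m => Matrix.of fun p i => christoffel G p m i y
  let B : Fin 4 → Fin 4 → Matrix (Fin 4) (Fin 4) ℝ := fun m n =>
    Matrix.of fun p i => pderiv4 m (christoffel G p n i) y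
  let R : Fin 4 → Fin 4 → Matrix (Fin 4) (Fin 4) ℝ := fun a b =>
    Matrix.of fun p i => riemannUp G a b p i y
  have hR : ∀ a b, R a b = B a b - B b a + (A a * A b - A b * A a) := by
    intro a b
    ext p i
    simp [R, A, B, riemannUp, Matrix.mul_apply, Finset.sum_sub_distrib]
  have hdR : ∀ e a b, pderiv4 e (riemannUp G a b c d) y =
      pderiv4 e (pderiv4 a (christoffel G c b d)) y - pderiv4 e (pderiv4 b (christoffel G c a d)) y
      + (B e a * A b + A a * B e b - (B e b * A a + A b * B e a)) c d := by
    intro e a b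
    unfold riemannUp
    rw [pderiv4_add ((hdp _ _ _ _).fun_sub (hdp _ _ _ _)) (DifferentiableAt.fun_sum fun f _ =>
      ((hdc _ _ _).fun_mul (hdc _ _ _)).fun_sub ((hdc _ _ _).fun_mul (hdc _ _ _))),
      pderiv4_sub (hdp _ _ _ _) (hdp _ _ _ _),
      pderiv4_sum _ fun f _ =>
        ((hdc _ _ _).fun_mul (hdc _ _ _)).fun_sub ((hdc _ _ _).fun_mul (hdc _ _ _))]
    congr 1
    simp only [Matrix.sub_apply, Matrix.add_apply, Matrix.mul_apply, A, B, Matrix.of_apply,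
      ← Finset.sum_add_distrib, ← Finset.sum_sub_distrib]
    refine Finset.sum_congr rfl fun f _ => ?_
    rw [pderiv4_sub ((hdc _ _ _).fun_mul (hdc _ _ _)) ((hdc _ _ _).fun_mul (hdc _ _ _)),
      pderiv4_mul (hdc _ _ _) (hdc _ _ _), pderiv4_mul (hdc _ _ _) (hdc _ _ _)]
  have hc : ∀ e a b, ∑ p, (christoffel G c e p y * riemannUp G a b p d y
        - riemannUp G a b c p y * christoffel G p e d y) = (A e * R a b - R a b * A e) c d := by
    intro e a b
    simp [A, R, Matrix.mul_apply, Finset.sum_sub_distrib]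
  have hcomm := fun a b p i j => pderiv4_comm (hG.smooth_christoffel p i j) hG.isOpen hy a b
  rw [hdR, hdR, hdR, hc, hc, hc, hcomm e a, hcomm e b, hcomm a b]
  have hM : (B e a * A b + A a * B e b - (B e b * A a + A b * B e a)) + (A e * R a b - R a b * A e)
      + ((B a b * A e + A b * B a e - (B a e * A b + A e * B a b)) + (A a * R b e - R b e * A a))
      + ((B b e * A a + A e * B b a - (B b a * A e + A a * B b e)) + (A b * R e a - R e a * A b))
      = 0 := by
    rw [hR, hR, hR]
    noncomm_ring
  have := congrFun (congrFun hM c) d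
  simp only [Matrix.add_apply, Matrix.zero_apply] at this ⊢
  linarith

/-- The differential Bianchi identity. -/
lemma IsMetricOn.covDeriv_riemann_cyclic (hG : IsMetricOn G Ω) (hy : y ∈ Ω) (e a b c d : Fin 4) :
    covDeriv G (riemannTensor G) y ![e, a, b, c, d] +
    covDeriv G (riemannTensor G) y ![a, b, e, c, d] +
    covDeriv G (riemannTensor G) y ![b, e, a, c, d] = 0 := by
  have hd : ∀ i j, DifferentiableAt ℝ (fun z => G z i j) y :=
    fun i j => (hG.smooth i j).differentiableAt hG.isOpen hy
  have hdR : ∀ a b c d, DifferentiableAt ℝ (fun z => riemannUp G a b c d z) y :=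
    fun a b c d => (hG.smooth_riemannUp a b c d).differentiableAt hG.isOpen hy
  have key : ∀ e a b, covDeriv G (riemannTensor G) y ![e, a, b, c, d] =
      ∑ f, G y c f * (pderiv4 e (riemannUp G a b f d) y +
        ∑ p, (christoffel G f e p y * riemannUp G a b p d y
        - riemannUp G a b f p y * christoffel G p e d y))
      - ∑ p, christoffel G p e a y * riemann G p b c d y
      - ∑ p, christoffel G p e b y * riemann G a p c d y := by
    intro e a b
    rw [covDeriv_vecCons]
    simp only [slotAct_vecCons, slotAct_zero_rank, add_zero]
    have h1 : pderiv4 e (fun z => riemannTensor G z ![a, b, c, d]) y =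
        ∑ f, (pderiv4 e (fun z => G z c f) y * riemannUp G a b f d y +
          G y c f * pderiv4 e (fun z => riemannUp G a b f d z) y) := by
      have : (fun z => riemannTensor G z ![a, b, c, d]) =
        fun z => ∑ f, G z c f * riemannUp G a b f d z := rfl
      rw [this, pderiv4_sum _ fun f _ => (hd _ _).fun_mul (hdR _ _ _ _)]
      exact Finset.sum_congr rfl fun f _ => pderiv4_mul (hd _ _) (hdR _ _ _ _) _
    rw [h1]
    simp only [hG.pderiv4_metric hy]
    have e1 : ∀ a b c d, riemannTensor G y ![a, b, c, d] = ∑ f, G y c f * riemannUp G a b f d y :=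
      fun _ _ _ _ => rfl
    simp only [riemann, e1]
    simp only [Fin.sum_univ_four]
    ring
  rw [key, key, key]
  have hB := fun f => hG.riemannUp_bianchi hy e a b f d
  have hs : ∀ x z w v, ∑ p, christoffel G p x z y * riemann G w p v d y =
      - ∑ p, christoffel G p z x y * riemann G p w v d y := by
    intro x z w v
    rw [← Finset.sum_neg_distrib]
    refine Finset.sum_congr rfl fun p _ => ?_
    rw [hG.christoffel_symm hy p x z, riemann_antisymm w p]
    ring
  rw [hs e b a c, hs a e b c, hs b a e c]
  have hsum : ∑ f, G y c f * ((pderiv4 e (riemannUp G a b f d) y +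
      ∑ p, (christoffel G f e p y * riemannUp G a b p d y
        - riemannUp G a b f p y * christoffel G p e d y)) +
    (pderiv4 a (riemannUp G b e f d) y + ∑ p, (christoffel G f a p y * riemannUp G b e p d y
        - riemannUp G b e f p y * christoffel G p a d y)) +
    (pderiv4 b (riemannUp G e a f d) y + ∑ p, (christoffel G f b p y * riemannUp G e a p d y
        - riemannUp G e a f p y * christoffel G p b d y))) = 0 := by
    simp only [hB, mul_zero, Finset.sum_const_zero]
  simp only [mul_add, Finset.sum_add_distrib] at hsum ⊢
  linarith

end Coord

namespace Coord

variable {G : E4 → Matrix (Fin 4) (Fin 4) ℝ} {Ω : Set E4} {y : E4}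

/-! ### The volume form and the Hodge star -/

/-- The sign of `I` as a permutation of `(0, 1, 2, 3)`, and `0` if two indices agree. -/
def leviCivita (I : Fin 4 → Fin 4) : ℝ := (Matrix.of fun s t => if I s = t then (1 : ℝ) else 0).det

lemma volForm_eq (I : Fin 4 → Fin 4) : volForm G y I = Real.sqrt (G y).det * leviCivita I := rfl

/-- A derivation acts on a top-degree form through its trace. Replacing one index of `ε` replaces
one row of a determinant, which gives an entry of the adjugate. -/
lemma slotAct_leviCivita (N : Fin 4 → Fin 4 → ℝ) (I : Fin 4 → Fin 4) :
    slotAct N leviCivita I = (∑ p, N p p) * leviCivita I := by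
  let S : Matrix (Fin 4) (Fin 4) ℝ := Matrix.of fun s t => if I s = t then (1 : ℝ) else 0
  have h1 : ∀ s p, leviCivita (Function.update I s p) = S.adjugate p s := by
    intro s p
    rw [Matrix.adjugate_apply, leviCivita]
    congr 1
    ext i j
    simp only [Matrix.of_apply, Matrix.updateRow_apply, Function.update_apply, S, Pi.single_apply]
    by_cases h : i = s
    · simp [h, eq_comm]
    · simp [h]
  have h2 : ∀ p t, ∑ s, S.adjugate p s * S s t = if p = t then leviCivita I else 0 := by
    intro p t
    rw [← Matrix.mul_apply, Matrix.adjugate_mul, Matrix.smul_apply, Matrix.one_apply]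
    simp [leviCivita, S]
  have h3 : ∀ s p, N p (I s) = ∑ t, N p t * S s t := by
    intro s p
    simp [S]
  simp only [slotAct, h1, h3, Finset.sum_mul]
  rw [Finset.sum_comm]
  refine Finset.sum_congr rfl fun p _ => ?_
  rw [Finset.sum_comm]
  have h4 : ∀ t, ∑ s, N p t * S s t * S.adjugate p s = N p t * if p = t then leviCivita I else 0
    := by
    intro t
    rw [← h2, Finset.mul_sum]
    exact Finset.sum_congr rfl fun s _ => by ring
  simp [h4]

/-- Jacobi's formula. -/
lemma pderiv4_det {A : E4 → Matrix (Fin 4) (Fin 4) ℝ}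
    (hA : ∀ i j, DifferentiableAt ℝ (fun z => A z i j) y) (m : Fin 4) :
    pderiv4 m (fun z => (A z).det) y =
      ∑ s, ∑ i, (A y).adjugate s i * pderiv4 m (fun z => A z i s) y := by
  have hprod : ∀ σ : Equiv.Perm (Fin 4), DifferentiableAt ℝ (fun z => ∏ i, A z (σ i) i) y :=
    fun σ => (HasFDerivAt.finsetProd fun i _ => (hA (σ i) i).hasFDerivAt).differentiableAt
  have h1 : ∀ σ : Equiv.Perm (Fin 4), pderiv4 m (fun z => ∏ i, A z (σ i) i) y =
      ∑ s, ∏ i, (A y).updateCol s (fun i => pderiv4 m (fun z => A z i s) y) (σ i) i := by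
    intro σ
    unfold pderiv4
    rw [fderiv_finsetProd fun i _ => hA _ _]
    simp only [sum_apply, smul_apply, smul_eq_mul]
    refine Finset.sum_congr rfl fun s _ => ?_
    rw [← Finset.prod_erase_mul _ _ (Finset.mem_univ s)]
    congr 1
    · refine Finset.prod_congr rfl fun i hi => ?_
      rw [Matrix.updateCol_ne (Finset.ne_of_mem_erase hi)]
    · simp
  simp only [Matrix.det_apply']
  rw [pderiv4_sum _ fun σ _ => (hprod σ).const_mul _]
  refine (Finset.sum_congr rfl fun σ _ =>
    (pderiv4_const_mul _ (hprod σ) m).trans (congrArg _ (h1 σ))).trans ?_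
  simp only [Finset.mul_sum]
  rw [Finset.sum_comm]
  refine Finset.sum_congr rfl fun s _ => ?_
  rw [← Matrix.det_apply', ← Matrix.cramer_apply, Matrix.cramer_eq_adjugate_mulVec]
  rfl

lemma IsMetricOn.pderiv4_sqrt_det (hG : IsMetricOn G Ω) (hy : y ∈ Ω) (m : Fin 4) :
    pderiv4 m (fun z => Real.sqrt (G z).det) y =
      (∑ p, christoffel G p m p y) * Real.sqrt (G y).det := by
  have hd : ∀ i j, DifferentiableAt ℝ (fun z => G z i j) y :=
    fun i j => (hG.smooth i j).differentiableAt hG.isOpen hy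
  have hdd : DifferentiableAt ℝ (fun z => (G z).det) y :=
    hG.smooth_det.differentiableAt hG.isOpen hy
  have hpos := hG.det_pos hy
  have h1 : pderiv4 m (fun z => (G z).det) y = 2 * (∑ p, christoffel G p m p y) * (G y).det := by
    rw [pderiv4_det hd]
    simp only [hG.pderiv4_metric hy, mul_add, Finset.sum_add_distrib]
    simp only [Finset.mul_sum (s := Finset.univ) (f := fun p => christoffel G p m _ y * _)]
    have e1 : ∀ p s, ∑ i, (G y).adjugate s i * G y i p = if s = p then (G y).det else 0 := by
      intro p s
      rw [← Matrix.mul_apply, Matrix.adjugate_mul, Matrix.smul_apply, Matrix.one_apply]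
      simp
    have e2 : ∀ i p, ∑ s, G y p s * (G y).adjugate s i = if p = i then (G y).det else 0 := by
      intro p s
      rw [← Matrix.mul_apply, Matrix.mul_adjugate, Matrix.smul_apply, Matrix.one_apply]
      simp
    have f1 : ∑ s, ∑ i, ∑ p, (G y).adjugate s i * (christoffel G p m s y * G y i p) =
        (∑ p, christoffel G p m p y) * (G y).det := by
      rw [Finset.sum_mul]
      refine Finset.sum_congr rfl fun s _ => ?_
      rw [Finset.sum_comm]
      have : ∀ p, ∑ i, (G y).adjugate s i * (christoffel G p m s y * G y i p) =
          christoffel G p m s y * if s = p then (G y).det else 0 := by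
        intro p
        rw [← e1, Finset.mul_sum]
        exact Finset.sum_congr rfl fun i _ => by ring
      simp [this]
    have f2 : ∑ s, ∑ i, ∑ p, (G y).adjugate s i * (christoffel G p m i y * G y p s) =
        (∑ p, christoffel G p m p y) * (G y).det := by
      rw [Finset.sum_comm, Finset.sum_mul]
      refine Finset.sum_congr rfl fun i _ => ?_
      rw [Finset.sum_comm]
      have : ∀ p, ∑ s, (G y).adjugate s i * (christoffel G p m i y * G y p s) =
          christoffel G p m i y * if p = i then (G y).det else 0 := by
        intro p
        rw [← e2, Finset.mul_sum]
        exact Finset.sum_congr rfl fun i _ => by ring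
      simp [this]
    rw [f1, f2]
    ring
  have h2 : pderiv4 m (fun z => Real.sqrt (G z).det) y =
      1 / (2 * Real.sqrt (G y).det) * pderiv4 m (fun z => (G z).det) y := by
    unfold pderiv4
    rw [fderiv_sqrt hdd hpos.ne']
    rfl
  rw [h2, h1]
  generalize ∑ p, christoffel G p m p y = t
  have h3 := Real.sqrt_pos.2 hpos
  have h4 := Real.sq_sqrt hpos.le
  field_simp
  rw [h4]; ring

/-- The volume form is parallel. -/
lemma IsMetricOn.pderiv4_volForm (hG : IsMetricOn G Ω) (hy : y ∈ Ω) (m : Fin 4)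
    (I : Fin 4 → Fin 4) :
    pderiv4 m (fun z => volForm G z I) y =
      slotAct (fun p i => christoffel G p m i y) (volForm G y) I := by
  have hd : DifferentiableAt ℝ (fun z => Real.sqrt (G z).det) y :=
    (hG.smooth_det.differentiableAt hG.isOpen hy).sqrt (hG.det_pos hy).ne'
  have h1 : slotAct (fun p i => christoffel G p m i y) (volForm G y) I =
      Real.sqrt (G y).det * slotAct (fun p i => christoffel G p m i y) leviCivita I := by
    rw [← slotAct_const_mul]; rfl
  rw [h1, slotAct_leviCivita]
  have h2 : (fun z => volForm G z I) = fun z => leviCivita I * Real.sqrt (G z).det := by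
    funext z; rw [volForm_eq, mul_comm]
  rw [h2, pderiv4_const_mul _ hd, hG.pderiv4_sqrt_det hy]
  ring

/-- The Hodge star on two-forms, as an operator `ω_{pq} ↦ ½ ε_{ab}{}^{pq} ω_{pq}`. -/
def starKernel (G : E4 → Matrix (Fin 4) (Fin 4) ℝ) (a b p q : Fin 4) (y : E4) : ℝ :=
  (1 / 2) * ∑ c, ∑ d, volForm G y ![a, b, c, d] * (G y)⁻¹ c p * (G y)⁻¹ d q

lemma IsMetricOn.differentiableAt_starKernel (hG : IsMetricOn G Ω) (hy : y ∈ Ω)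
    (a b p q : Fin 4) : DifferentiableAt ℝ (fun z => starKernel G a b p q z) y := by
  have hd : DifferentiableAt ℝ (fun z => Real.sqrt (G z).det) y :=
    (hG.smooth_det.differentiableAt hG.isOpen hy).sqrt (hG.det_pos hy).ne'
  have hdi : ∀ i j, DifferentiableAt ℝ (fun z => (G z)⁻¹ i j) y :=
    fun i j => (hG.smooth_inv i j).differentiableAt hG.isOpen hy
  refine DifferentiableAt.const_mul (DifferentiableAt.fun_sum fun c _ =>
    DifferentiableAt.fun_sum fun d _ => ((hd.mul_const _).fun_mul (hdi _ _)).fun_mul (hdi _ _)) _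

/-- The kernel of `⋆` is built from `ε` and `g⁻¹`, both parallel. Its covariant derivative as a
tensor with two lower and two upper indices therefore vanishes, and this is that statement written
out. -/
lemma IsMetricOn.pderiv4_starKernel (hG : IsMetricOn G Ω) (hy : y ∈ Ω) (m a b p q : Fin 4) :
    pderiv4 m (fun z => starKernel G a b p q z) y =
      ∑ x, christoffel G x m a y * starKernel G x b p q y
      + ∑ x, christoffel G x m b y * starKernel G a x p q y
      - ∑ x, christoffel G p m x y * starKernel G a b x q y
      - ∑ x, christoffel G q m x y * starKernel G a b p x y := by
  have hd : ∀ I, DifferentiableAt ℝ (fun z => volForm G z I) y := fun I =>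
    ((hG.smooth_det.differentiableAt hG.isOpen hy).sqrt (hG.det_pos hy).ne').mul_const _
  have hdi : ∀ i j, DifferentiableAt ℝ (fun z => (G z)⁻¹ i j) y :=
    fun i j => (hG.smooth_inv i j).differentiableAt hG.isOpen hy
  have h1 : pderiv4 m (fun z => starKernel G a b p q z) y = (1 / 2) * ∑ c, ∑ d,
      ((pderiv4 m (fun z => volForm G z ![a, b, c, d]) y * (G y)⁻¹ c p
        + volForm G y ![a, b, c, d] * pderiv4 m (fun z => (G z)⁻¹ c p) y) * (G y)⁻¹ d q
        + volForm G y ![a, b, c, d] * (G y)⁻¹ c p * pderiv4 m (fun z => (G z)⁻¹ d q) y) := by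
    unfold starKernel
    rw [pderiv4_const_mul _ (DifferentiableAt.fun_sum fun c _ => DifferentiableAt.fun_sum fun d _ =>
      ((hd _).fun_mul (hdi _ _)).fun_mul (hdi _ _)), pderiv4_sum _ (fun c _ =>
      DifferentiableAt.fun_sum fun d _ => ((hd _).fun_mul (hdi _ _)).fun_mul (hdi _ _))]
    congr 1
    refine Finset.sum_congr rfl fun c _ => ?_
    rw [pderiv4_sum _ (fun d _ => ((hd _).fun_mul (hdi _ _)).fun_mul (hdi _ _))]
    refine Finset.sum_congr rfl fun d _ => ?_
    rw [pderiv4_mul ((hd _).fun_mul (hdi _ _)) (hdi _ _), pderiv4_mul (hd _) (hdi _ _)]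
  rw [h1]
  simp only [hG.pderiv4_volForm hy, hG.pderiv4_inv hy, slotAct_vecCons, slotAct_zero_rank, add_zero,
    starKernel]
  generalize (G y)⁻¹ = H
  generalize volForm G y = V
  simp only [add_mul, mul_add, sub_mul, mul_sub, neg_mul, mul_neg, Finset.sum_add_distrib,
    Finset.sum_sub_distrib, Finset.mul_sum, Finset.sum_mul, Finset.sum_neg_distrib]
  simp only [Fin.sum_univ_four]
  ring

end Coord

namespace Coord

variable {G : E4 → Matrix (Fin 4) (Fin 4) ℝ} {Ω : Set E4} {y : E4}

/-- Being an eigentensor of the Hodge star in the first two indices is preserved by covariant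
differentiation. -/
lemma covDeriv_starKernel_eq {k : ℕ} {T : CoordTensor (k + 2)} (hT : SmoothTensor Ω T)
    (hG : IsMetricOn G Ω) (c : ℝ)
    (h : ∀ z ∈ Ω, ∀ a b I, ∑ p, ∑ q, starKernel G a b p q z *
      T z (Fin.cons p (Fin.cons q I : Fin (k + 1) → Fin 4)) =
      c * T z (Fin.cons a (Fin.cons b I : Fin (k + 1) → Fin 4)))
    (hy : y ∈ Ω) (m a b : Fin 4) (I : Fin k → Fin 4) :
    ∑ p, ∑ q, starKernel G a b p q y * covDeriv G T y
      (Fin.cons m (Fin.cons p (Fin.cons q I : Fin (k + 1) → Fin 4) : Fin (k + 2) → Fin 4)) =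
      c * covDeriv G T y
        (Fin.cons m (Fin.cons a (Fin.cons b I : Fin (k + 1) → Fin 4) : Fin (k + 2) → Fin 4)) := by
  have hd := fun I => hT.differentiableAt hG.isOpen hy I
  have hK := fun a b p q => hG.differentiableAt_starKernel hy a b p q
  -- The relation is differentiated as an equality of functions on `Ω`. Christoffel terms on `a`,
  -- `b` are reabsorbed by the relation itself; those on `p`, `q` match the slot actions on `T`.
  have h1 := pderiv4_congr hG.isOpen hy (fun z hz => h z hz a b I) m
  rw [pderiv4_const_mul _ (hd _), pderiv4_sum _ (fun p _ => DifferentiableAt.fun_sum fun q _ =>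
    (hK _ _ _ _).fun_mul (hd _))] at h1
  have h2 : ∀ p, pderiv4 m (fun z => ∑ q, starKernel G a b p q z *
      T z (Fin.cons p (Fin.cons q I : Fin (k + 1) → Fin 4))) y =
      ∑ q, (pderiv4 m (fun z => starKernel G a b p q z) y *
        T y (Fin.cons p (Fin.cons q I : Fin (k + 1) → Fin 4)) + starKernel G a b p q y *
        pderiv4 m (fun z => T z (Fin.cons p (Fin.cons q I : Fin (k + 1) → Fin 4))) y) := by
    intro p
    rw [pderiv4_sum _ (fun q _ => (hK _ _ _ _).fun_mul (hd _))]
    exact Finset.sum_congr rfl fun q _ => pderiv4_mul (hK _ _ _ _) (hd _) m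
  simp only [h2, hG.pderiv4_starKernel hy] at h1
  have h3 : ∑ p, ∑ q, starKernel G a b p q y * slotAct (fun p i => christoffel G p m i y)
      (fun J => T y (Fin.cons p (Fin.cons q J : Fin (k + 1) → Fin 4))) I =
      c * slotAct (fun p i => christoffel G p m i y)
      (fun J => T y (Fin.cons a (Fin.cons b J : Fin (k + 1) → Fin 4))) I := by
    rw [← slotAct_const_mul]
    simp only [← h y hy a b, slotAct_sum, slotAct_const_mul]
  have h4 := fun x => h y hy x b I
  have h5 := fun x => h y hy a x I
  simp only [covDeriv_cons, slotAct_cons, mul_sub, mul_add, Finset.sum_sub_distrib,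
    Finset.sum_add_distrib]
  rw [h3]
  have h6 : c * ∑ x, christoffel G x m a y *
      T y (Fin.cons x (Fin.cons b I : Fin (k + 1) → Fin 4)) =
      ∑ x, christoffel G x m a y * ∑ p, ∑ q, starKernel G x b p q y *
      T y (Fin.cons p (Fin.cons q I : Fin (k + 1) → Fin 4)) := by
    rw [Finset.mul_sum]
    exact Finset.sum_congr rfl fun x _ => by rw [h4]; ring
  have h7 : c * ∑ x, christoffel G x m b y *
      T y (Fin.cons a (Fin.cons x I : Fin (k + 1) → Fin 4)) =
      ∑ x, christoffel G x m b y * ∑ p, ∑ q, starKernel G a x p q y *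
      T y (Fin.cons p (Fin.cons q I : Fin (k + 1) → Fin 4)) := by
    rw [Finset.mul_sum]
    exact Finset.sum_congr rfl fun x _ => by rw [h5]; ring
  rw [h6, h7, ← h1]
  generalize (fun p q => pderiv4 m (fun z =>
    T z (Fin.cons p (Fin.cons q I : Fin (k + 1) → Fin 4))) y) = D
  simp only [Fin.sum_univ_four]
  ring

lemma hodgeStar_eq_starKernel (T : CoordTensor 4) (i j k l : Fin 4) :
    hodgeStar G T y ![i, j, k, l] = ∑ p, ∑ q, starKernel G i j p q y * T y ![p, q, k, l] := by
  simp only [hodgeStar, starKernel, Finset.mul_sum, Finset.sum_mul]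
  have e1 : ∀ F : Fin 4 → Fin 4 → Fin 4 → Fin 4 → ℝ,
      ∑ a, ∑ b, ∑ p, ∑ q, F a b p q = ∑ p, ∑ q, ∑ a, ∑ b, F a b p q := by
    intro F
    simp only [Fin.sum_univ_four]
    ring
  rw [e1]
  refine Finset.sum_congr rfl fun p _ => Finset.sum_congr rfl fun q _ =>
    Finset.sum_congr rfl fun a _ => Finset.sum_congr rfl fun b _ => ?_
  simp only [Matrix.cons_val]
  ring

/-! ### The Schouten and Weyl tensors -/

/-- The Schouten tensor as a covariant tensor field. -/
def schoutenTensor (G : E4 → Matrix (Fin 4) (Fin 4) ℝ) : CoordTensor 2 := fun y I =>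
  schouten G (I 0) (I 1) y

namespace IsMetricOn

lemma smooth_schoutenTensor (hG : IsMetricOn G Ω) : SmoothTensor Ω (schoutenTensor G) :=
  fun _ => hG.smooth_schouten _ _

lemma smooth_weyl (hG : IsMetricOn G Ω) : SmoothTensor Ω (weyl G) := fun I => by
  have h := fun i j a b => (hG.smooth i j).mul (hG.smooth_schouten a b)
  exact (hG.smooth_riemann _ _ _ _).sub ((((h _ _ _ _).sub (h _ _ _ _)).add (h _ _ _ _)).sub
    (h _ _ _ _))

lemma ricci_eq_trace (hG : IsMetricOn G Ω) (hy : y ∈ Ω) (b d : Fin 4) :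
    ricci G b d y = ∑ a, ∑ c, (G y)⁻¹ a c * riemann G a b c d y := by
  unfold ricci riemann
  refine Finset.sum_congr rfl fun a _ => ?_
  simp only [Finset.mul_sum, ← mul_assoc]
  rw [Finset.sum_comm]
  simp only [← Finset.sum_mul, hG.inv_mul_apply hy]
  simp

lemma ricci_symm (hG : IsMetricOn G Ω) (hy : y ∈ Ω) (b d : Fin 4) :
    ricci G b d y = ricci G d b y := by
  rw [hG.ricci_eq_trace hy, hG.ricci_eq_trace hy, Finset.sum_comm]
  refine Finset.sum_congr rfl fun a _ => Finset.sum_congr rfl fun c _ => ?_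
  rw [hG.inv_symm hy, hG.riemann_pair_symm hy]

lemma schouten_symm (hG : IsMetricOn G Ω) (hy : y ∈ Ω) (a b : Fin 4) :
    schouten G a b y = schouten G b a y := by
  simp only [schouten, hG.ricci_symm hy a b, hG.symm hy a b]

lemma trace_metric (hG : IsMetricOn G Ω) (hy : y ∈ Ω) :
    ∑ a, ∑ b, (G y)⁻¹ a b * G y a b = 4 := by
  have : ∀ a, ∑ b, (G y)⁻¹ a b * G y a b = 1 := by
    intro a
    have := hG.inv_mul_apply hy a a
    simp only [if_true] at this
    rw [← this]
    exact Finset.sum_congr rfl fun b _ => by rw [hG.symm hy]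
  simp [this]

lemma traceJ_eq (hG : IsMetricOn G Ω) (hy : y ∈ Ω) : traceJ G y = scalarCurv G y / 6 := by
  have h : traceJ G y = (1 / 2) * (scalarCurv G y - scalarCurv G y / 6 *
      ∑ a, ∑ b, (G y)⁻¹ a b * G y a b) := by
    simp only [traceJ, schouten]
    conv_rhs => enter [2, 1]; rw [scalarCurv]
    simp only [Finset.mul_sum, ← Finset.sum_sub_distrib]
    exact Finset.sum_congr rfl fun a _ => Finset.sum_congr rfl fun b _ => by ring
  rw [h, hG.trace_metric hy]
  ring

lemma ricci_eq_schouten (hG : IsMetricOn G Ω) (hy : y ∈ Ω) (a b : Fin 4) :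
    ricci G a b y = 2 * schouten G a b y + traceJ G y * G y a b := by
  rw [hG.traceJ_eq hy, schouten]; ring

lemma weyl_pair_symm (hG : IsMetricOn G Ω) (hy : y ∈ Ω) (a b c d : Fin 4) :
    weyl G y ![c, d, a, b] = weyl G y ![a, b, c, d] := by
  have := hG.riemann_pair_symm hy a b c d
  simp only [weyl, Matrix.cons_val]
  rw [this, hG.symm hy a c, hG.symm hy a d, hG.symm hy b c, hG.symm hy b d,
    hG.schouten_symm hy d b, hG.schouten_symm hy c b, hG.schouten_symm hy d a,
    hG.schouten_symm hy c a]
  ring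

/-- The Schouten part has trace `4P - P - P + J g = 2P + J g`, which is the Ricci tensor exactly in
dimension four. -/
lemma weyl_trace_free (hG : IsMetricOn G Ω) (hy : y ∈ Ω) (b d : Fin 4) :
    ∑ a, ∑ c, (G y)⁻¹ a c * weyl G y ![a, b, c, d] = 0 := by
  have h : ∑ a, ∑ c, (G y)⁻¹ a c * weyl G y ![a, b, c, d] =
      ricci G b d y - ((∑ a, ∑ c, (G y)⁻¹ a c * G y a c) * schouten G b d y
        - ∑ a, (∑ c, (G y)⁻¹ a c * G y c b) * schouten G a d y
        + traceJ G y * G y d b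
        - ∑ c, (∑ a, G y d a * (G y)⁻¹ a c) * schouten G b c y) := by
    have e1 : ∑ c, (∑ a, G y d a * (G y)⁻¹ a c) * schouten G b c y =
        ∑ a, ∑ c, (G y)⁻¹ a c * (G y d a * schouten G b c y) := by
      simp only [Finset.sum_mul]
      rw [Finset.sum_comm]
      exact Finset.sum_congr rfl fun a _ => Finset.sum_congr rfl fun c _ => by ring
    rw [hG.ricci_eq_trace hy, e1, traceJ]
    simp only [weyl, Matrix.cons_val, Finset.sum_mul, ← Finset.sum_sub_distrib,
      ← Finset.sum_add_distrib]
    refine Finset.sum_congr rfl fun a _ => Finset.sum_congr rfl fun c _ => ?_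
    rw [hG.symm hy a c]
    ring
  rw [h, hG.trace_metric hy, hG.ricci_eq_schouten hy]
  simp only [hG.inv_mul_apply hy, hG.mul_inv_apply hy, ite_mul, one_mul, zero_mul,
    Finset.sum_ite_eq, Finset.sum_ite_eq', Finset.mem_univ, if_true]
  rw [hG.symm hy b d]
  ring

/-- Since `∇g = 0`, the splitting of the curvature into Weyl and Schouten parts is preserved by `∇`.
-/
lemma covDeriv_weyl (hG : IsMetricOn G Ω) (hy : y ∈ Ω) (e a b c d : Fin 4) :
    covDeriv G (weyl G) y ![e, a, b, c, d] = covDeriv G (riemannTensor G) y ![e, a, b, c, d]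
      - (G y c a * covDeriv G (schoutenTensor G) y ![e, b, d]
        - G y c b * covDeriv G (schoutenTensor G) y ![e, a, d]
        + G y d b * covDeriv G (schoutenTensor G) y ![e, a, c]
        - G y d a * covDeriv G (schoutenTensor G) y ![e, b, c]) := by
  have hd : ∀ i j, DifferentiableAt ℝ (fun z => G z i j) y :=
    fun i j => (hG.smooth i j).differentiableAt hG.isOpen hy
  have hP : ∀ a b, DifferentiableAt ℝ (fun z => schouten G a b z) y :=
    fun a b => (hG.smooth_schouten a b).differentiableAt hG.isOpen hy
  have hR : ∀ a b c d, DifferentiableAt ℝ (fun z => riemann G a b c d z) y :=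
    fun a b c d => (hG.smooth_riemann a b c d).differentiableAt hG.isOpen hy
  have hm := fun i j k l => (hd i j).fun_mul (hP k l)
  have h1 : pderiv4 e (fun z => weyl G z ![a, b, c, d]) y =
      pderiv4 e (fun z => riemann G a b c d z) y -
      (pderiv4 e (fun z => G z c a * schouten G b d z) y
        - pderiv4 e (fun z => G z c b * schouten G a d z) y
        + pderiv4 e (fun z => G z d b * schouten G a c z) y
        - pderiv4 e (fun z => G z d a * schouten G b c z) y) := by
    simp only [weyl, Matrix.cons_val]
    rw [pderiv4_sub (hR _ _ _ _) ((((hm _ _ _ _).fun_sub (hm _ _ _ _)).fun_add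
        (hm _ _ _ _)).fun_sub (hm _ _ _ _)),
      pderiv4_sub (((hm _ _ _ _).fun_sub (hm _ _ _ _)).fun_add (hm _ _ _ _)) (hm _ _ _ _),
      pderiv4_add ((hm _ _ _ _).fun_sub (hm _ _ _ _)) (hm _ _ _ _),
      pderiv4_sub (hm _ _ _ _) (hm _ _ _ _)]
  simp only [covDeriv_vecCons, slotAct_vecCons, slotAct_zero_rank, add_zero]
  rw [h1]
  simp only [pderiv4_mul (hd _ _) (hP _ _), hG.pderiv4_metric hy]
  simp only [weyl, riemannTensor, schoutenTensor, Matrix.cons_val]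
  simp only [Fin.sum_univ_four]
  ring

lemma pderiv4_traceJ (hG : IsMetricOn G Ω) (hy : y ∈ Ω) (m : Fin 4) :
    pderiv4 m (traceJ G) y =
      ∑ a, ∑ b, (G y)⁻¹ a b * covDeriv G (schoutenTensor G) y ![m, a, b] := by
  have h := covDeriv_traceHead hG.smooth_schoutenTensor hG hy m ![]
  rw [covDeriv_cons, slotAct_zero_rank, sub_zero] at h
  exact h

end IsMetricOn
end Coord

namespace Coord

variable {G : E4 → Matrix (Fin 4) (Fin 4) ℝ} {Ω : Set E4} {y : E4}

/-! ### Components with respect to a frame -/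

/-- The components of the covariant array `T` in the frame whose vectors are the columns of `E`. -/
def pull (E : Matrix (Fin 4) (Fin 4) ℝ) {k : ℕ} (T : (Fin k → Fin 4) → ℝ) :
    (Fin k → Fin 4) → ℝ := fun I => ∑ J : Fin k → Fin 4, (∏ s, E (J s) (I s)) * T J

variable (E : Matrix (Fin 4) (Fin 4) ℝ)

lemma pull_zero_rank (T : (Fin 0 → Fin 4) → ℝ) (I) : pull E T I = T I := by
  simp only [pull, Finset.univ_unique, Finset.sum_singleton, Finset.univ_eq_empty,
    Finset.prod_empty, one_mul]
  congr 1
  exact Subsingleton.elim _ _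

lemma pull_cons {k : ℕ} (T : (Fin (k + 1) → Fin 4) → ℝ) (a : Fin 4) (I : Fin k → Fin 4) :
    pull E T (Fin.cons a I : Fin (k + 1) → Fin 4) =
      ∑ b, E b a * pull E (fun J => T (Fin.cons b J : Fin (k + 1) → Fin 4)) I := by
  simp only [pull]
  rw [← (Fin.consEquiv fun _ => Fin 4).sum_comp, Fintype.sum_prod_type]
  refine Finset.sum_congr rfl fun b _ => ?_
  rw [Finset.mul_sum]
  refine Finset.sum_congr rfl fun J _ => ?_
  simp [Fin.prod_univ_succ, Fin.consEquiv, mul_assoc]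

lemma pull_add {k : ℕ} (S T : (Fin k → Fin 4) → ℝ) (I) :
    pull E (fun J => S J + T J) I = pull E S I + pull E T I := by
  simp only [pull, mul_add, Finset.sum_add_distrib]

lemma pull_sub {k : ℕ} (S T : (Fin k → Fin 4) → ℝ) (I) :
    pull E (fun J => S J - T J) I = pull E S I - pull E T I := by
  simp only [pull, mul_sub, Finset.sum_sub_distrib]

lemma pull_neg {k : ℕ} (T : (Fin k → Fin 4) → ℝ) (I) :
    pull E (fun J => - T J) I = - pull E T I := by
  simp only [pull, mul_neg, Finset.sum_neg_distrib]

lemma pull_const_mul {k : ℕ} (c : ℝ) (T : (Fin k → Fin 4) → ℝ) (I) :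
    pull E (fun J => c * T J) I = c * pull E T I := by
  simp only [pull, Finset.mul_sum]
  exact Finset.sum_congr rfl fun J _ => by ring

lemma pull_sum {ι : Type*} (s : Finset ι) {k : ℕ} (T : ι → (Fin k → Fin 4) → ℝ) (I) :
    pull E (fun J => ∑ x ∈ s, T x J) I = ∑ x ∈ s, pull E (T x) I := by
  simp only [pull, Finset.mul_sum]
  exact Finset.sum_comm

lemma pull_zero {k : ℕ} (I) : pull E (fun _ : Fin k → Fin 4 => 0) I = 0 := by simp [pull]

lemma pull_reindex {k : ℕ} (T : (Fin k → Fin 4) → ℝ) (σ : Equiv.Perm (Fin k)) (I) :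
    pull E (fun J => T (J ∘ σ)) I = pull E T (I ∘ σ) := by
  simp only [pull]
  rw [← (Equiv.arrowCongr σ (Equiv.refl (Fin 4))).sum_comp]
  refine Finset.sum_congr rfl fun J _ => ?_
  congr 1
  · rw [← Equiv.prod_comp σ]
    simp [Equiv.arrowCongr]
  · congr 1
    funext s
    simp [Equiv.arrowCongr]

lemma pull_cons_cons {k : ℕ} (T : (Fin (k + 2) → Fin 4) → ℝ) (a b : Fin 4) (I : Fin k → Fin 4) :
    pull E T (Fin.cons a (Fin.cons b I : Fin (k + 1) → Fin 4) : Fin (k + 2) → Fin 4) =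
      ∑ p, ∑ q, E p a * E q b * pull E (fun J => T
        (Fin.cons p (Fin.cons q J : Fin (k + 1) → Fin 4) : Fin (k + 2) → Fin 4)) I := by
  rw [pull_cons]
  refine Finset.sum_congr rfl fun p _ => ?_
  rw [pull_cons, Finset.mul_sum]
  exact Finset.sum_congr rfl fun q _ => by ring

lemma pull_two (T : (Fin 2 → Fin 4) → ℝ) (a b : Fin 4) :
    pull E T ![a, b] = ∑ p, ∑ q, E p a * E q b * T ![p, q] := by
  have h := pull_cons_cons E T a b ![]
  simp only [pull_zero_rank] at h
  exact h

lemma pull_prodHead (S : CoordTensor 2) {k : ℕ} (T : CoordTensor k) (a b : Fin 4)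
    (I : Fin k → Fin 4) :
    pull E (prodHead S T y) (Fin.cons a (Fin.cons b I : Fin (k + 1) → Fin 4)) =
      pull E (S y) ![a, b] * pull E (T y) I := by
  rw [pull_cons_cons, pull_two]
  simp only [prodHead_cons, pull_const_mul, Finset.sum_mul, mul_assoc]

variable {E}

/-- This is the way back from frame components to coordinates: an invertible frame matrix is undone
one slot at a time. -/
lemma eq_zero_of_pull_eq_zero (hE : IsUnit E.det) {k : ℕ} {T : (Fin k → Fin 4) → ℝ}
    (h : ∀ I, pull E T I = 0) (I) : T I = 0 := by
  induction k with
  | zero => rw [← pull_zero_rank E T I, h]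
  | succ k ih =>
    obtain ⟨a, I, rfl⟩ : ∃ a J, I = (Fin.cons a J : Fin (k + 1) → Fin 4) :=
      ⟨I 0, Fin.tail I, (Fin.cons_self_tail I).symm⟩
    refine ih (T := fun J => T (Fin.cons a J : Fin (k + 1) → Fin 4)) (fun J => ?_) I
    let v : Fin 4 → ℝ := fun b => pull E (fun K => T (Fin.cons b K : Fin (k + 1) → Fin 4)) J
    have hv : v ᵥ* E = 0 := by
      funext b
      have := h (Fin.cons b J : Fin (k + 1) → Fin 4)
      rw [pull_cons] at this
      simp only [Matrix.vecMul, dotProduct, Pi.zero_apply, ← this, v]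
      exact Finset.sum_congr rfl fun c _ => by ring
    have : v = 0 := by
      rw [← Matrix.vecMul_one v, ← Matrix.mul_nonsing_inv E hE, ← Matrix.vecMul_vecMul, hv,
        Matrix.zero_vecMul]
    exact congrFun this a

/-- The hypothesis reads `N E = E N'`: `N'` is the same endomorphism expressed in the frame. -/
lemma pull_slotAct {N N' : Fin 4 → Fin 4 → ℝ}
    (h : ∀ p a, ∑ i, N p i * E i a = ∑ c, E p c * N' c a) {k : ℕ} (T : (Fin k → Fin 4) → ℝ) (I) :
    pull E (slotAct N T) I = slotAct N' (pull E T) I := by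
  induction k with
  | zero =>
    rw [pull_zero_rank, slotAct_zero_rank, slotAct_zero_rank]
  | succ k ih =>
    obtain ⟨a, I, rfl⟩ : ∃ a J, I = (Fin.cons a J : Fin (k + 1) → Fin 4) :=
      ⟨I 0, Fin.tail I, (Fin.cons_self_tail I).symm⟩
    rw [pull_cons, slotAct_cons]
    simp only [slotAct_cons, pull_cons, pull_add, pull_sum, pull_const_mul, slotAct_sum,
      slotAct_const_mul, mul_add, Finset.sum_add_distrib, ← ih]
    congr 1
    simp only [Finset.mul_sum, ← mul_assoc]
    rw [Finset.sum_comm]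
    conv_rhs => rw [Finset.sum_comm]
    refine Finset.sum_congr rfl fun p _ => ?_
    rw [← Finset.sum_mul, ← Finset.sum_mul]
    congr 1
    rw [Finset.sum_congr rfl fun i _ => mul_comm (E i a) (N p i), h]
    exact Finset.sum_congr rfl fun c _ => mul_comm _ _

/-- The product rule for determinants applied to `S Eᵀ`, where the rows of `S` select the indices
`I`; the sum over `J` is the multilinear expansion of that determinant in its rows. -/
lemma pull_leviCivita (I : Fin 4 → Fin 4) : pull E leviCivita I = E.det * leviCivita I := by
  let S : Matrix (Fin 4) (Fin 4) ℝ := Matrix.of fun s t => if I s = t then (1 : ℝ) else 0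
  have h1 : E.det * leviCivita I = (S * Eᵀ).det := by
    rw [Matrix.det_mul, Matrix.det_transpose, mul_comm]; rfl
  have h2 : S * Eᵀ = fun s => ∑ j, E j (I s) • (Pi.single j 1 : Fin 4 → ℝ) := by
    funext s t
    simp [S, Matrix.mul_apply, Finset.sum_apply, Pi.single_apply]
  have h3 := (Matrix.detRowAlternating (n := Fin 4) (R := ℝ)).toMultilinearMap.map_sum
    (fun s j => E j (I s) • (Pi.single j 1 : Fin 4 → ℝ))
  rw [h1, h2]
  change _ = (Matrix.detRowAlternating (n := Fin 4) (R := ℝ)).toMultilinearMap _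
  rw [h3, pull]
  refine Finset.sum_congr rfl fun J _ => ?_
  rw [MultilinearMap.map_smul_univ, smul_eq_mul]
  congr 1
  change _ = Matrix.det _
  rw [leviCivita]
  congr 1
  ext s t
  simp [Pi.single_apply, eq_comm]

/-- The columns of `E` are a positively oriented orthonormal frame for the metric `g`. -/
structure IsOrthonormalFrame (g E : Matrix (Fin 4) (Fin 4) ℝ) : Prop where
  orthonormal : Eᵀ * g * E = 1
  det_pos : 0 < E.det

open scoped MatrixOrder Matrix.Norms.L2Operator in
lemma exists_isOrthonormalFrame {g : Matrix (Fin 4) (Fin 4) ℝ} (hg : g.PosDef) :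
    ∃ E, IsOrthonormalFrame g E := by
  -- A factorisation `g = Bᵀ B` makes the columns of `B⁻¹` orthonormal.
  obtain ⟨B, hB⟩ := CStarAlgebra.nonneg_iff_eq_star_mul_self.mp hg.posSemidef.nonneg
  have hB' : g = Bᵀ * B := by rw [hB, Matrix.star_eq_conjTranspose,
    Matrix.conjTranspose_eq_transpose_of_trivial]
  have hdet : B.det ≠ 0 := by
    intro h
    have := hg.det_pos
    rw [hB', Matrix.det_mul, h, mul_zero] at this
    exact lt_irrefl _ this
  have h1 : B⁻¹ᵀ * g * B⁻¹ = 1 := by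
    rw [hB', ← Matrix.mul_assoc, ← Matrix.transpose_mul, Matrix.mul_nonsing_inv _ hdet.isUnit,
      Matrix.transpose_one, Matrix.one_mul, Matrix.mul_nonsing_inv _ hdet.isUnit]
  have h2 : B⁻¹.det ≠ 0 := by
    rw [Matrix.det_nonsing_inv, Ring.inverse_eq_inv']
    exact inv_ne_zero hdet
  rcases lt_or_gt_of_ne h2 with h | h
  -- Reversing the first frame vector corrects a negative orientation.
  · let D : Matrix (Fin 4) (Fin 4) ℝ := Matrix.diagonal ![-1, 1, 1, 1]
    refine ⟨B⁻¹ * D, ?_, ?_⟩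
    · have hD : Dᵀ * D = 1 := by
        rw [Matrix.diagonal_transpose, Matrix.diagonal_mul_diagonal, ← Matrix.diagonal_one]
        congr 1
        funext i
        fin_cases i <;> simp
      calc (B⁻¹ * D)ᵀ * g * (B⁻¹ * D) = Dᵀ * (B⁻¹ᵀ * g * B⁻¹) * D := by
            rw [Matrix.transpose_mul]; simp only [Matrix.mul_assoc]
        _ = 1 := by rw [h1, Matrix.mul_one, hD]
    · rw [Matrix.det_mul, Matrix.det_diagonal]
      simp only [Fin.prod_univ_four, Matrix.cons_val]
      linarith
  · exact ⟨B⁻¹, h1, h⟩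

lemma sum_four_swap (F : Fin 4 → Fin 4 → Fin 4 → Fin 4 → ℝ) :
    ∑ a, ∑ b, ∑ p, ∑ q, F a b p q = ∑ p, ∑ q, ∑ a, ∑ b, F a b p q := by
  rw [Finset.sum_congr rfl fun (a : Fin 4) _ => Finset.sum_comm, Finset.sum_comm]
  refine Finset.sum_congr rfl fun p _ => ?_
  rw [Finset.sum_congr rfl fun (a : Fin 4) _ => Finset.sum_comm, Finset.sum_comm]

lemma sum_mul_sandwich (c : ℝ) (W X Z : Fin 4 → Fin 4 → ℝ) :
    ∑ p, ∑ q, (c * ∑ m, ∑ n, W m n * (Z p m * Z q n)) * X p q =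
      c * ∑ m, ∑ n, W m n * ∑ p, ∑ q, Z p m * Z q n * X p q := by
  simp only [Finset.mul_sum, Finset.sum_mul]
  rw [sum_four_swap]
  refine Finset.sum_congr rfl fun m _ => Finset.sum_congr rfl fun n _ =>
    Finset.sum_congr rfl fun p _ => Finset.sum_congr rfl fun q _ => by ring

lemma sum_mul_swap (c : ℝ) (e : Fin 4 → Fin 4 → ℝ) (Z : Fin 4 → Fin 4 → Fin 4 → Fin 4 → ℝ) :
    ∑ a, ∑ b, e a b * (c * ∑ m, ∑ n, Z a b m n) = c * ∑ m, ∑ n, ∑ a, ∑ b, e a b * Z a b m n := by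
  simp only [Finset.mul_sum]
  rw [sum_four_swap]
  refine Finset.sum_congr rfl fun m _ => Finset.sum_congr rfl fun n _ =>
    Finset.sum_congr rfl fun p _ => Finset.sum_congr rfl fun q _ => by ring

namespace IsOrthonormalFrame

variable {g : Matrix (Fin 4) (Fin 4) ℝ}

lemma isUnit_det (h : IsOrthonormalFrame g E) : IsUnit E.det := h.det_pos.ne'.isUnit

lemma inv_eq (h : IsOrthonormalFrame g E) : g⁻¹ = E * Eᵀ := by
  have h1 : E * (Eᵀ * g) = 1 := mul_eq_one_comm.1 h.orthonormal
  exact Matrix.inv_eq_left_inv (by rw [Matrix.mul_assoc, h1])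

lemma inv_apply (h : IsOrthonormalFrame g E) (a b : Fin 4) : g⁻¹ a b = ∑ c, E a c * E b c := by
  rw [h.inv_eq, Matrix.mul_apply]; rfl

/-- Positive orientation fixes the sign of the square root, so the volume form has component `1` on
the frame. -/
lemma sqrt_det_mul (h : IsOrthonormalFrame g E) : Real.sqrt g.det * E.det = 1 := by
  have h1 := congrArg Matrix.det h.orthonormal
  rw [Matrix.det_mul, Matrix.det_mul, Matrix.det_transpose, Matrix.det_one] at h1
  have h2 : g.det = (1 / E.det) ^ 2 := by
    have := h.det_pos.ne'
    field_simp
    linarith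
  rw [h2, Real.sqrt_sq (by have := h.det_pos; positivity)]
  have := h.det_pos.ne'
  field_simp

lemma pull_metricTensor (h : IsOrthonormalFrame (G y) E) (a b : Fin 4) :
    ∑ p, ∑ q, E p a * E q b * G y p q = if a = b then 1 else 0 := by
  have h1 := congrFun (congrFun h.orthonormal a) b
  rw [Matrix.one_apply] at h1
  rw [← h1, Matrix.mul_apply]
  simp only [Matrix.mul_apply, Matrix.transpose_apply, Finset.sum_mul]
  rw [Finset.sum_comm]
  exact Finset.sum_congr rfl fun q _ => Finset.sum_congr rfl fun p _ => by ring

/-- Because `g⁻¹ = E Eᵀ`, contraction with the inverse metric becomes a plain sum over a repeated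
frame index. -/
lemma pull_trace (h : IsOrthonormalFrame g E) {k : ℕ} (T : (Fin (k + 2) → Fin 4) → ℝ)
    (I : Fin k → Fin 4) :
    pull E (fun J => ∑ a, ∑ b, g⁻¹ a b * T
      (Fin.cons a (Fin.cons b J : Fin (k + 1) → Fin 4) : Fin (k + 2) → Fin 4)) I =
      ∑ c, pull E T (Fin.cons c (Fin.cons c I : Fin (k + 1) → Fin 4) : Fin (k + 2) → Fin 4) := by
  simp only [pull_cons_cons, pull_sum, pull_const_mul, h.inv_apply, Finset.sum_mul]
  rw [Finset.sum_comm' (t' := Finset.univ) (s' := fun _ => Finset.univ) (by simp)]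
  rw [Finset.sum_comm]
  conv_rhs => rw [Finset.sum_comm]
  refine Finset.sum_congr rfl fun a _ => ?_
  rw [Finset.sum_comm]

/-- In an oriented orthonormal frame, the Hodge star has its standard form. -/
lemma pull_starKernel (h : IsOrthonormalFrame (G y) E) {k : ℕ} {T : (Fin (k + 2) → Fin 4) → ℝ}
    {c : ℝ} (hT : ∀ a b I, ∑ p, ∑ q, starKernel G a b p q y *
      T (Fin.cons p (Fin.cons q I : Fin (k + 1) → Fin 4)) =
      c * T (Fin.cons a (Fin.cons b I : Fin (k + 1) → Fin 4))) (i j : Fin 4) (I : Fin k → Fin 4) :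
    c * pull E T (Fin.cons i (Fin.cons j I : Fin (k + 1) → Fin 4) : Fin (k + 2) → Fin 4) =
      (1 / 2) * ∑ m, ∑ n, leviCivita ![i, j, m, n] *
      pull E T (Fin.cons m (Fin.cons n I : Fin (k + 1) → Fin 4) : Fin (k + 2) → Fin 4) := by
  let X : Fin 4 → Fin 4 → ℝ := fun p q => pull E (fun J => T
        (Fin.cons p (Fin.cons q J : Fin (k + 1) → Fin 4) : Fin (k + 2) → Fin 4)) I
  have hX : ∀ a b, c * X a b = ∑ p, ∑ q, starKernel G a b p q y * X p q := by
    intro a b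
    simp only [X, ← pull_const_mul, ← hT, pull_sum]
  let Y : Fin 4 → Fin 4 → ℝ := fun m n => ∑ p, ∑ q, E p m * E q n * X p q
  let V := volForm G y
  have hV : ∀ m n, leviCivita ![i, j, m, n] =
      ∑ a, ∑ b, ∑ d, ∑ e, E a i * E b j * (E d m * E e n * V ![a, b, d, e]) := by
    intro m n
    have h1 : pull E V ![i, j, m, n] = leviCivita ![i, j, m, n] := by
      have : pull E V ![i, j, m, n] = Real.sqrt (G y).det * pull E leviCivita ![i, j, m, n] := by
        rw [← pull_const_mul]; rfl
      rw [this, pull_leviCivita, ← mul_assoc, h.sqrt_det_mul, one_mul]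
    have h2 := pull_cons_cons E V i j ![m, n]
    rw [← h1]
    refine h2.trans ?_
    simp only [pull_two, Finset.mul_sum]
    rfl
  have hK : ∀ a b, ∑ p, ∑ q, starKernel G a b p q y * X p q =
      (1 / 2) * ∑ m, ∑ n, (∑ d, ∑ e, E d m * E e n * V ![a, b, d, e]) * Y m n := by
    intro a b
    have hk : ∀ p q, starKernel G a b p q y =
        (1 / 2) * ∑ m, ∑ n, (∑ d, ∑ e, E d m * E e n * V ![a, b, d, e]) * (E p m * E q n) := by
      intro p q
      simp only [starKernel, h.inv_apply, V]
      generalize volForm G y = V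
      simp only [Fin.sum_univ_four]
      ring
    simp only [hk]
    exact sum_mul_sandwich _ _ _ _
  have hL : c * pull E T (Fin.cons i (Fin.cons j I : Fin (k + 1) → Fin 4) : Fin (k + 2) → Fin 4) =
      ∑ a, ∑ b, E a i * E b j * (c * X a b) := by
    rw [pull_cons_cons]
    simp only [Finset.mul_sum, X]
    exact Finset.sum_congr rfl fun a _ => Finset.sum_congr rfl fun b _ => by ring
  have hY : ∀ m n, pull E T (Fin.cons m (Fin.cons n I : Fin (k + 1) → Fin 4) :
      Fin (k + 2) → Fin 4) = Y m n := fun m n => pull_cons_cons E T m n I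
  have hR : ∀ m n, leviCivita ![i, j, m, n] * Y m n = ∑ a, ∑ b, E a i * E b j *
      ((∑ d, ∑ e, E d m * E e n * V ![a, b, d, e]) * Y m n) := by
    intro m n
    rw [hV, Finset.sum_mul]
    refine Finset.sum_congr rfl fun a _ => ?_
    rw [Finset.sum_mul]
    refine Finset.sum_congr rfl fun b _ => ?_
    simp only [← Finset.mul_sum, mul_assoc]
  rw [hL]
  simp only [hX, hK]
  simp only [hY, hR]
  exact sum_mul_swap _ _ _

end IsOrthonormalFrame

end Coord

namespace Coord

/-! ### Two-forms in an oriented orthonormal frame of a four-dimensional space -/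

/-- The array `X` is a two-form with `⋆X = c X`, in an oriented orthonormal frame; `c = ±1`. -/
structure IsDuality (c : ℝ) (X : Fin 4 → Fin 4 → ℝ) : Prop where
  skew : ∀ i j, X j i = - X i j
  dual01 : X 2 3 = c * X 0 1
  dual02 : X 1 3 = - (c * X 0 2)
  dual03 : X 1 2 = c * X 0 3

namespace IsDuality

variable {c : ℝ} {X Y : Fin 4 → Fin 4 → ℝ}

lemma diag (h : IsDuality c X) (i : Fin 4) : X i i = 0 := by linarith [h.skew i i]

lemma h10 (h : IsDuality c X) : X 1 0 = - X 0 1 := h.skew 0 1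

lemma h20 (h : IsDuality c X) : X 2 0 = - X 0 2 := h.skew 0 2

lemma h30 (h : IsDuality c X) : X 3 0 = - X 0 3 := h.skew 0 3

lemma h21 (h : IsDuality c X) : X 2 1 = - (c * X 0 3) := by rw [h.skew 1 2, h.dual03]

lemma h31 (h : IsDuality c X) : X 3 1 = c * X 0 2 := by rw [h.skew 1 3, h.dual02, neg_neg]

lemma h32 (h : IsDuality c X) : X 3 2 = - (c * X 0 1) := by rw [h.skew 2 3, h.dual01]

/-- The spaces `Λ^±` are three-dimensional. This reduces every later identity to the index pairs
`01`, `02`, `03`. -/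
lemma ext (hX : IsDuality c X) (hY : IsDuality c Y) (h1 : X 0 1 = Y 0 1) (h2 : X 0 2 = Y 0 2)
    (h3 : X 0 3 = Y 0 3) (i j : Fin 4) : X i j = Y i j := by
  fin_cases i <;> fin_cases j <;>
    simp only [Fin.zero_eta, Fin.mk_one, Fin.reduceFinMk, hX.diag, hX.h10, hX.h20, hX.h30, hX.h21,
      hX.h31, hX.h32, hX.dual01, hX.dual02, hX.dual03, hY.diag, hY.h10, hY.h20, hY.h30, hY.h21,
      hY.h31, hY.h32, hY.dual01, hY.dual02, hY.dual03, h1, h2, h3]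

lemma add (hX : IsDuality c X) (hY : IsDuality c Y) : IsDuality c fun i j => X i j + Y i j where
  skew i j := by rw [hX.skew, hY.skew]; ring
  dual01 := by rw [hX.dual01, hY.dual01]; ring
  dual02 := by rw [hX.dual02, hY.dual02]; ring
  dual03 := by rw [hX.dual03, hY.dual03]; ring

lemma const_mul (t : ℝ) (hX : IsDuality c X) : IsDuality c fun i j => t * X i j where
  skew i j := by rw [hX.skew]; ring
  dual01 := by rw [hX.dual01]; ring
  dual02 := by rw [hX.dual02]; ring
  dual03 := by rw [hX.dual03]; ring

lemma mul_const (t : ℝ) (hX : IsDuality c X) : IsDuality c fun i j => X i j * t := by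
  simpa only [mul_comm] using hX.const_mul t

lemma neg (hX : IsDuality c X) : IsDuality c fun i j => - X i j where
  skew i j := by rw [hX.skew]
  dual01 := by rw [hX.dual01]; ring
  dual02 := by rw [hX.dual02]; ring
  dual03 := by rw [hX.dual03]; ring

lemma sub (hX : IsDuality c X) (hY : IsDuality c Y) : IsDuality c fun i j => X i j - Y i j := by
  simpa only [sub_eq_add_neg] using hX.add hY.neg

lemma zero : IsDuality c fun _ _ => 0 := ⟨by simp, by simp, by simp, by simp⟩

lemma sum {ι : Type*} (s : Finset ι) {Z : ι → Fin 4 → Fin 4 → ℝ} (h : ∀ x ∈ s, IsDuality c (Z x)) :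
    IsDuality c fun i j => ∑ x ∈ s, Z x i j where
  skew i j := by
    rw [← Finset.sum_neg_distrib]
    exact Finset.sum_congr rfl fun x hx => (h x hx).skew _ _
  dual01 := by rw [Finset.mul_sum]; exact Finset.sum_congr rfl fun x hx => (h x hx).dual01
  dual02 := by
    rw [Finset.mul_sum, ← Finset.sum_neg_distrib]
    exact Finset.sum_congr rfl fun x hx => (h x hx).dual02
  dual03 := by rw [Finset.mul_sum]; exact Finset.sum_congr rfl fun x hx => (h x hx).dual03

end IsDuality

/-- An algebraic Weyl tensor, in an oriented orthonormal frame, which is self-dual (`c = 1`) or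
anti-self-dual (`c = -1`). -/
structure IsWeylDuality (c : ℝ) (u : Fin 4 → Fin 4 → Fin 4 → Fin 4 → ℝ) : Prop where
  left : ∀ k l, IsDuality c fun i j => u i j k l
  symm : ∀ i j k l, u k l i j = u i j k l
  trace : ∀ j l, ∑ i, u i j i l = 0

namespace IsWeylDuality

variable {c : ℝ} {u : Fin 4 → Fin 4 → Fin 4 → Fin 4 → ℝ}

lemma right (h : IsWeylDuality c u) (i j : Fin 4) : IsDuality c (u i j) := by
  have := h.left i j
  simpa only [h.symm i j] using this

/-- On `Λ^±` the tensor is a symmetric `3 × 3` matrix, and the Weyl condition is that its trace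
vanishes. Eliminating this entry leaves five independent components, which makes the component
computations closable by `ring`. -/
lemma trace0303 (h : IsWeylDuality c u) : u 0 3 0 3 = - u 0 1 0 1 - u 0 2 0 2 := by
  have := h.trace 0 0
  simp only [Fin.sum_univ_four, (h.left _ _).h10, (h.left _ _).h20, (h.left _ _).h30,
    (h.right _ _).h10, (h.right _ _).h20, (h.right _ _).h30, (h.left _ _).diag] at this
  linarith

end IsWeylDuality

/-- The contraction `ε_{klad} f_{ad}` in an oriented orthonormal frame. -/
def epsContract (f : Fin 4 → Fin 4 → ℝ) : Fin 4 → Fin 4 → ℝ :=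
  ![![0, f 2 3 - f 3 2, f 3 1 - f 1 3, f 1 2 - f 2 1],
    ![f 3 2 - f 2 3, 0, f 0 3 - f 3 0, f 2 0 - f 0 2],
    ![f 1 3 - f 3 1, f 3 0 - f 0 3, 0, f 0 1 - f 1 0],
    ![f 2 1 - f 1 2, f 0 2 - f 2 0, f 1 0 - f 0 1, 0]]

/-- The skew part of `f` minus its Hodge dual is anti-self-dual. -/
lemma isDuality_sub_epsContract (f : Fin 4 → Fin 4 → ℝ) :
    IsDuality (-1) fun k l => f k l - f l k - epsContract f k l where
  skew i j := by
    fin_cases i <;> fin_cases j <;> simp [epsContract] <;> ring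
  dual01 := by simp [epsContract]
  dual02 := by simp [epsContract]; ring
  dual03 := by simp [epsContract]

lemma isDuality_epsContract {c : ℝ} {V : Fin 4 → Fin 4 → Fin 4 → Fin 4 → ℝ}
    (hV : ∀ k l, IsDuality c (V k l)) (k l : Fin 4) :
    IsDuality c fun i j => epsContract (fun a d => V a d i j) k l := by
  fin_cases k <;> fin_cases l <;>
    first | exact IsDuality.zero | exact (hV _ _).sub (hV _ _)

end Coord

/-! ### Differential identities for arrays with values in self-dual two-forms, reduced to algebra.
-/

namespace Coord

/-- The differential Bianchi-type identity satisfied by self-dual two-forms: the contracted cyclic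
sum of second derivatives is the dual of the derivative of the divergence. -/
lemma cyclic_trace_eq_epsContract {Y : Fin 4 → Fin 4 → Fin 4 → Fin 4 → ℝ}
    (hY : ∀ a b, IsDuality 1 (Y a b)) (k l : Fin 4) :
    ∑ a, (Y a a k l + Y a k l a + Y a l a k) = epsContract (fun a d => ∑ m, Y a m m d) k l := by
  fin_cases k <;> fin_cases l <;>
    simp only [Fin.zero_eta, Fin.mk_one, Fin.reduceFinMk, Fin.sum_univ_four, epsContract,
      Matrix.cons_val, (hY _ _).diag, (hY _ _).h10, (hY _ _).h20, (hY _ _).h30, (hY _ _).h21,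
      (hY _ _).h31, (hY _ _).h32, (hY _ _).dual01, (hY _ _).dual02, (hY _ _).dual03] <;>
    ring

/-- The anticommutator of a symmetric array with a self-dual two-form has no self-dual part,
up to the trace. -/
lemma isDuality_anticommutator {ψ : Fin 4 → Fin 4 → ℝ} (hψ : IsDuality 1 ψ)
    {P : Fin 4 → Fin 4 → ℝ} (hP : ∀ a b, P a b = P b a) :
    IsDuality (-1) fun k l =>
      -2 * ∑ m, (ψ k m * P l m - ψ l m * P k m) + (∑ a, P a a) * ψ k l := by
  constructor
  · intro i j
    rw [hψ.skew i j]
    simp only [Finset.sum_sub_distrib]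
    ring
  all_goals
    simp only [Fin.sum_univ_four, hψ.diag, hψ.h10, hψ.h20, hψ.h30, hψ.h21, hψ.h31, hψ.h32,
      hψ.dual01, hψ.dual02, hψ.dual03, hP 1 0, hP 2 0, hP 3 0, hP 2 1, hP 3 1, hP 3 2]
    ring

set_option linter.unusedSimpArgs false

variable {u u' W : Fin 4 → Fin 4 → Fin 4 → Fin 4 → ℝ} {P P' : Fin 4 → Fin 4 → ℝ}

set_option maxHeartbeats 1000000 in
/-- The anti-self-dual part of the skew derivative of a trace-free one-form with values in self-dual
two-forms is determined by its divergence. -/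
lemma sub_epsContract_eq {V : Fin 4 → Fin 4 → Fin 4 → Fin 4 → ℝ} (hV : ∀ k l, IsDuality 1 (V k l))
    (hVt : ∀ k i, ∑ l, V k l i l = 0) (hu : IsWeylDuality 1 u) (hu' : IsWeylDuality 1 u')
    (hP : ∀ a b, P a b = P b a) (hP' : ∀ a b, P' a b = P' b a)
    (hH : ∀ k i, ∑ l, V l k i l = ∑ a, ∑ b, (P a b * u k a i b + P' a b * u' k a i b))
    (k l i j : Fin 4) :
    V k l i j - V l k i j - epsContract (fun a d => V a d i j) k l =
      (-2 * ∑ m, (u i j k m * P l m - u i j l m * P k m) + (∑ a, P a a) * u i j k l) +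
      (-2 * ∑ m, (u' i j k m * P' l m - u' i j l m * P' k m) + (∑ a, P' a a) * u' i j k l) := by
  have hL : ∀ k l, IsDuality 1 fun i j =>
      V k l i j - V l k i j - epsContract (fun a d => V a d i j) k l :=
    fun k l => ((hV k l).sub (hV l k)).sub (isDuality_epsContract hV k l)
  have hR : ∀ {u : Fin 4 → Fin 4 → Fin 4 → Fin 4 → ℝ} {P : Fin 4 → Fin 4 → ℝ}
      (_ : IsWeylDuality 1 u) (k l : Fin 4), IsDuality 1 fun i j =>
      -2 * ∑ m, (u i j k m * P l m - u i j l m * P k m) + (∑ a, P a a) * u i j k l :=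
    fun hu k l => (IsDuality.const_mul _ (IsDuality.sum _ fun m _ =>
      ((hu.left k m).mul_const _).sub ((hu.left l m).mul_const _))).add
        ((hu.left k l).const_mul _)
  have t00 := hVt 0 0
  have H00 := hH 0 0
  have t01 := hVt 0 1
  have H01 := hH 0 1
  have t02 := hVt 0 2
  have H02 := hH 0 2
  have t03 := hVt 0 3
  have H03 := hH 0 3
  have t10 := hVt 1 0
  have H10 := hH 1 0
  have t11 := hVt 1 1
  have H11 := hH 1 1
  have t12 := hVt 1 2
  have H12 := hH 1 2
  have t13 := hVt 1 3
  have H13 := hH 1 3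
  have t20 := hVt 2 0
  have H20 := hH 2 0
  have t21 := hVt 2 1
  have H21 := hH 2 1
  have t22 := hVt 2 2
  have H22 := hH 2 2
  have t23 := hVt 2 3
  have H23 := hH 2 3
  have t30 := hVt 3 0
  have H30 := hH 3 0
  have t31 := hVt 3 1
  have H31 := hH 3 1
  have t32 := hVt 3 2
  have H32 := hH 3 2
  have t33 := hVt 3 3
  have H33 := hH 3 3
  simp only [Fin.sum_univ_four, (hV _ _).diag, (hV _ _).h10, (hV _ _).h20, (hV _ _).h30,
    (hV _ _).h21, (hV _ _).h31, (hV _ _).h32, (hV _ _).dual01, (hV _ _).dual02, (hV _ _).dual03,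
    (hu.left _ _).diag, (hu.left _ _).h10, (hu.left _ _).h20, (hu.left _ _).h30,
    (hu.left _ _).h21, (hu.left _ _).h31, (hu.left _ _).h32, (hu.left _ _).dual01,
    (hu.left _ _).dual02, (hu.left _ _).dual03,
      (hu.right _ _).diag, (hu.right _ _).h10, (hu.right _ _).h20, (hu.right _ _).h30,
        (hu.right _ _).h21, (hu.right _ _).h31, (hu.right _ _).h32, (hu.right _ _).dual01,
        (hu.right _ _).dual02, (hu.right _ _).dual03,
      hu.trace0303, hu.symm 0 1 0 2, hu.symm 0 1 0 3, hu.symm 0 2 0 3, (hu'.left _ _).diag,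
        (hu'.left _ _).h10, (hu'.left _ _).h20, (hu'.left _ _).h30, (hu'.left _ _).h21,
        (hu'.left _ _).h31, (hu'.left _ _).h32, (hu'.left _ _).dual01, (hu'.left _ _).dual02,
        (hu'.left _ _).dual03,
      (hu'.right _ _).diag, (hu'.right _ _).h10, (hu'.right _ _).h20, (hu'.right _ _).h30,
        (hu'.right _ _).h21, (hu'.right _ _).h31, (hu'.right _ _).h32, (hu'.right _ _).dual01,
        (hu'.right _ _).dual02, (hu'.right _ _).dual03,
      hu'.trace0303, hu'.symm 0 1 0 2, hu'.symm 0 1 0 3, hu'.symm 0 2 0 3, hP 1 0, hP 2 0,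
        hP 3 0, hP 2 1, hP 3 1, hP 3 2, hP' 1 0, hP' 2 0, hP' 3 0, hP' 2 1, hP' 3 1, hP' 3 2]
        at t00 H00 t01 H01 t02 H02 t03 H03 t10 H10 t11 H11 t12 H12 t13 H13 t20 H20 t21 H21 t22
          H22 t23 H23 t30 H30 t31 H31 t32 H32 t33 H33
  -- Both sides are self-dual in `ij` and anti-self-dual in `kl`, so nine components suffice.
  refine IsDuality.ext (hL k l) ((hR hu k l).add (hR hu' k l)) ?_ ?_ ?_ i j
  all_goals
    refine IsDuality.ext (isDuality_sub_epsContract fun a d => V a d _ _)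
      ((isDuality_anticommutator (hu.right _ _) hP).add
        (isDuality_anticommutator (hu'.right _ _) hP')) ?_ ?_ ?_ k l
  all_goals
    simp only [Fin.sum_univ_four, epsContract, Matrix.cons_val, (hV _ _).diag, (hV _ _).h10,
      (hV _ _).h20, (hV _ _).h30, (hV _ _).h21, (hV _ _).h31, (hV _ _).h32, (hV _ _).dual01,
      (hV _ _).dual02, (hV _ _).dual03, (hu.left _ _).diag, (hu.left _ _).h10, (hu.left _ _).h20,
      (hu.left _ _).h30, (hu.left _ _).h21, (hu.left _ _).h31, (hu.left _ _).h32,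
      (hu.left _ _).dual01, (hu.left _ _).dual02, (hu.left _ _).dual03,
      (hu.right _ _).diag, (hu.right _ _).h10, (hu.right _ _).h20, (hu.right _ _).h30,
        (hu.right _ _).h21, (hu.right _ _).h31, (hu.right _ _).h32, (hu.right _ _).dual01,
        (hu.right _ _).dual02, (hu.right _ _).dual03,
      hu.trace0303, hu.symm 0 1 0 2, hu.symm 0 1 0 3, hu.symm 0 2 0 3, (hu'.left _ _).diag,
        (hu'.left _ _).h10, (hu'.left _ _).h20, (hu'.left _ _).h30, (hu'.left _ _).h21,
        (hu'.left _ _).h31, (hu'.left _ _).h32, (hu'.left _ _).dual01, (hu'.left _ _).dual02,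
        (hu'.left _ _).dual03,
      (hu'.right _ _).diag, (hu'.right _ _).h10, (hu'.right _ _).h20, (hu'.right _ _).h30,
        (hu'.right _ _).h21, (hu'.right _ _).h31, (hu'.right _ _).h32, (hu'.right _ _).dual01,
        (hu'.right _ _).dual02, (hu'.right _ _).dual03,
      hu'.trace0303, hu'.symm 0 1 0 2, hu'.symm 0 1 0 3, hu'.symm 0 2 0 3,
      hP 1 0, hP 2 0, hP 3 0, hP 2 1, hP 3 1, hP 3 2, hP' 1 0, hP' 2 0, hP' 3 0, hP' 2 1,
        hP' 3 1, hP' 3 2]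
  -- The coefficients are the entries of `-½ ω⁺ω⁻`, with `ω⁺` and `ω⁻` the basis forms of `Λ⁺` and
  -- `Λ⁻` attached to the current `ij` and `kl`. These nine products span the trace-free symmetric
  -- matrices, which realises `Λ⁻ ⊗ Λ⁺` inside the two-tensors.
  · linear_combination (1 / 2) * ((t00 - H00) + (t11 - H11) - (t22 - H22) - (t33 - H33))
  · linear_combination (1 / 2) * (-(t03 - H03) + (t12 - H12) + (t21 - H21) - (t30 - H30))
  · linear_combination (1 / 2) * ((t02 - H02) + (t13 - H13) + (t20 - H20) + (t31 - H31))
  · linear_combination (1 / 2) * ((t03 - H03) + (t12 - H12) + (t21 - H21) + (t30 - H30))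
  · linear_combination (1 / 2) * ((t00 - H00) - (t11 - H11) + (t22 - H22) - (t33 - H33))
  · linear_combination (1 / 2) * (-(t10 - H10) - (t01 - H01) + (t32 - H32) + (t23 - H23))
  · linear_combination (1 / 2) * (-(t02 - H02) + (t13 - H13) - (t20 - H20) + (t31 - H31))
  · linear_combination (1 / 2) * ((t10 - H10) + (t01 - H01) + (t32 - H32) + (t23 - H23))
  · linear_combination (1 / 2) * ((t00 - H00) - (t11 - H11) - (t22 - H22) + (t33 - H33))

end Coord

/-! ### Contractions of the curvature action, and the Cotton tensor. -/

namespace Coord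

set_option linter.unusedSimpArgs false

variable {u W : Fin 4 → Fin 4 → Fin 4 → Fin 4 → ℝ} {P : Fin 4 → Fin 4 → ℝ}

/-- The curvature tensor with Weyl tensor `W` and Schouten tensor `P`, in an orthonormal frame. -/
def curvatureOf (W : Fin 4 → Fin 4 → Fin 4 → Fin 4 → ℝ) (P : Fin 4 → Fin 4 → ℝ)
    (a b c d : Fin 4) : ℝ :=
  W a b c d + ((if c = a then 1 else 0) * P b d - (if c = b then 1 else 0) * P a d
    + (if d = b then 1 else 0) * P a c - (if d = a then 1 else 0) * P b c)

/-- The action of the curvature on a covariant array of rank four. -/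
def curvAct4 (R u : Fin 4 → Fin 4 → Fin 4 → Fin 4 → ℝ) (a b i j k l : Fin 4) : ℝ :=
  ∑ p, (R a b p i * u p j k l + R a b p j * u i p k l + R a b p k * u i j p l
    + R a b p l * u i j k p)

/-- The action of the curvature on a covariant array of rank three. -/
def curvAct3 (R : Fin 4 → Fin 4 → Fin 4 → Fin 4 → ℝ) (w : Fin 4 → Fin 4 → Fin 4 → ℝ)
    (a b i j k : Fin 4) : ℝ :=
  ∑ p, (R a b p i * w p j k + R a b p j * w i p k + R a b p k * w i j p)

-- The curvature left over when `∇_a∇_k U_{la}` and `∇_a∇_l U_{ak}` are commuted. The Weyl part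
-- drops out because anti-self-dual curvature acts trivially on `Λ⁺` and contracts to zero against
-- `U`; the trace-free part of `P` cancels as well, so only `J` is left. Three components are enough
-- by self-duality in the last pair.
set_option maxHeartbeats 4000000 in
lemma curvAct4_trace (hu : IsWeylDuality 1 u) (hW : IsWeylDuality (-1) W)
    (hP : ∀ a b, P a b = P b a) (k l : Fin 4) :
    (∑ a, (curvAct4 (curvatureOf W P) u a k l a 0 1 + curvAct4 (curvatureOf W P) u a l a k 0 1) =
      3 * (∑ a, P a a) * u k l 0 1) ∧
    (∑ a, (curvAct4 (curvatureOf W P) u a k l a 0 2 + curvAct4 (curvatureOf W P) u a l a k 0 2) =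
      3 * (∑ a, P a a) * u k l 0 2) ∧
    (∑ a, (curvAct4 (curvatureOf W P) u a k l a 0 3 + curvAct4 (curvatureOf W P) u a l a k 0 3) =
      3 * (∑ a, P a a) * u k l 0 3) := by
  fin_cases k <;> fin_cases l <;>
    simp only [Fin.zero_eta, Fin.mk_one, Fin.reduceFinMk, Fin.sum_univ_four, curvAct4,
      curvatureOf, Fin.reduceEq, Fin.isValue, if_true, if_false,
      zero_ne_one, one_ne_zero,
      (hu.left _ _).diag, (hu.left _ _).h10, (hu.left _ _).h20, (hu.left _ _).h30,
        (hu.left _ _).h21, (hu.left _ _).h31, (hu.left _ _).h32, (hu.left _ _).dual01,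
        (hu.left _ _).dual02, (hu.left _ _).dual03,
      (hu.right _ _).diag, (hu.right _ _).h10, (hu.right _ _).h20, (hu.right _ _).h30,
        (hu.right _ _).h21, (hu.right _ _).h31, (hu.right _ _).h32, (hu.right _ _).dual01,
        (hu.right _ _).dual02, (hu.right _ _).dual03,
      hu.trace0303, hu.symm 0 1 0 2, hu.symm 0 1 0 3, hu.symm 0 2 0 3, (hW.left _ _).diag,
        (hW.left _ _).h10, (hW.left _ _).h20, (hW.left _ _).h30, (hW.left _ _).h21,
        (hW.left _ _).h31, (hW.left _ _).h32, (hW.left _ _).dual01, (hW.left _ _).dual02,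
        (hW.left _ _).dual03,
      (hW.right _ _).diag, (hW.right _ _).h10, (hW.right _ _).h20, (hW.right _ _).h30,
        (hW.right _ _).h21, (hW.right _ _).h31, (hW.right _ _).h32, (hW.right _ _).dual01,
        (hW.right _ _).dual02, (hW.right _ _).dual03,
      hW.trace0303, hW.symm 0 1 0 2, hW.symm 0 1 0 3, hW.symm 0 2 0 3, hP 1 0, hP 2 0, hP 3 0,
        hP 2 1, hP 3 1, hP 3 2] <;>
    refine ⟨?_, ?_, ?_⟩ <;> ring

end Coord

namespace Coord

set_option linter.unusedSimpArgs false

variable {u W : Fin 4 → Fin 4 → Fin 4 → Fin 4 → ℝ} {P : Fin 4 → Fin 4 → ℝ}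

-- The curvature left over in the contracted second derivatives of `w = δU`: one commutator from
-- `∇^c∇_l w_c`, and half a commutator from the `ε` term. The Weyl tensor disappears and only `P`
-- and its trace remain.
set_option maxHeartbeats 4000000 in
lemma curvAct3_trace {w : Fin 4 → Fin 4 → Fin 4 → ℝ} (hw : ∀ l, IsDuality 1 (w l))
    (hwt : ∀ i, ∑ l, w l i l = 0) (hW : IsWeylDuality (-1) W)
    (hP : ∀ a b, P a b = P b a) (l : Fin 4) :
    (- ∑ c, curvAct3 (curvatureOf W P) w c l c 0 1 -
      (1 / 2) * ∑ c, epsContract (fun a d => curvAct3 (curvatureOf W P) w c a d 0 1) c l =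
      2 * ∑ m, P l m * w m 0 1 + 2 * (∑ a, P a a) * w l 0 1) ∧
    (- ∑ c, curvAct3 (curvatureOf W P) w c l c 0 2 -
      (1 / 2) * ∑ c, epsContract (fun a d => curvAct3 (curvatureOf W P) w c a d 0 2) c l =
      2 * ∑ m, P l m * w m 0 2 + 2 * (∑ a, P a a) * w l 0 2) ∧
    (- ∑ c, curvAct3 (curvatureOf W P) w c l c 0 3 -
      (1 / 2) * ∑ c, epsContract (fun a d => curvAct3 (curvatureOf W P) w c a d 0 3) c l =
      2 * ∑ m, P l m * w m 0 3 + 2 * (∑ a, P a a) * w l 0 3) := by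
  have t0 := hwt 0
  have t1 := hwt 1
  have t2 := hwt 2
  have t3 := hwt 3
  simp only [Fin.sum_univ_four, (hw _).diag, (hw _).h10, (hw _).h20, (hw _).h30, (hw _).h21,
    (hw _).h31, (hw _).h32, (hw _).dual01, (hw _).dual02, (hw _).dual03] at t0 t1 t2 t3
  -- The four trace conditions are solved for four of the twelve components, so that the goals
  -- become identities in free variables.
  have e0 : w 3 0 3 = - w 1 0 1 - w 2 0 2 := by linarith
  have e1 : w 0 0 1 = w 2 0 3 - w 3 0 2 := by linarith
  have e2 : w 0 0 2 = w 3 0 1 - w 1 0 3 := by linarith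
  have e3 : w 0 0 3 = w 1 0 2 - w 2 0 1 := by linarith
  fin_cases l <;>
    simp only [Fin.zero_eta, Fin.mk_one, Fin.reduceFinMk, Fin.sum_univ_four, curvAct3,
      curvatureOf, epsContract, Matrix.cons_val,
      Fin.reduceEq, Fin.isValue, if_true, if_false, zero_ne_one, one_ne_zero,
      (hw _).diag, (hw _).h10, (hw _).h20, (hw _).h30, (hw _).h21, (hw _).h31, (hw _).h32,
        (hw _).dual01, (hw _).dual02, (hw _).dual03, e0, e1, e2, e3, (hW.left _ _).diag,
        (hW.left _ _).h10, (hW.left _ _).h20, (hW.left _ _).h30, (hW.left _ _).h21,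
        (hW.left _ _).h31, (hW.left _ _).h32, (hW.left _ _).dual01, (hW.left _ _).dual02,
        (hW.left _ _).dual03,
      (hW.right _ _).diag, (hW.right _ _).h10, (hW.right _ _).h20, (hW.right _ _).h30,
        (hW.right _ _).h21, (hW.right _ _).h31, (hW.right _ _).h32, (hW.right _ _).dual01,
        (hW.right _ _).dual02, (hW.right _ _).dual03,
      hW.trace0303, hW.symm 0 1 0 2, hW.symm 0 1 0 3, hW.symm 0 2 0 3, hP 1 0, hP 2 0, hP 3 0,
        hP 2 1, hP 3 1, hP 3 2] <;>
    refine ⟨?_, ?_, ?_⟩ <;> ring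

/-- The divergence-type trace of a trace-free one-form-valued array vanishes if its other trace is
symmetric. -/
lemma trace_eq_zero_of_symm {V : Fin 4 → Fin 4 → Fin 4 → Fin 4 → ℝ}
    (hV : ∀ k l, IsDuality 1 (V k l)) (hVt : ∀ k i, ∑ l, V k l i l = 0)
    (hH : ∀ k i, ∑ l, V l k i l = ∑ l, V l i k l) (i j : Fin 4) : ∑ l, V l l i j = 0 := by
  refine IsDuality.ext (IsDuality.sum _ fun l _ => hV l l) IsDuality.zero ?_ ?_ ?_ i j
  · have h1 := hH 1 0
    have h2 := hVt 2 3
    have h3 := hVt 3 2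
    simp only [Fin.sum_univ_four, (hV _ _).diag, (hV _ _).h10, (hV _ _).h20, (hV _ _).h30,
      (hV _ _).h21, (hV _ _).h31, (hV _ _).h32, (hV _ _).dual01, (hV _ _).dual02,
      (hV _ _).dual03] at h1 h2 h3 ⊢
    linarith
  · have h1 := hH 2 0
    have h2 := hVt 1 3
    have h3 := hVt 3 1
    simp only [Fin.sum_univ_four, (hV _ _).diag, (hV _ _).h10, (hV _ _).h20, (hV _ _).h30,
      (hV _ _).h21, (hV _ _).h31, (hV _ _).h32, (hV _ _).dual01, (hV _ _).dual02,
      (hV _ _).dual03] at h1 h2 h3 ⊢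
    linarith
  · have h1 := hH 3 0
    have h2 := hVt 1 2
    have h3 := hVt 2 1
    simp only [Fin.sum_univ_four, (hV _ _).diag, (hV _ _).h10, (hV _ _).h20, (hV _ _).h30,
      (hV _ _).h21, (hV _ _).h31, (hV _ _).h32, (hV _ _).dual01, (hV _ _).dual02,
      (hV _ _).dual03] at h1 h2 h3 ⊢
    linarith

lemma IsWeylDuality.trace' {c : ℝ} (h : IsWeylDuality c u) (j l : Fin 4) :
    ∑ i, u j i l i = 0 := by
  rw [← h.trace j l]
  refine Finset.sum_congr rfl fun i _ => ?_
  rw [(h.left _ _).skew, (h.right _ _).skew, neg_neg]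

lemma IsWeylDuality.trace_left {c : ℝ} (h : IsWeylDuality c u) (j l : Fin 4) :
    ∑ i, u j i i l = 0 := by
  rw [← neg_eq_zero, ← Finset.sum_neg_distrib, ← h.trace j l]
  exact Finset.sum_congr rfl fun i _ => ((h.left _ _).skew _ _).symm

/-- The Cotton tensor of a metric with anti-self-dual Weyl tensor is anti-self-dual. -/
lemma isDuality_cotton {DW : Fin 4 → Fin 4 → Fin 4 → Fin 4 → Fin 4 → ℝ}
    {DP : Fin 4 → Fin 4 → Fin 4 → ℝ} (hDW : ∀ e, IsWeylDuality (-1) (DW e))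
    (hDP : ∀ c a b, DP c a b = DP c b a)
    (hB : ∀ e a b c d, curvatureOf (DW e) (DP e) a b c d + curvatureOf (DW a) (DP a) b e c d +
      curvatureOf (DW b) (DP b) e a c d = 0) :
    (∀ d, IsDuality (-1) fun a b => DP a b d - DP b a d) ∧
      ∀ m, ∑ k, DP k k m = ∑ a, DP m a a := by
  -- The contracted Bianchi identity: the divergence of `W` is the Cotton tensor, up to terms in the
  -- difference between `dJ` and the divergence of `P`, which is not yet known to vanish.
  have hT : ∀ a b d, (DP a b d - DP b a d) +
      ((∑ k, DP a k k - ∑ k, DP k k a) * (if d = b then 1 else 0)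
        - (∑ k, DP b k k - ∑ k, DP k k b) * (if d = a then 1 else 0)) =
      ∑ c, DW c a b c d := by
    intro a b d
    have h1 : ∑ c, (curvatureOf (DW c) (DP c) a b c d + curvatureOf (DW a) (DP a) b c c d +
      curvatureOf (DW b) (DP b) c a c d) = 0 := Finset.sum_eq_zero fun c _ => hB c a b c d
    have h2 := (hDW a).trace_left b d
    have h3 := (hDW b).trace a d
    have e0 : ∀ (x : Fin 4) (f : Fin 4 → ℝ), ∑ c, (if c = x then 1 else 0) * f c = f x := by simp
    have e0' : ∀ (x : Fin 4) (f : Fin 4 → ℝ), ∑ c, (if x = c then 1 else 0) * f c = f x := by simp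
    have e1 : ∑ c, curvatureOf (DW c) (DP c) a b c d = ∑ c, DW c a b c d + (DP a b d - DP b a d
        + (if d = b then 1 else 0) * ∑ c, DP c a c - (if d = a then 1 else 0) * ∑ c, DP c b c) := by
      simp only [curvatureOf, Finset.sum_add_distrib, Finset.sum_sub_distrib, e0, Finset.mul_sum]
    have e2 : ∑ c, curvatureOf (DW a) (DP a) b c c d = ∑ c, DW a b c c d + (DP a b d - 4 * DP a b d
        + DP a b d - (if d = b then 1 else 0) * ∑ c, DP a c c) := by
      simp only [curvatureOf, Finset.sum_add_distrib, Finset.sum_sub_distrib, e0, e0',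
        Finset.mul_sum]
      simp [hDP a d b]
    have e3 : ∑ c, curvatureOf (DW b) (DP b) c a c d = ∑ c, DW b c a c d + (4 * DP b a d
        - DP b a d + (if d = a then 1 else 0) * ∑ c, DP b c c - DP b a d) := by
      simp only [curvatureOf, Finset.sum_add_distrib, Finset.sum_sub_distrib, e0, e0',
        Finset.mul_sum]
      simp [hDP b d a]
    rw [Finset.sum_add_distrib, Finset.sum_add_distrib, e1, e2, e3, h2, h3] at h1
    simp only [fun k => hDP k a k, fun k => hDP k b k] at h1
    linarith
  have hd : ∀ d, IsDuality (-1) fun a b => ∑ c, DW c a b c d := fun d =>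
    IsDuality.sum _ fun c _ => (hDW c).left c d
  have h1 := fun d => (hd d).dual01
  have h2 := fun d => (hd d).dual02
  have h3 := fun d => (hd d).dual03
  simp only [← hT] at h1 h2 h3
  -- The left side of `hT` has zero cyclic sum and, by `hd`, is anti-self-dual in `ab`. Duality
  -- relates the cyclic sum to the trace on `b`, `d`, so this trace vanishes; it equals four times
  -- the difference in question.
  have hJ : ∀ m, ∑ k, DP k k m = ∑ a, DP m a a := by
    intro m
    have a0 := h1 0
    have a1 := h1 1
    have a2 := h1 2
    have a3 := h1 3
    have b0 := h2 0
    have b1 := h2 1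
    have b2 := h2 2
    have b3 := h2 3
    have c0 := h3 0
    have c1 := h3 1
    have c2 := h3 2
    have c3 := h3 3
    simp only [Fin.sum_univ_four, Fin.reduceEq, Fin.isValue, if_true, if_false, zero_ne_one,
      one_ne_zero, hDP _ 1 0, hDP _ 2 0, hDP _ 3 0, hDP _ 2 1, hDP _ 3 1, hDP _ 3 2]
      at a0 a1 a2 a3 b0 b1 b2 b3 c0 c1 c2 c3 ⊢
    fin_cases m <;> simp only [Fin.zero_eta, Fin.mk_one, Fin.reduceFinMk, hDP _ 1 0, hDP _ 2 0,
      hDP _ 3 0, hDP _ 2 1, hDP _ 3 1,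
      hDP _ 3 2] <;> linarith
  refine ⟨fun d => ?_, hJ⟩
  convert hd d using 3 with a b
  rw [← hT, hJ, hJ]
  ring

end Coord

/-! ### The two Laplacian formulas as linear algebra in an orthonormal frame. -/

namespace Coord

variable {u W : Fin 4 → Fin 4 → Fin 4 → Fin 4 → ℝ} {P : Fin 4 → Fin 4 → ℝ}

/-- The formula for the Laplacian of `u`, in an orthonormal frame. -/
theorem laplacian_formula_orthonormal (hu : IsWeylDuality 1 u) (hW : IsWeylDuality (-1) W)
    (hP : ∀ a b, P a b = P b a)
    {D2 : Fin 4 → Fin 4 → Fin 4 → Fin 4 → Fin 4 → Fin 4 → ℝ}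
    (hD2 : ∀ a b, IsWeylDuality 1 (D2 a b))
    (hc : ∀ a b i j k l,
      D2 a b i j k l - D2 b a i j k l = - curvAct4 (curvatureOf W P) u a b i j k l)
    (hD : ∀ i j, ∑ k, ∑ l, D2 k l i k j l + ∑ k, ∑ l, P k l * u i k j l = 0) (i j k l : Fin 4) :
    (1 / 2) * ∑ a, D2 a a i j k l =
      ∑ m, D2 k m m l i j - ∑ m, D2 l m m k i j + ∑ m, u i j k m * P l m
        - ∑ m, u i j l m * P k m + (∑ a, P a a) * u i j k l := by
  have hV : ∀ k l, IsDuality 1 fun i j => ∑ m, D2 k m m l i j := fun k l =>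
    IsDuality.sum _ fun m _ => (hD2 k m).right m l
  have hVt : ∀ k i, ∑ l, ∑ m, D2 k m m l i l = 0 := fun k i => by
    rw [Finset.sum_comm]
    exact Finset.sum_eq_zero fun m _ => (hD2 k m).trace' m i
  -- This is `𝒟*U = 0` rewritten as a contraction of `∇δU`. The second pair in `sub_epsContract_eq`
  -- serves the differentiated equation, so here its Schouten array is `0`.
  have hH : ∀ k i, ∑ l, ∑ m, D2 l m m k i l =
      ∑ a, ∑ b, (P a b * u k a i b + (fun _ _ => (0 : ℝ)) a b * u k a i b) := fun k i => by
    have h1 := hD i k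
    have h2 : ∑ l, ∑ m, D2 l m m k i l = - ∑ l, ∑ m, D2 l m i l k m := by
      simp only [← Finset.sum_neg_distrib]
      refine Finset.sum_congr rfl fun l _ => Finset.sum_congr rfl fun m _ => ?_
      rw [((hD2 l m).left i l).skew k m, (hD2 l m).symm]
    have h3 : ∑ a, ∑ b, (P a b * u k a i b + (fun _ _ => (0 : ℝ)) a b * u k a i b) =
        ∑ k', ∑ l, P k' l * u i k' k l := by
      rw [Finset.sum_comm]
      refine Finset.sum_congr rfl fun a _ => Finset.sum_congr rfl fun b _ => ?_
      rw [hP b a, ← hu.symm k b i a]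
      ring
    rw [h2, h3]
    linarith
  have h1 := sub_epsContract_eq hV hVt hu hu hP (fun _ _ => rfl) hH k l i j
  -- This expresses `ΔU` by `ε∇w` and two second-derivative terms in the wrong order, which `hK`
  -- commutes.
  have h2 := cyclic_trace_eq_epsContract (Y := fun a b k l => D2 a b k l i j)
    (fun a b => (hD2 a b).left i j) k l
  have hK : ∑ a, (D2 a k l a i j - D2 k a l a i j + (D2 a l a k i j - D2 l a a k i j)) =
      (-3 * ∑ a, P a a) * u k l i j := by
    have hs : IsDuality 1 fun i j =>
        ∑ a, (D2 a k l a i j - D2 k a l a i j + (D2 a l a k i j - D2 l a a k i j)) :=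
      IsDuality.sum _ fun a _ => (((hD2 a k).right l a).sub ((hD2 k a).right l a)).add
        (((hD2 a l).right a k).sub ((hD2 l a).right a k))
    obtain ⟨e1, e2, e3⟩ := curvAct4_trace hu hW hP k l
    refine IsDuality.ext hs ((hu.right k l).const_mul _) ?_ ?_ ?_ i j <;>
      simp only [hc, ← neg_add, Finset.sum_neg_distrib] <;> linarith
  have h3 : ∑ a, D2 k a l a i j = - ∑ m, D2 k m m l i j := by
    rw [← Finset.sum_neg_distrib]
    exact Finset.sum_congr rfl fun a _ => ((hD2 k a).left i j).skew a l
  have h4 : ∑ a, D2 a a k l i j = ∑ a, D2 a a i j k l :=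
    Finset.sum_congr rfl fun a _ => (hD2 a a).symm i j k l
  simp only [Finset.sum_add_distrib, Finset.sum_sub_distrib] at h1 h2 hK
  rw [h3] at hK
  rw [h4] at h2
  simp only [Finset.sum_const_zero, mul_zero, sub_self, zero_mul, add_zero] at h1
  have h5 := hu.symm i j k l
  rw [h5] at hK
  linarith

/-- The formula for the Laplacian of the divergence of `u`, in an orthonormal frame. -/
theorem laplacian_divergence_formula_orthonormal (hu : IsWeylDuality 1 u)
    (hW : IsWeylDuality (-1) W) (hP : ∀ a b, P a b = P b a)
    {Du : Fin 4 → Fin 4 → Fin 4 → Fin 4 → Fin 4 → ℝ} (hDu : ∀ a, IsWeylDuality 1 (Du a))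
    {DP : Fin 4 → Fin 4 → Fin 4 → ℝ} (hDP : ∀ c a b, DP c a b = DP c b a)
    (hCot : ∀ d, IsDuality (-1) fun a b => DP a b d - DP b a d)
    (hDJ : ∀ m, ∑ k, DP k k m = ∑ a, DP m a a)
    {w : Fin 4 → Fin 4 → Fin 4 → ℝ} (hw : ∀ l i j, w l i j = ∑ m, Du m m l i j)
    {X : Fin 4 → Fin 4 → Fin 4 → Fin 4 → Fin 4 → ℝ} (hX : ∀ a b l, IsDuality 1 (X a b l))
    (hXt : ∀ a b i, ∑ l, X a b l i l = 0)
    (hXH : ∀ c k i, ∑ l, X c l k i l =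
      ∑ a, ∑ b, (DP c a b * u k a i b + P a b * Du c k a i b))
    (hc : ∀ a b l i j,
      X a b l i j - X b a l i j = - curvAct3 (curvatureOf W P) w a b l i j) (l i j : Fin 4) :
    ∑ a, X a a l i j = -2 * ∑ m, ∑ k, Du m i j k l * P m k
      - ∑ k, u i j k l * ∑ a, DP k a a + 3 * (∑ a, P a a) * w l i j := by
  have hwd : ∀ l, IsDuality 1 (w l) := fun l => by
    have : w l = fun i j => ∑ m, Du m m l i j := by funext i j; exact hw l i j
    rw [this]
    exact IsDuality.sum _ fun m _ => (hDu m).right m l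
  have hwt : ∀ i, ∑ l, w l i l = 0 := fun i => by
    simp only [hw]
    rw [Finset.sum_comm]
    exact Finset.sum_eq_zero fun m _ => (hDu m).trace' m i
  -- The covariant derivative of the anti-self-dual identity. The product rule for `P U` is why two
  -- pairs occur: `(U, ∇_c P)` and `(∇_c U, P)`.
  have hkey := fun c => sub_epsContract_eq (hX c) (hXt c) hu (hDu c) (hDP c) hP (hXH c) c l i j
  -- Here `∇_c` of the divergence of `w` vanishes, because the contraction supplied by `𝒟*U = 0` is
  -- symmetric.
  have h0 : ∀ c, ∑ l, X c l l i j = 0 := fun c => by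
    refine trace_eq_zero_of_symm (hX c) (hXt c) (fun k i => ?_) i j
    rw [hXH, hXH, Finset.sum_comm]
    refine Finset.sum_congr rfl fun a _ => Finset.sum_congr rfl fun b _ => ?_
    rw [hDP c b a, hP b a, ← hu.symm k b i a, ← (hDu c).symm k b i a]
  have hcomm : ∑ c, (X c l c i j - X l c c i j)
      + (1 / 2) * ∑ c, epsContract (fun a d => X c a d i j - X a c d i j) c l =
      2 * ∑ m, P l m * w m i j + 2 * (∑ a, P a a) * w l i j := by
    have hs : IsDuality 1 fun i j => ∑ c, (X c l c i j - X l c c i j)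
      + (1 / 2) * ∑ c, epsContract (fun a d => X c a d i j - X a c d i j) c l :=
      (IsDuality.sum _ fun c _ => (hX c l c).sub (hX l c c)).add
        (IsDuality.const_mul _ (IsDuality.sum _ fun c _ =>
          isDuality_epsContract (V := fun a d i j => X c a d i j - X a c d i j)
            (fun a d => (hX c a d).sub (hX a c d)) c l))
    have hr : IsDuality 1 fun i j => 2 * ∑ m, P l m * w m i j + 2 * (∑ a, P a a) * w l i j :=
      (IsDuality.const_mul _ (IsDuality.sum _ fun m _ => (hwd m).const_mul _)).add
        ((hwd l).const_mul _)
    have hneg : ∀ (f : Fin 4 → Fin 4 → ℝ) c l,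
        epsContract (fun a d => - f a d) c l = - epsContract f c l := by
      intro f c l
      fin_cases c <;> fin_cases l <;> simp [epsContract] <;> ring
    obtain ⟨e1, e2, e3⟩ := curvAct3_trace hwd hwt hW hP l
    refine IsDuality.ext hs hr ?_ ?_ ?_ i j <;>
      simp only [hc, Finset.sum_neg_distrib, hneg] <;> linarith
  -- Summed over both derivative indices, `ε` is skew in them, so only half of the commutator
  -- contributes.
  have heps : ∑ c, epsContract (fun a d => X c a d i j) c l =
      (1 / 2) * ∑ c, epsContract (fun a d => X c a d i j - X a c d i j) c l := by
    fin_cases l <;> simp [epsContract, Fin.sum_univ_four] <;> ring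
  -- Skewness of `U` in `cm` turns `∇_c P_{lm}` into the Cotton tensor, and anti-self-dual is
  -- orthogonal to self-dual.
  have hC : ∑ c, ∑ m, u i j c m * DP c l m = 0 := by
    have h1 := fun a b => (hCot l).skew a b
    have h2 : ∑ c, ∑ m, u i j c m * DP c l m = ∑ c, ∑ m, u i j c m * DP c m l := by
      simp only [fun c m => hDP c l m]
    rw [h2]
    have q1 := (hCot l).dual01
    have q2 := (hCot l).dual02
    have q3 := (hCot l).dual03
    have hr := hu.right i j
    simp only [Fin.sum_univ_four, hr.diag, hr.h10, hr.h20, hr.h30, hr.h21, hr.h31, hr.h32,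
      hr.dual01, hr.dual02, hr.dual03]
    linear_combination u i j 0 1 * q1 - u i j 0 2 * q2 + u i j 0 3 * q3
  have hsum := Finset.sum_congr (rfl : (Finset.univ : Finset (Fin 4)) = Finset.univ)
    fun c _ => hkey c
  simp only [Finset.sum_add_distrib, Finset.sum_sub_distrib, mul_sub] at hsum hcomm
  rw [heps] at hsum
  have hl : ∑ c, X l c c i j = 0 := h0 l
  have k1 : ∑ c, -2 * ∑ m, u i j c m * DP c l m = 0 := by
    rw [← Finset.mul_sum, hC, mul_zero]
  have k2 : ∑ c, -2 * ∑ m, u i j l m * DP c c m = 2 * ∑ k, u i j k l * ∑ a, DP k a a := by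
    rw [← Finset.mul_sum, Finset.sum_comm]
    simp only [← Finset.mul_sum, hDJ, fun m => (hu.right i j).skew m l, neg_mul,
      Finset.sum_neg_distrib]
    ring
  have k3 : ∑ c, (∑ a, DP c a a) * u i j c l = ∑ k, u i j k l * ∑ a, DP k a a :=
    Finset.sum_congr rfl fun c _ => mul_comm _ _
  have hw' : ∀ m, ∑ c, Du c i j c m = w m i j := fun m => by
    rw [hw]
    exact Finset.sum_congr rfl fun c _ => (hDu c).symm _ _ _ _
  have k4 : ∑ c, -2 * ∑ m, Du c i j c m * P l m = -2 * ∑ m, P l m * w m i j := by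
    rw [← Finset.mul_sum, Finset.sum_comm]
    simp only [← Finset.sum_mul, hw']
    simp only [mul_comm]
  have k5 : ∑ c, -2 * ∑ m, Du c i j l m * P c m = 2 * ∑ m, ∑ k, Du m i j k l * P m k := by
    rw [← Finset.mul_sum]
    simp only [fun c m => ((hDu c).right i j).skew m l, neg_mul, Finset.sum_neg_distrib]
    ring
  have k6 : ∑ c, (∑ a, P a a) * Du c i j c l = (∑ a, P a a) * w l i j := by
    rw [← Finset.mul_sum, hw']
  rw [k1, k2, k3, k4, k5, k6] at hsum
  rw [hl] at hcomm
  linarith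

end Coord

namespace Coord

variable {G : E4 → Matrix (Fin 4) (Fin 4) ℝ} {Ω : Set E4} {y : E4}
  {E : Matrix (Fin 4) (Fin 4) ℝ}

/-! ### Covariant differentiation of linear relations -/

lemma covDeriv_perm_eq {k : ℕ} {S : CoordTensor k} (hS : SmoothTensor Ω S) (hΩ : IsOpen Ω)
    (σ : Equiv.Perm (Fin k)) (t : ℝ) (h : ∀ z ∈ Ω, ∀ I, S z (I ∘ σ) = t * S z I) (hy : y ∈ Ω)
    (m : Fin 4) (I : Fin k → Fin 4) :
    covDeriv G S y (Fin.cons m (I ∘ σ) : Fin (k + 1) → Fin 4) =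
      t * covDeriv G S y (Fin.cons m I : Fin (k + 1) → Fin 4) := by
  rw [← covDeriv_reindex, covDeriv_congr hΩ hy h, covDeriv_const_mul t hS hΩ hy]

lemma SmoothTensor.reindex {k : ℕ} {S : CoordTensor k} (hS : SmoothTensor Ω S)
    (σ : Equiv.Perm (Fin k)) : SmoothTensor Ω (fun y I => S y (I ∘ σ) : CoordTensor k) :=
  fun _ => hS _

/-- The permutation `σ` moves the two contracted indices from the head to arbitrary slots, so a
trace relation valid throughout `Ω` can be differentiated wherever its indices sit. -/
lemma covDeriv_trace_eq {k : ℕ} {S : CoordTensor (k + 2)} {R : CoordTensor k}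
    (hS : SmoothTensor Ω S) (hG : IsMetricOn G Ω) (σ : Equiv.Perm (Fin (k + 2)))
    (h : ∀ z ∈ Ω, ∀ I, ∑ a, ∑ b, (G z)⁻¹ a b *
      S z ((Fin.cons a (Fin.cons b I : Fin (k + 1) → Fin 4) : Fin (k + 2) → Fin 4) ∘ σ) = R z I)
    (hy : y ∈ Ω) (m : Fin 4) (I : Fin k → Fin 4) :
    ∑ a, ∑ b, (G y)⁻¹ a b * covDeriv G S y (Fin.cons m
      ((Fin.cons a (Fin.cons b I : Fin (k + 1) → Fin 4) : Fin (k + 2) → Fin 4) ∘ σ) :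
        Fin (k + 3) → Fin 4) = covDeriv G R y (Fin.cons m I : Fin (k + 1) → Fin 4) := by
  rw [← covDeriv_congr hG.isOpen hy h]
  refine Eq.trans ?_ (covDeriv_traceHead (hS.reindex σ) hG hy m I).symm
  refine Finset.sum_congr rfl fun a _ => Finset.sum_congr rfl fun b _ => ?_
  rw [covDeriv_reindex]

lemma covDeriv_star_eq {k : ℕ} {S : CoordTensor (k + 2)} (hS : SmoothTensor Ω S)
    (hG : IsMetricOn G Ω) (c : ℝ) (σ : Equiv.Perm (Fin (k + 2)))
    (h : ∀ z ∈ Ω, ∀ a b I, ∑ p, ∑ q, starKernel G a b p q z *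
      S z ((Fin.cons p (Fin.cons q I : Fin (k + 1) → Fin 4) : Fin (k + 2) → Fin 4) ∘ σ) =
      c * S z ((Fin.cons a (Fin.cons b I : Fin (k + 1) → Fin 4) : Fin (k + 2) → Fin 4) ∘ σ))
    (hy : y ∈ Ω) (m a b : Fin 4) (I : Fin k → Fin 4) :
    ∑ p, ∑ q, starKernel G a b p q y * covDeriv G S y (Fin.cons m
      ((Fin.cons p (Fin.cons q I : Fin (k + 1) → Fin 4) : Fin (k + 2) → Fin 4) ∘ σ) :
        Fin (k + 3) → Fin 4) = c * covDeriv G S y (Fin.cons m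
      ((Fin.cons a (Fin.cons b I : Fin (k + 1) → Fin 4) : Fin (k + 2) → Fin 4) ∘ σ) :
        Fin (k + 3) → Fin 4) := by
  have := covDeriv_starKernel_eq (hS.reindex σ) hG c h hy m a b I
  simpa only [covDeriv_reindex] using this

/-! ### Frame components of linear relations -/

lemma pull_perm_eq {k : ℕ} {T : (Fin k → Fin 4) → ℝ} (σ : Equiv.Perm (Fin k)) (t : ℝ)
    (h : ∀ I, T (I ∘ σ) = t * T I) (I) : pull E T (I ∘ σ) = t * pull E T I := by
  rw [← pull_reindex, ← pull_const_mul]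
  simp only [h]

lemma IsOrthonormalFrame.pull_trace_eq {g : Matrix (Fin 4) (Fin 4) ℝ} (hE : IsOrthonormalFrame g E)
    {k : ℕ} {T : (Fin (k + 2) → Fin 4) → ℝ} {R : (Fin k → Fin 4) → ℝ}
    (σ : Equiv.Perm (Fin (k + 2)))
    (h : ∀ I, ∑ a, ∑ b, g⁻¹ a b *
      T ((Fin.cons a (Fin.cons b I : Fin (k + 1) → Fin 4) : Fin (k + 2) → Fin 4) ∘ σ) = R I)
    (I : Fin k → Fin 4) :
    ∑ c, pull E T ((Fin.cons c (Fin.cons c I : Fin (k + 1) → Fin 4) : Fin (k + 2) → Fin 4) ∘ σ) =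
      pull E R I := by
  have := hE.pull_trace (fun J => T (J ∘ σ)) I
  simp only [h, pull_reindex] at this
  exact this.symm

lemma leviCivita_contract (f : Fin 4 → Fin 4 → ℝ) (i j : Fin 4) :
    ∑ m, ∑ n, leviCivita ![i, j, m, n] * f m n = epsContract f i j := by
  -- The selection matrix of `(i,j,m,n)` times the Vandermonde matrix of `0,1,2,3` is the
  -- Vandermonde matrix of `i,j,m,n`. The constant `12` is the Vandermonde determinant of `0,1,2,3`.
  have h : ∀ i j m n : Fin 4, leviCivita ![i, j, m, n] =
    (((j : ℕ) : ℝ) - (i : ℕ)) * ((m : ℕ) - (i : ℕ)) * ((n : ℕ) - (i : ℕ)) * ((m : ℕ) - (j : ℕ))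
      * ((n : ℕ) - (j : ℕ)) * ((n : ℕ) - (m : ℕ)) / 12 := by
    intro i j m n
    let V : Matrix (Fin 4) (Fin 4) ℝ := Matrix.vandermonde fun s : Fin 4 => ((s : ℕ) : ℝ)
    have h1 : (Matrix.of fun s t => if (![i, j, m, n]
      : Fin 4 → Fin 4) s = t then (1 : ℝ) else 0) * V =
        Matrix.vandermonde fun s => (((![i, j, m, n] : Fin 4 → Fin 4) s : ℕ) : ℝ) := by
      ext s t
      simp [Matrix.mul_apply, V, Matrix.vandermonde]
    have h2 := congrArg Matrix.det h1
    rw [Matrix.det_mul, Matrix.det_vandermonde, Matrix.det_vandermonde] at h2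
    have h3 : ∀ v : Fin 4 → ℝ, ∏ i, ∏ j ∈ Finset.Ioi i, (v j - v i) =
        (v 1 - v 0) * (v 2 - v 0) * (v 3 - v 0) * (v 2 - v 1) * (v 3 - v 1) * (v 3 - v 2) := by
      intro v
      have e0 : Finset.Ioi (0 : Fin 4) = {1, 2, 3} := by decide
      have e1 : Finset.Ioi (1 : Fin 4) = {2, 3} := by decide
      have e2 : Finset.Ioi (2 : Fin 4) = {3} := by decide
      have e3 : Finset.Ioi (3 : Fin 4) = ∅ := by decide
      rw [Fin.prod_univ_four, e0, e1, e2, e3, Finset.prod_insert (by decide),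
        Finset.prod_insert (by decide), Finset.prod_singleton, Finset.prod_insert (by decide),
        Finset.prod_singleton, Finset.prod_singleton, Finset.prod_empty]
      ring
    rw [h3, h3] at h2
    simp only [Matrix.cons_val] at h2
    have h4 : leviCivita ![i, j, m, n] * 12 = (((j : ℕ) : ℝ) - (i : ℕ)) * ((m : ℕ) - (i : ℕ)) *
      ((n : ℕ) - (i : ℕ)) * ((m : ℕ) - (j : ℕ)) * ((n : ℕ) - (j : ℕ)) * ((n : ℕ) - (m : ℕ)) := by
      rw [← h2, leviCivita]
      congr 1
      norm_num
    linarith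
  simp only [h, Fin.sum_univ_four]
  fin_cases i <;> fin_cases j <;> norm_num [epsContract] <;> ring

/-- Skewness need not be assumed: since `c² = 1`, the array equals `c` times its own contraction
with `½ε`, which is skew. -/
lemma IsOrthonormalFrame.pull_star_isDuality (hE : IsOrthonormalFrame (G y) E)
    {k : ℕ} {T : (Fin (k + 2) → Fin 4) → ℝ} {c : ℝ} (hc : c * c = 1)
    (σ : Equiv.Perm (Fin (k + 2)))
    (h : ∀ a b I, ∑ p, ∑ q, starKernel G a b p q y *
      T ((Fin.cons p (Fin.cons q I : Fin (k + 1) → Fin 4) : Fin (k + 2) → Fin 4) ∘ σ) =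
      c * T ((Fin.cons a (Fin.cons b I : Fin (k + 1) → Fin 4) : Fin (k + 2) → Fin 4) ∘ σ))
    (I : Fin k → Fin 4) :
    IsDuality c fun i j => pull E T
      ((Fin.cons i (Fin.cons j I : Fin (k + 1) → Fin 4) : Fin (k + 2) → Fin 4) ∘ σ) := by
  have h1 := fun i j => hE.pull_starKernel (T := fun J => T (J ∘ σ)) h i j I
  simp only [pull_reindex] at h1
  generalize hX : (fun i j => pull E T
      ((Fin.cons i (Fin.cons j I : Fin (k + 1) → Fin 4) : Fin (k + 2) → Fin 4) ∘ σ)) = X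
  have h2 : ∀ i j, c * X i j = (1 / 2) * epsContract X i j := fun i j => by
    rw [← leviCivita_contract, ← hX]; exact h1 i j
  have h3 : ∀ i j, X i j = c * ((1 / 2) * epsContract X i j) := fun i j => by
    rw [← h2, ← mul_assoc, hc, one_mul]
  have hs : ∀ i j, X j i = - X i j := by
    intro i j
    rw [h3 j i, h3 i j]
    fin_cases i <;> fin_cases j <;> norm_num [epsContract] <;> ring
  have e01 : c * X 0 1 = 1 / 2 * (X 2 3 - X 3 2) := h2 0 1
  have e02 : c * X 0 2 = 1 / 2 * (X 3 1 - X 1 3) := h2 0 2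
  have e03 : c * X 0 3 = 1 / 2 * (X 1 2 - X 2 1) := h2 0 3
  exact ⟨fun i j => hs i j, by linarith [hs 2 3], by linarith [hs 1 3], by linarith [hs 1 2]⟩

end Coord

namespace Coord

variable {G : E4 → Matrix (Fin 4) (Fin 4) ℝ} {Ω : Set E4} {y : E4}
  {E : Matrix (Fin 4) (Fin 4) ℝ}

/-- The frame components of a tensor product, with the slots in any order. -/
lemma pull_mul {p q k : ℕ} (A : (Fin p → Fin 4) → ℝ) (B : (Fin q → Fin 4) → ℝ)
    (α : Fin p → Fin k) (β : Fin q → Fin k) (h : Function.Bijective (Sum.elim α β))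
    (I : Fin k → Fin 4) :
    pull E (fun J => A (J ∘ α) * B (J ∘ β)) I = pull E A (I ∘ α) * pull E B (I ∘ β) := by
  let σ : Fin p ⊕ Fin q ≃ Fin k := Equiv.ofBijective _ h
  have hα : ∀ s, σ (Sum.inl s) = α s := fun s => rfl
  have hβ : ∀ s, σ (Sum.inr s) = β s := fun s => rfl
  simp only [pull]
  rw [Finset.sum_mul_sum, ← Fintype.sum_prod_type',
    ← ((Equiv.arrowCongr σ (Equiv.refl (Fin 4))).symm.trans
      (Equiv.sumArrowEquivProdArrow _ _ _)).sum_comp]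
  refine Finset.sum_congr rfl fun J _ => ?_
  have h1 : ∏ s, E (J s) (I s) = (∏ s, E (J (α s)) (I (α s))) * ∏ s, E (J (β s)) (I (β s)) := by
    rw [← σ.prod_comp, Fintype.prod_sum_type]
    rfl
  rw [h1]
  change _ = (∏ s, E (J (α s)) (I (α s))) * A (J ∘ α) * ((∏ s, E (J (β s)) (I (β s))) * B (J ∘ β))
  ring

lemma eta_four (I : Fin 4 → Fin 4) : I = ![I 0, I 1, I 2, I 3] := by
  funext s; fin_cases s <;> rfl

lemma eta_three (I : Fin 3 → Fin 4) : I = ![I 0, I 1, I 2] := by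
  funext s; fin_cases s <;> rfl

/-! ### The Ricci identity in an orthonormal frame -/

/-- In an orthonormal frame the raised and lowered curvature have the same components, so the
endomorphism `R_{ab}{}^p{}_i` acts through those of `R_{abpi}`. -/
lemma IsOrthonormalFrame.pull_ricci_identity (hE : IsOrthonormalFrame (G y) E) {k : ℕ}
    {T : CoordTensor k} (hT : SmoothTensor Ω T) (hG : IsMetricOn G Ω) (hy : y ∈ Ω) (a b : Fin 4)
    (I : Fin k → Fin 4) :
    pull E (covDeriv G (covDeriv G T) y)
        (Fin.cons a (Fin.cons b I : Fin (k + 1) → Fin 4) : Fin (k + 2) → Fin 4) -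
      pull E (covDeriv G (covDeriv G T) y)
        (Fin.cons b (Fin.cons a I : Fin (k + 1) → Fin 4) : Fin (k + 2) → Fin 4) =
      - slotAct (fun p i => pull E (riemannTensor G y) ![a, b, p, i]) (pull E (T y)) I := by
  have h1 : ∀ m n p c, ∑ i, riemannUp G m n p i y * E i c =
      ∑ d, E p d * ∑ q, ∑ j, E q d * E j c * riemann G m n q j y := by
    intro m n p c
    have e1 : ∑ d, E p d * ∑ q, ∑ j, E q d * E j c * riemann G m n q j y =
        ∑ j, E j c * ∑ q, (∑ d, E p d * E q d) * riemann G m n q j y := by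
      simp only [Fin.sum_univ_four]
      ring
    rw [e1]
    refine Finset.sum_congr rfl fun j _ => ?_
    rw [mul_comm]
    congr 1
    simp only [← hE.inv_apply, riemann, Finset.mul_sum, ← mul_assoc]
    rw [Finset.sum_comm]
    simp only [← Finset.sum_mul, hG.inv_mul_apply hy]
    simp
  have h2 : ∀ p i, pull E (riemannTensor G y) ![a, b, p, i] = ∑ m, ∑ n, E m a * E n b *
      ∑ q, ∑ j, E q p * E j i * riemann G m n q j y := by
    intro p i
    refine (pull_cons_cons E _ a b ![p, i]).trans ?_
    simp only [pull_two]
    rfl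
  have h3 : ∀ m n, pull E (slotAct (fun p i => riemannUp G m n p i y) (T y)) I =
      slotAct (fun d c => ∑ q, ∑ j, E q d * E j c * riemann G m n q j y) (pull E (T y)) I :=
    fun m n => pull_slotAct (h1 m n) (T y) I
  simp only [h2, slotAct_sum_left, slotAct_const_mul_left, ← h3]
  rw [pull_cons_cons, pull_cons_cons, Finset.sum_comm (γ := Fin 4)]
  simp only [← Finset.sum_sub_distrib, ← Finset.sum_neg_distrib]
  rw [Finset.sum_comm]
  refine Finset.sum_congr rfl fun m _ => Finset.sum_congr rfl fun n _ => ?_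
  rw [mul_comm (E n b), ← mul_sub, ← mul_neg, ← pull_sub, ← pull_neg]
  simp only [covDeriv_covDeriv_sub hT hG hy]

lemma IsOrthonormalFrame.pull_riemann (hE : IsOrthonormalFrame (G y) E) (a b c d : Fin 4) :
    pull E (riemannTensor G y) ![a, b, c, d] =
      curvatureOf (fun i j k l => pull E (weyl G y) ![i, j, k, l])
        (fun i j => pull E (schoutenTensor G y) ![i, j]) a b c d := by
  have hg : ∀ a b, pull E (metricTensor G y) ![a, b] = if a = b then 1 else 0 := fun a b => by
    rw [pull_two]; exact hE.pull_metricTensor a b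
  have h := fun α β hb => pull_mul (E := E) (k := 4) (metricTensor G y) (schoutenTensor G y) α β hb
    ![a, b, c, d]
  have e : riemannTensor G y = fun J => weyl G y J +
      (metricTensor G y (J ∘ ![2, 0]) * schoutenTensor G y (J ∘ ![1, 3])
      - metricTensor G y (J ∘ ![2, 1]) * schoutenTensor G y (J ∘ ![0, 3])
      + metricTensor G y (J ∘ ![3, 1]) * schoutenTensor G y (J ∘ ![0, 2])
      - metricTensor G y (J ∘ ![3, 0]) * schoutenTensor G y (J ∘ ![1, 2])) := by
    funext J
    simp only [weyl, riemannTensor, metricTensor, schoutenTensor, Function.comp_apply,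
      Matrix.cons_val]
    ring
  rw [e, pull_add, pull_sub, pull_add, pull_sub, h _ _ (by decide), h _ _ (by decide),
    h _ _ (by decide), h _ _ (by decide)]
  have v : ∀ p q : Fin 4, (![a, b, c, d] : Fin 4 → Fin 4) ∘ ![p, q] =
    ![(![a, b, c, d] : Fin 4 → Fin 4) p, (![a, b, c, d] : Fin 4 → Fin 4) q] := fun p q => by
    funext s; fin_cases s <;> rfl
  simp only [v, hg, Matrix.cons_val, curvatureOf]

lemma IsOrthonormalFrame.pull_covDeriv_riemann (hE : IsOrthonormalFrame (G y) E)
    (hG : IsMetricOn G Ω) (hy : y ∈ Ω) (e a b c d : Fin 4) :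
    pull E (covDeriv G (riemannTensor G) y) ![e, a, b, c, d] =
      curvatureOf (fun i j k l => pull E (covDeriv G (weyl G) y) ![e, i, j, k, l])
        (fun i j => pull E (covDeriv G (schoutenTensor G) y) ![e, i, j]) a b c d := by
  have hg : ∀ a b, pull E (metricTensor G y) ![a, b] = if a = b then 1 else 0 := fun a b => by
    rw [pull_two]; exact hE.pull_metricTensor a b
  have h := fun α β hb => pull_mul (E := E) (k := 5) (metricTensor G y)
    (covDeriv G (schoutenTensor G) y) α β hb ![e, a, b, c, d]
  have eq : covDeriv G (riemannTensor G) y = fun J => covDeriv G (weyl G) y J +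
      (metricTensor G y (J ∘ ![3, 1]) * covDeriv G (schoutenTensor G) y (J ∘ ![0, 2, 4])
      - metricTensor G y (J ∘ ![3, 2]) * covDeriv G (schoutenTensor G) y (J ∘ ![0, 1, 4])
      + metricTensor G y (J ∘ ![4, 2]) * covDeriv G (schoutenTensor G) y (J ∘ ![0, 1, 3])
      - metricTensor G y (J ∘ ![4, 1]) * covDeriv G (schoutenTensor G) y (J ∘ ![0, 2, 3])) := by
    funext J
    have hJ : J = ![J 0, J 1, J 2, J 3, J 4] := by funext s; fin_cases s <;> rfl
    have w : ∀ p q r : Fin 5, J ∘ ![p, q, r] = ![J p, J q, J r] := fun p q r => by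
      funext s; fin_cases s <;> rfl
    have := hG.covDeriv_weyl hy (J 0) (J 1) (J 2) (J 3) (J 4)
    rw [← hJ] at this
    rw [this]
    simp only [w, metricTensor, Function.comp_apply, Matrix.cons_val]
    ring
  rw [eq, pull_add, pull_sub, pull_add, pull_sub, h _ _ (by decide), h _ _ (by decide),
    h _ _ (by decide), h _ _ (by decide)]
  have v : ∀ p q : Fin 5, (![e, a, b, c, d] : Fin 5 → Fin 4) ∘ ![p, q] =
    ![(![e, a, b, c, d] : Fin 5 → Fin 4) p, (![e, a, b, c, d] : Fin 5 → Fin 4) q] := fun p q => by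
    funext s; fin_cases s <;> rfl
  have w : ∀ p q r : Fin 5, (![e, a, b, c, d] : Fin 5 → Fin 4) ∘ ![p, q, r] =
    ![(![e, a, b, c, d] : Fin 5 → Fin 4) p, (![e, a, b, c, d] : Fin 5 → Fin 4) q,
      (![e, a, b, c, d] : Fin 5 → Fin 4) r] := fun p q r => by
    funext s; fin_cases s <;> rfl
  simp only [v, w, hg, Matrix.cons_val, curvatureOf]

/-! ### Algebraic Weyl tensors with a duality -/

/-- The components `t i j k l`, at the point `y`, form an algebraic Weyl tensor on which the Hodge
star acts as `c`. -/
structure IsWeylEigenAt (G : E4 → Matrix (Fin 4) (Fin 4) ℝ) (c : ℝ) (y : E4)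
    (t : Fin 4 → Fin 4 → Fin 4 → Fin 4 → ℝ) : Prop where
  symm : ∀ i j k l, t k l i j = t i j k l
  trace : ∀ j l, ∑ a, ∑ b, (G y)⁻¹ a b * t a j b l = 0
  star : ∀ i j k l, ∑ p, ∑ q, starKernel G i j p q y * t p q k l = c * t i j k l

/-- Skewness and the algebraic Bianchi identity may be dropped: they are not used beyond this point,
the former being recovered from the star equation. The three conditions kept are linear with
parallel coefficients, hence inherited by covariant derivatives. -/
lemma IsSelfDualWeylAt.isWeylEigenAt {T : CoordTensor 4} (h : IsSelfDualWeylAt G T y) :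
    IsWeylEigenAt G 1 y fun i j k l => T y ![i, j, k, l] where
  symm := h.pair_symm
  trace := h.trace_free
  star i j k l := by rw [← hodgeStar_eq_starKernel, h.self_dual, one_mul]

lemma IsMetricOn.isWeylEigenAt_weyl (hG : IsMetricOn G Ω) (hy : y ∈ Ω)
    (h : ∀ I, weylPlus G y I = 0) :
    IsWeylEigenAt G (-1) y fun i j k l => weyl G y ![i, j, k, l] where
  symm := hG.weyl_pair_symm hy
  trace := hG.weyl_trace_free hy
  star i j k l := by
    have := h ![i, j, k, l]
    rw [weylPlus] at this
    rw [← hodgeStar_eq_starKernel]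
    linarith

variable {c : ℝ}

lemma IsWeylEigenAt.covDeriv {T : CoordTensor 4} (hT : SmoothTensor Ω T) (hG : IsMetricOn G Ω)
    (h : ∀ z ∈ Ω, IsWeylEigenAt G c z fun i j k l => T z ![i, j, k, l]) (hy : y ∈ Ω) (m : Fin 4) :
    IsWeylEigenAt G c y fun i j k l => covDeriv G T y ![m, i, j, k, l] where
  symm i j k l := by
    have := covDeriv_perm_eq (G := G) hT hG.isOpen ⟨![2, 3, 0, 1], ![2, 3, 0, 1], by decide,
      by decide⟩ 1
      (fun z hz I => by
        rw [one_mul, eta_four I]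
        exact Eq.trans (congrArg _ (by funext s; fin_cases s <;> rfl))
          ((h z hz).symm (I 0) (I 1) (I 2) (I 3))) hy m ![i, j, k, l]
    rw [one_mul] at this
    exact Eq.trans (congrArg _ (by funext s; fin_cases s <;> rfl)) this
  trace j l := by
    have := covDeriv_trace_eq (R := fun _ _ => 0) hT hG
      ⟨![0, 2, 1, 3], ![0, 2, 1, 3], by decide, by decide⟩
      (fun z hz I => by
        refine Eq.trans ?_ ((h z hz).trace (I 0) (I 1))
        refine Finset.sum_congr rfl fun a _ => Finset.sum_congr rfl fun b _ => ?_
        congr 2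
        funext s; fin_cases s <;> rfl) hy m ![j, l]
    rw [covDeriv_zero] at this
    refine Eq.trans ?_ this
    refine Finset.sum_congr rfl fun a _ => Finset.sum_congr rfl fun b _ => ?_
    congr 2
    funext s; fin_cases s <;> rfl
  star i j k l := by
    refine covDeriv_star_eq hT hG c (Equiv.refl _) (fun z hz a b I => ?_) hy m i j ![k, l]
    have e : ∀ p q, (Fin.cons p (Fin.cons q I : Fin 3 → Fin 4) : Fin 4 → Fin 4) ∘ (Equiv.refl _) =
      ![p, q, I 0, I 1] := fun p q => by funext s; fin_cases s <;> rfl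
    simp only [e]
    exact (h z hz).star a b (I 0) (I 1)

/-- Applied to `T = ∇U`, whose first slot is a spectator; this puts `∇∇U` in the same algebraic
class in its last four slots. -/
lemma IsWeylEigenAt.covDeriv_five {T : CoordTensor 5} (hT : SmoothTensor Ω T)
    (hG : IsMetricOn G Ω)
    (h : ∀ z ∈ Ω, ∀ n, IsWeylEigenAt G c z fun i j k l => T z ![n, i, j, k, l]) (hy : y ∈ Ω)
    (m n : Fin 4) :
    IsWeylEigenAt G c y fun i j k l => Coord.covDeriv G T y ![m, n, i, j, k, l] where
  symm i j k l := by
    have := covDeriv_perm_eq (G := G) hT hG.isOpen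
      ⟨![0, 3, 4, 1, 2], ![0, 3, 4, 1, 2], by decide, by decide⟩ 1
      (fun z hz I => by
        have hI : I = ![I 0, I 1, I 2, I 3, I 4] := by funext s; fin_cases s <;> rfl
        rw [one_mul, hI]
        exact Eq.trans (congrArg _ (by funext s; fin_cases s <;> rfl))
          ((h z hz (I 0)).symm (I 1) (I 2) (I 3) (I 4))) hy m ![n, i, j, k, l]
    rw [one_mul] at this
    exact Eq.trans (congrArg _ (by funext s; fin_cases s <;> rfl)) this
  trace j l := by
    have := covDeriv_trace_eq (R := fun _ _ => 0) hT hG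
      -- It rearranges `(a, b, n, j, l)`, with the contracted indices in front, into `(n, a, j, b,
      -- l)`.
      ⟨![2, 0, 3, 1, 4], ![1, 3, 0, 2, 4], by decide, by decide⟩
      (fun z hz I => by
        refine Eq.trans ?_ ((h z hz (I 0)).trace (I 1) (I 2))
        refine Finset.sum_congr rfl fun a _ => Finset.sum_congr rfl fun b _ => ?_
        congr 2
        funext s; fin_cases s <;> rfl) hy m ![n, j, l]
    rw [covDeriv_zero] at this
    refine Eq.trans ?_ this
    refine Finset.sum_congr rfl fun a _ => Finset.sum_congr rfl fun b _ => ?_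
    congr 2
    funext s; fin_cases s <;> rfl
  star i j k l := by
    have e : ∀ p q (I : Fin 3 → Fin 4), (Fin.cons p (Fin.cons q I : Fin 4 → Fin 4) :
      Fin 5 → Fin 4) ∘ ![2, 0, 1, 3, 4] = ![I 0, p, q, I 1, I 2] :=
      fun p q I => by funext s; fin_cases s <;> rfl
    have := covDeriv_star_eq hT hG c ⟨![2, 0, 1, 3, 4], ![1, 2, 0, 3, 4], by decide, by decide⟩
      (fun z hz a b I => by
        simp only [Equiv.coe_fn_mk, e]
        exact (h z hz (I 0)).star a b (I 1) (I 2)) hy m i j ![n, k, l]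
    simp only [Equiv.coe_fn_mk, e] at this
    exact this

lemma IsOrthonormalFrame.isWeylDuality_four (hE : IsOrthonormalFrame (G y) E) (hc : c * c = 1)
    {T : (Fin 4 → Fin 4) → ℝ} (h : IsWeylEigenAt G c y fun i j k l => T ![i, j, k, l]) :
    IsWeylDuality c fun i j k l => pull E T ![i, j, k, l] where
  left k l := by
    have e : ∀ p q (I : Fin 2 → Fin 4), (Fin.cons p (Fin.cons q I : Fin 3 → Fin 4) :
      Fin 4 → Fin 4) ∘ (Equiv.refl _) = ![p, q, I 0, I 1] :=
      fun p q I => by funext s; fin_cases s <;> rfl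
    have := hE.pull_star_isDuality (T := T) hc (Equiv.refl _) (fun a b I => by
      simp only [e]
      exact h.star a b (I 0) (I 1)) ![k, l]
    exact this
  symm i j k l := by
    have := pull_perm_eq (E := E) (T := T) ⟨![2, 3, 0, 1], ![2, 3, 0, 1], by decide, by decide⟩ 1
      (fun I => by
        rw [one_mul, eta_four I]
        exact Eq.trans (congrArg _ (by funext s; fin_cases s <;> rfl))
          (h.symm (I 0) (I 1) (I 2) (I 3))) ![i, j, k, l]
    rw [one_mul] at this
    exact Eq.trans (congrArg _ (by funext s; fin_cases s <;> rfl)) this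
  trace j l := by
    have := hE.pull_trace_eq (T := T) (R := fun _ => 0)
      ⟨![0, 2, 1, 3], ![0, 2, 1, 3], by decide, by decide⟩
      (fun I => by
        refine Eq.trans ?_ (h.trace (I 0) (I 1))
        refine Finset.sum_congr rfl fun a _ => Finset.sum_congr rfl fun b _ => ?_
        congr 2
        funext s; fin_cases s <;> rfl) ![j, l]
    rw [pull_zero] at this
    refine Eq.trans ?_ this
    refine Finset.sum_congr rfl fun a _ => ?_
    congr 1
    funext s; fin_cases s <;> rfl

lemma IsWeylDuality.sum_mul {t : Fin 4 → Fin 4 → Fin 4 → Fin 4 → Fin 4 → ℝ}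
    (h : ∀ b, IsWeylDuality c (t b)) (r : Fin 4 → ℝ) :
    IsWeylDuality c fun i j k l => ∑ b, r b * t b i j k l where
  left k l := IsDuality.sum _ fun b _ => ((h b).left k l).const_mul (r b)
  symm i j k l := by simp only [(h _).symm i j k l]
  trace j l := by
    rw [Finset.sum_comm]
    simp only [← Finset.mul_sum, (h _).trace, mul_zero, Finset.sum_const_zero]

lemma IsOrthonormalFrame.isWeylDuality_five (hE : IsOrthonormalFrame (G y) E) (hc : c * c = 1)
    {T : (Fin 5 → Fin 4) → ℝ} (h : ∀ m, IsWeylEigenAt G c y fun i j k l => T ![m, i, j, k, l])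
    (m : Fin 4) : IsWeylDuality c fun i j k l => pull E T ![m, i, j, k, l] := by
  have e : (fun i j k l => pull E T ![m, i, j, k, l]) = fun i j k l => ∑ b, E b m *
      pull E (fun J => T (Fin.cons b J : Fin 5 → Fin 4)) ![i, j, k, l] := by
    funext i j k l
    exact pull_cons E T m ![i, j, k, l]
  rw [e]
  exact IsWeylDuality.sum_mul (fun b => hE.isWeylDuality_four hc (h b)) _

lemma IsOrthonormalFrame.isWeylDuality_six (hE : IsOrthonormalFrame (G y) E) (hc : c * c = 1)
    {T : (Fin 6 → Fin 4) → ℝ} (h : ∀ m n, IsWeylEigenAt G c y fun i j k l => T ![m, n, i, j, k, l])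
    (m n : Fin 4) : IsWeylDuality c fun i j k l => pull E T ![m, n, i, j, k, l] := by
  have e : (fun i j k l => pull E T ![m, n, i, j, k, l]) = fun i j k l => ∑ b, E b m *
      pull E (fun J => T (Fin.cons b J : Fin 6 → Fin 4)) ![n, i, j, k, l] := by
    funext i j k l
    exact pull_cons E T m ![n, i, j, k, l]
  rw [e]
  exact IsWeylDuality.sum_mul (fun b => hE.isWeylDuality_five hc (h b) n) _

end Coord

/-! ### Frame components of `U`, of the curvature and of their covariant derivatives. -/

namespace Coord

variable {G : E4 → Matrix (Fin 4) (Fin 4) ℝ} {Ω : Set E4} {y : E4}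
  {E : Matrix (Fin 4) (Fin 4) ℝ} {u : CoordTensor 4}

/-- The frame components of a double trace. -/
lemma IsOrthonormalFrame.pull_double_trace {g : Matrix (Fin 4) (Fin 4) ℝ}
    (hE : IsOrthonormalFrame g E) {k : ℕ} (T : (Fin (k + 4) → Fin 4) → ℝ)
    (σ : Equiv.Perm (Fin (k + 4))) (I : Fin k → Fin 4) :
    pull E (fun J => ∑ a, ∑ b, g⁻¹ a b * ∑ c, ∑ d, g⁻¹ c d *
      T ((Fin.cons c (Fin.cons d (Fin.cons a (Fin.cons b J : Fin (k + 1) → Fin 4) :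
        Fin (k + 2) → Fin 4) : Fin (k + 3) → Fin 4) : Fin (k + 4) → Fin 4) ∘ σ)) I =
      ∑ a, ∑ c, pull E T ((Fin.cons c (Fin.cons c (Fin.cons a (Fin.cons a I :
        Fin (k + 1) → Fin 4) : Fin (k + 2) → Fin 4) : Fin (k + 3) → Fin 4) :
        Fin (k + 4) → Fin 4) ∘ σ) := by
  refine (hE.pull_trace (fun K => ∑ c, ∑ d, g⁻¹ c d *
      T ((Fin.cons c (Fin.cons d K : Fin (k + 3) → Fin 4) : Fin (k + 4) → Fin 4) ∘ σ)) I).trans ?_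
  refine Finset.sum_congr rfl fun a _ => ?_
  rw [← hE.pull_trace_eq σ fun _ => rfl]

/-- On `Ω`, the metric `G` is anti-self-dual and `u` is a smooth section of `𝒲⁺` in the kernel of
`𝒟*`. -/
structure IsDstarKernelOn (G : E4 → Matrix (Fin 4) (Fin 4) ℝ) (Ω : Set E4) (u : CoordTensor 4) :
    Prop where
  metric : IsMetricOn G Ω
  asd : ∀ z ∈ Ω, ∀ I, weylPlus G z I = 0
  smooth : SmoothTensor Ω u
  weyl : ∀ z ∈ Ω, IsSelfDualWeylAt G u z
  dstar : ∀ z ∈ Ω, ∀ i j, Dstar G u z ![i, j] = 0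

namespace IsDstarKernelOn

lemma eigen (h : IsDstarKernelOn G Ω u) (hy : y ∈ Ω) :
    IsWeylEigenAt G 1 y fun i j k l => u y ![i, j, k, l] := (h.weyl y hy).isWeylEigenAt

lemma eigen_covDeriv (h : IsDstarKernelOn G Ω u) (hy : y ∈ Ω) (m : Fin 4) :
    IsWeylEigenAt G 1 y fun i j k l => covDeriv G u y ![m, i, j, k, l] :=
  IsWeylEigenAt.covDeriv h.smooth h.metric (fun _ hz => h.eigen hz) hy m

lemma eigen_covDeriv_covDeriv (h : IsDstarKernelOn G Ω u) (hy : y ∈ Ω) (m n : Fin 4) :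
    IsWeylEigenAt G 1 y fun i j k l => covDeriv G (covDeriv G u) y ![m, n, i, j, k, l] :=
  IsWeylEigenAt.covDeriv_five (h.smooth.covDeriv h.metric) h.metric
    (fun _ hz => h.eigen_covDeriv hz) hy m n

lemma duality (h : IsDstarKernelOn G Ω u) (hy : y ∈ Ω) (hE : IsOrthonormalFrame (G y) E) :
    IsWeylDuality 1 fun i j k l => pull E (u y) ![i, j, k, l] :=
  hE.isWeylDuality_four (by norm_num) (h.eigen hy)

lemma duality_covDeriv (h : IsDstarKernelOn G Ω u) (hy : y ∈ Ω) (hE : IsOrthonormalFrame (G y) E)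
    (m : Fin 4) : IsWeylDuality 1 fun i j k l => pull E (covDeriv G u y) ![m, i, j, k, l] :=
  hE.isWeylDuality_five (by norm_num) (h.eigen_covDeriv hy) m

lemma duality_covDeriv_covDeriv (h : IsDstarKernelOn G Ω u) (hy : y ∈ Ω)
    (hE : IsOrthonormalFrame (G y) E) (m n : Fin 4) :
    IsWeylDuality 1 fun i j k l => pull E (covDeriv G (covDeriv G u) y) ![m, n, i, j, k, l] :=
  hE.isWeylDuality_six (by norm_num) (h.eigen_covDeriv_covDeriv hy) m n

lemma duality_weyl (h : IsDstarKernelOn G Ω u) (hy : y ∈ Ω) (hE : IsOrthonormalFrame (G y) E) :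
    IsWeylDuality (-1) fun i j k l => pull E (Coord.weyl G y) ![i, j, k, l] :=
  hE.isWeylDuality_four (by norm_num) (h.metric.isWeylEigenAt_weyl hy (h.asd y hy))

lemma duality_covDeriv_weyl (h : IsDstarKernelOn G Ω u) (hy : y ∈ Ω)
    (hE : IsOrthonormalFrame (G y) E) (m : Fin 4) :
    IsWeylDuality (-1) fun i j k l => pull E (covDeriv G (Coord.weyl G) y) ![m, i, j, k, l] :=
  hE.isWeylDuality_five (by norm_num) (fun m => IsWeylEigenAt.covDeriv h.metric.smooth_weyl
    h.metric (fun z hz => h.metric.isWeylEigenAt_weyl hz (h.asd z hz)) hy m) m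

end IsDstarKernelOn

lemma IsMetricOn.pull_schouten_symm (hG : IsMetricOn G Ω) (hy : y ∈ Ω) (a b : Fin 4) :
    pull E (schoutenTensor G y) ![a, b] = pull E (schoutenTensor G y) ![b, a] := by
  rw [pull_two, pull_two, Finset.sum_comm]
  refine Finset.sum_congr rfl fun p _ => Finset.sum_congr rfl fun q _ => ?_
  have : schoutenTensor G y ![q, p] = schoutenTensor G y ![p, q] := hG.schouten_symm hy q p
  rw [this]
  ring

lemma IsMetricOn.pull_covDeriv_schouten_symm (hG : IsMetricOn G Ω) (hy : y ∈ Ω) (m a b : Fin 4) :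
    pull E (covDeriv G (schoutenTensor G) y) ![m, a, b] =
      pull E (covDeriv G (schoutenTensor G) y) ![m, b, a] := by
  have h1 : ∀ m a b, covDeriv G (schoutenTensor G) y ![m, b, a] =
      covDeriv G (schoutenTensor G) y ![m, a, b] := by
    intro m a b
    have := covDeriv_perm_eq (G := G) hG.smooth_schoutenTensor hG.isOpen
      ⟨![1, 0], ![1, 0], by decide, by decide⟩ 1
      (fun z hz I => by
        rw [one_mul]
        exact hG.schouten_symm hz (I 1) (I 0)) hy m ![a, b]
    rw [one_mul] at this
    exact Eq.trans (congrArg _ (by funext s; fin_cases s <;> rfl)) this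
  have h2 := pull_perm_eq (E := E) (T := covDeriv G (schoutenTensor G) y)
    ⟨![0, 2, 1], ![0, 2, 1], by decide, by decide⟩ 1
    (fun I => by
      rw [one_mul, eta_three I]
      exact Eq.trans (congrArg _ (by funext s; fin_cases s <;> rfl)) (h1 (I 0) (I 1) (I 2)))
    ![m, a, b]
  rw [one_mul] at h2
  rw [← h2]
  exact congrArg _ (by funext s; fin_cases s <;> rfl)

/-- In an orthonormal frame, the Cotton tensor of an anti-self-dual metric is anti-self-dual, and
the divergence of the Schouten tensor is the differential of its trace. -/
lemma IsDstarKernelOn.cotton (h : IsDstarKernelOn G Ω u) (hy : y ∈ Ω)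
    (hE : IsOrthonormalFrame (G y) E) :
    (∀ d, IsDuality (-1) fun a b => pull E (covDeriv G (schoutenTensor G) y) ![a, b, d] -
      pull E (covDeriv G (schoutenTensor G) y) ![b, a, d]) ∧
    ∀ m, ∑ k, pull E (covDeriv G (schoutenTensor G) y) ![k, k, m] =
      ∑ a, pull E (covDeriv G (schoutenTensor G) y) ![m, a, a] := by
  refine isDuality_cotton (DW := fun e a b c d => pull E (covDeriv G (Coord.weyl G) y)
    ![e, a, b, c, d]) (DP := fun m a b => pull E (covDeriv G (schoutenTensor G) y) ![m, a, b])
    (h.duality_covDeriv_weyl hy hE) (h.metric.pull_covDeriv_schouten_symm hy) ?_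
  intro e a b c d
  simp only [← hE.pull_covDeriv_riemann h.metric hy]
  have hp := fun σ => pull_reindex E (covDeriv G (riemannTensor G) y) σ ![e, a, b, c, d]
  have h1 := hp ⟨![1, 2, 0, 3, 4], ![2, 0, 1, 3, 4], by decide, by decide⟩
  have h2 := hp ⟨![2, 0, 1, 3, 4], ![1, 2, 0, 3, 4], by decide, by decide⟩
  have e1 : (![e, a, b, c, d] : Fin 5 → Fin 4) ∘ ![1, 2, 0, 3, 4] = ![a, b, e, c, d] := by
    funext s; fin_cases s <;> rfl
  have e2 : (![e, a, b, c, d] : Fin 5 → Fin 4) ∘ ![2, 0, 1, 3, 4] = ![b, e, a, c, d] := by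
    funext s; fin_cases s <;> rfl
  simp only [Equiv.coe_fn_mk, e1, e2] at h1 h2
  rw [← h1, ← h2, ← pull_add, ← pull_add, ← pull_zero E ![e, a, b, c, d]]
  congr 1
  funext J
  have hJ : J = ![J 0, J 1, J 2, J 3, J 4] := by funext s; fin_cases s <;> rfl
  rw [hJ]
  refine Eq.trans (congrArg₂ (· + ·) (congrArg₂ (· + ·) rfl (congrArg _ ?_)) (congrArg _ ?_))
    (h.metric.covDeriv_riemann_cyclic hy (J 0) (J 1) (J 2) (J 3) (J 4))
  · funext s; fin_cases s <;> rfl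
  · funext s; fin_cases s <;> rfl

/-! ### The Ricci identity for a Weyl tensor and its divergence -/

lemma IsOrthonormalFrame.ricci_identity_four (hE : IsOrthonormalFrame (G y) E)
    {T : CoordTensor 4} (hT : SmoothTensor Ω T) (hG : IsMetricOn G Ω) (hy : y ∈ Ω)
    (a b i j k l : Fin 4) :
    pull E (covDeriv G (covDeriv G T) y) ![a, b, i, j, k, l] -
      pull E (covDeriv G (covDeriv G T) y) ![b, a, i, j, k, l] =
      - curvAct4 (curvatureOf (fun i j k l => pull E (weyl G y) ![i, j, k, l])
        (fun i j => pull E (schoutenTensor G y) ![i, j]))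
        (fun i j k l => pull E (T y) ![i, j, k, l]) a b i j k l := by
  refine (hE.pull_ricci_identity hT hG hy a b ![i, j, k, l]).trans ?_
  simp only [slotAct_vecCons, slotAct_zero_rank, hE.pull_riemann, curvAct4,
    Finset.sum_add_distrib]
  ring

lemma IsOrthonormalFrame.ricci_identity_three (hE : IsOrthonormalFrame (G y) E)
    {T : CoordTensor 3} (hT : SmoothTensor Ω T) (hG : IsMetricOn G Ω) (hy : y ∈ Ω)
    (a b i j k : Fin 4) :
    pull E (covDeriv G (covDeriv G T) y) ![a, b, i, j, k] -
      pull E (covDeriv G (covDeriv G T) y) ![b, a, i, j, k] =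
      - curvAct3 (curvatureOf (fun i j k l => pull E (weyl G y) ![i, j, k, l])
        (fun i j => pull E (schoutenTensor G y) ![i, j]))
        (fun i j k => pull E (T y) ![i, j, k]) a b i j k := by
  refine (hE.pull_ricci_identity hT hG hy a b ![i, j, k]).trans ?_
  simp only [slotAct_vecCons, slotAct_zero_rank, hE.pull_riemann, curvAct3,
    Finset.sum_add_distrib]
  ring

end Coord

namespace Coord

variable {G : E4 → Matrix (Fin 4) (Fin 4) ℝ} {Ω : Set E4} {y : E4}
  {E : Matrix (Fin 4) (Fin 4) ℝ} {u : CoordTensor 4}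

/-! ### The divergence of a section of `𝒲⁺` in the kernel of `𝒟*` -/

namespace IsDstarKernelOn

lemma divergence_eq (h : IsDstarKernelOn G Ω u) : ∀ z ∈ Ω, ∀ I : Fin 3 → Fin 4,
    divergence G u z I = traceHead G (covDeriv G u) z I := by
  intro z hz I
  simp only [divergence, traceHead]
  rw [Finset.sum_comm]
  refine Finset.sum_congr rfl fun a _ => Finset.sum_congr rfl fun b _ => ?_
  rw [h.metric.inv_symm hz]
  congr 2
  funext s; fin_cases s <;> rfl

lemma smooth_divergence (h : IsDstarKernelOn G Ω u) : SmoothTensor Ω (divergence G u) := fun _ =>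
  ContDiffOn.sum fun _ _ => ContDiffOn.sum fun _ _ =>
    (h.metric.smooth_inv _ _).mul (h.smooth.covDeriv h.metric _)

lemma pull_divergence (h : IsDstarKernelOn G Ω u) (hy : y ∈ Ω) (hE : IsOrthonormalFrame (G y) E)
    (l i j : Fin 4) : pull E (divergence G u y) ![l, i, j] =
      ∑ m, pull E (covDeriv G u y) ![m, m, l, i, j] := by
  rw [show divergence G u y = traceHead G (covDeriv G u) y from funext fun I =>
    h.divergence_eq y hy I]
  exact hE.pull_trace (covDeriv G u y) ![l, i, j]

lemma pull_covDeriv_divergence (h : IsDstarKernelOn G Ω u) (hy : y ∈ Ω)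
    (hE : IsOrthonormalFrame (G y) E) (k l i j : Fin 4) :
    pull E (covDeriv G (divergence G u) y) ![k, l, i, j] =
      ∑ m, pull E (covDeriv G (covDeriv G u) y) ![k, m, m, l, i, j] := by
  have e : ∀ (a b : Fin 4) (I : Fin 4 → Fin 4), (Fin.cons a (Fin.cons b I : Fin 5 → Fin 4) :
      Fin 6 → Fin 4) ∘ ![2, 0, 1, 3, 4, 5] = ![I 0, a, b, I 1, I 2, I 3] :=
    fun a b I => by funext s; fin_cases s <;> rfl
  have := hE.pull_trace_eq (T := covDeriv G (covDeriv G u) y)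
    (R := covDeriv G (divergence G u) y)
    ⟨![2, 0, 1, 3, 4, 5], ![1, 2, 0, 3, 4, 5], by decide, by decide⟩ (fun I => by
      rw [covDeriv_congr h.metric.isOpen hy h.divergence_eq, eta_four I]
      refine Eq.trans ?_ (covDeriv_traceHead (h.smooth.covDeriv h.metric) h.metric hy (I 0)
        ![I 1, I 2, I 3]).symm
      simp only [Equiv.coe_fn_mk, e]
      refine Finset.sum_congr rfl fun a _ => Finset.sum_congr rfl fun b _ => ?_
      rfl) ![k, l, i, j]
  rw [← this]
  simp only [Equiv.coe_fn_mk, e]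
  rfl

/-- The trace of `δU` is a divergence of the trace of `U`. The argument uses a frame at each point,
but the result is kept in coordinates so that it can be differentiated. -/
lemma trace_divergence (h : IsDstarKernelOn G Ω u) (hy : y ∈ Ω) (I : Fin 1 → Fin 4) :
    ∑ a, ∑ b, (G y)⁻¹ a b * divergence G u y
      ((Fin.cons a (Fin.cons b I : Fin 2 → Fin 4) : Fin 3 → Fin 4) ∘ ![0, 2, 1]) = 0 := by
  obtain ⟨E, hE⟩ := exists_isOrthonormalFrame (h.metric.posDef y hy)
  refine eq_zero_of_pull_eq_zero hE.isUnit_det (T := fun I => ∑ a, ∑ b, (G y)⁻¹ a b *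
    divergence G u y ((Fin.cons a (Fin.cons b I : Fin 2 → Fin 4) : Fin 3 → Fin 4) ∘ ![0, 2, 1]))
    (fun I => ?_) I
  refine (hE.pull_trace_eq (T := divergence G u y)
    ⟨![0, 2, 1], ![0, 2, 1], by decide, by decide⟩ (fun _ => rfl) I).symm.trans ?_
  have e : ∀ a, (Fin.cons a (Fin.cons a I : Fin 2 → Fin 4) : Fin 3 → Fin 4) ∘ ![0, 2, 1] =
    ![a, I 0, a] := fun a => by funext s; fin_cases s <;> rfl
  simp only [Equiv.coe_fn_mk, e, h.pull_divergence hy hE]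
  rw [Finset.sum_comm]
  refine Finset.sum_eq_zero fun m _ => ?_
  exact (h.duality_covDeriv hy hE m).trace' m (I 0)

/-- Pair symmetry of `∇U` moves `ij` to the first pair, where its star equation is available. -/
lemma star_divergence (h : IsDstarKernelOn G Ω u) (hy : y ∈ Ω) (i j l : Fin 4) :
    ∑ p, ∑ q, starKernel G i j p q y * divergence G u y ![l, p, q] =
      1 * divergence G u y ![l, i, j] := by
  have e : ∀ p q m n, covDeriv G u y ![n, m, l, p, q] = covDeriv G u y ![n, p, q, m, l] :=
    fun p q m n => (h.eigen_covDeriv hy n).symm p q m l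
  have e2 : ∀ p q, divergence G u y ![l, p, q] =
      ∑ m, ∑ n, (G y)⁻¹ m n * covDeriv G u y ![n, p, q, m, l] := fun p q => by
    simp only [← e]
    rfl
  have e3 : ∀ F : Fin 4 → Fin 4 → Fin 4 → Fin 4 → ℝ, ∑ a, ∑ b, ∑ p, ∑ q, F a b p q =
      ∑ p, ∑ q, ∑ a, ∑ b, F a b p q := fun F => sum_four_swap F
  simp only [e2, Finset.mul_sum]
  rw [e3]
  refine Finset.sum_congr rfl fun m _ => Finset.sum_congr rfl fun n _ => ?_
  rw [mul_left_comm, ← (h.eigen_covDeriv hy n).star i j m l, Finset.mul_sum]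
  refine Finset.sum_congr rfl fun p _ => ?_
  rw [Finset.mul_sum]
  exact Finset.sum_congr rfl fun q _ => by ring

/-- The star equation for `δU` is differentiated twice in coordinates, and only then evaluated in
the frame, which is chosen at the single point `y`. -/
lemma duality_covDeriv_covDeriv_divergence (h : IsDstarKernelOn G Ω u) (hy : y ∈ Ω)
    (hE : IsOrthonormalFrame (G y) E) (a b l : Fin 4) : IsDuality 1 fun i j =>
      pull E (covDeriv G (covDeriv G (divergence G u)) y) ![a, b, l, i, j] := by
  have e3 : ∀ p q (I : Fin 1 → Fin 4), (Fin.cons p (Fin.cons q I : Fin 2 → Fin 4) :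
      Fin 3 → Fin 4) ∘ ![2, 0, 1] = ![I 0, p, q] :=
    fun p q I => by funext s; fin_cases s <;> rfl
  have e4 : ∀ p q (I : Fin 2 → Fin 4), (Fin.cons p (Fin.cons q I : Fin 3 → Fin 4) :
      Fin 4 → Fin 4) ∘ ![2, 3, 0, 1] = ![I 0, I 1, p, q] :=
    fun p q I => by funext s; fin_cases s <;> rfl
  have e5 : ∀ p q (I : Fin 3 → Fin 4), (Fin.cons p (Fin.cons q I : Fin 4 → Fin 4) :
      Fin 5 → Fin 4) ∘ ![2, 3, 4, 0, 1] = ![I 0, I 1, I 2, p, q] :=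
    fun p q I => by funext s; fin_cases s <;> rfl
  have h1 : ∀ z ∈ Ω, ∀ i j l b, ∑ p, ∑ q, starKernel G i j p q z *
      covDeriv G (divergence G u) z ![b, l, p, q] =
      1 * covDeriv G (divergence G u) z ![b, l, i, j] := by
    intro z hz i j l b
    have := covDeriv_star_eq h.smooth_divergence h.metric 1
      ⟨![2, 0, 1], ![1, 2, 0], by decide, by decide⟩ (fun z hz i j I => by
        simp only [Equiv.coe_fn_mk, e3]
        exact h.star_divergence hz i j (I 0)) hz b i j ![l]
    simp only [Equiv.coe_fn_mk, e3] at this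
    exact this
  have h2 : ∀ i j l b a, ∑ p, ∑ q, starKernel G i j p q y *
      covDeriv G (covDeriv G (divergence G u)) y ![a, b, l, p, q] =
      1 * covDeriv G (covDeriv G (divergence G u)) y ![a, b, l, i, j] := by
    intro i j l b a
    have := covDeriv_star_eq (h.smooth_divergence.covDeriv h.metric) h.metric 1
      ⟨![2, 3, 0, 1], ![2, 3, 0, 1], by decide, by decide⟩ (fun z hz i j I => by
        simp only [Equiv.coe_fn_mk, e4]
        exact h1 z hz i j (I 1) (I 0)) hy a i j ![b, l]
    simp only [Equiv.coe_fn_mk, e4] at this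
    exact this
  have := hE.pull_star_isDuality (c := 1) (by norm_num)
    (T := covDeriv G (covDeriv G (divergence G u)) y)
    ⟨![2, 3, 4, 0, 1], ![3, 4, 0, 1, 2], by decide, by decide⟩ (fun i j I => by
      simp only [Equiv.coe_fn_mk, e5]
      exact h2 i j (I 2) (I 1) (I 0)) ![a, b, l]
  simp only [Equiv.coe_fn_mk, e5] at this
  exact this

lemma trace_covDeriv_covDeriv_divergence (h : IsDstarKernelOn G Ω u) (hy : y ∈ Ω)
    (hE : IsOrthonormalFrame (G y) E) (a b i : Fin 4) :
    ∑ l, pull E (covDeriv G (covDeriv G (divergence G u)) y) ![a, b, l, i, l] = 0 := by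
  have e4 : ∀ p q (I : Fin 2 → Fin 4), (Fin.cons p (Fin.cons q I : Fin 3 → Fin 4) :
      Fin 4 → Fin 4) ∘ ![2, 0, 3, 1] = ![I 0, p, I 1, q] :=
    fun p q I => by funext s; fin_cases s <;> rfl
  have e5 : ∀ p q (I : Fin 3 → Fin 4), (Fin.cons p (Fin.cons q I : Fin 4 → Fin 4) :
      Fin 5 → Fin 4) ∘ ![2, 3, 0, 4, 1] = ![I 0, I 1, p, I 2, q] :=
    fun p q I => by funext s; fin_cases s <;> rfl
  have h1 : ∀ z ∈ Ω, ∀ b i, ∑ p, ∑ q, (G z)⁻¹ p q *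
      covDeriv G (divergence G u) z ![b, p, i, q] = 0 := by
    intro z hz b i
    have := covDeriv_trace_eq (R := fun _ _ => 0) h.smooth_divergence h.metric
      ⟨![0, 2, 1], ![0, 2, 1], by decide, by decide⟩ (fun z hz I => h.trace_divergence hz I)
      hz b ![i]
    rw [covDeriv_zero] at this
    refine Eq.trans ?_ this
    refine Finset.sum_congr rfl fun a _ => Finset.sum_congr rfl fun b _ => ?_
    congr 2
    funext s; fin_cases s <;> rfl
  have h2 : ∀ a b i, ∑ p, ∑ q, (G y)⁻¹ p q *
      covDeriv G (covDeriv G (divergence G u)) y ![a, b, p, i, q] = 0 := by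
    intro a b i
    have := covDeriv_trace_eq (R := fun _ _ => 0) (h.smooth_divergence.covDeriv h.metric) h.metric
      ⟨![2, 0, 3, 1], ![1, 3, 0, 2], by decide, by decide⟩ (fun z hz I => by
        simp only [Equiv.coe_fn_mk, e4]
        exact h1 z hz (I 0) (I 1)) hy a ![b, i]
    rw [covDeriv_zero] at this
    simp only [Equiv.coe_fn_mk, e4] at this
    exact this
  have := hE.pull_trace_eq (R := fun _ => 0) (T := covDeriv G (covDeriv G (divergence G u)) y)
    ⟨![2, 3, 0, 4, 1], ![2, 4, 0, 1, 3], by decide, by decide⟩ (fun I => by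
      simp only [Equiv.coe_fn_mk, e5]
      exact h2 (I 0) (I 1) (I 2)) ![a, b, i]
  rw [pull_zero] at this
  simp only [Equiv.coe_fn_mk, e5] at this
  exact this

end IsDstarKernelOn
end Coord

/-! ### The equation `𝒟*U = 0` in a frame, and its covariant derivative. -/

namespace Coord

variable {G : E4 → Matrix (Fin 4) (Fin 4) ℝ} {Ω : Set E4} {y : E4}
  {E : Matrix (Fin 4) (Fin 4) ℝ} {u : CoordTensor 4}

/-- The contraction `P^{ab} T_{kaib}`. -/
def schoutenContract (G : E4 → Matrix (Fin 4) (Fin 4) ℝ) (T : CoordTensor 4) : CoordTensor 2 :=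
  traceHead G (traceHead G fun z J => prodHead (schoutenTensor G) T z (J ∘ ![3, 1, 4, 2, 5, 0]))

lemma IsOrthonormalFrame.pull_schoutenContract (hE : IsOrthonormalFrame (G y) E)
    (T : CoordTensor 4) (k i : Fin 4) :
    pull E (schoutenContract G T y) ![k, i] =
      ∑ a, ∑ b, pull E (schoutenTensor G y) ![a, b] * pull E (T y) ![k, a, i, b] := by
  refine (hE.pull_double_trace (prodHead (schoutenTensor G) T y)
    ⟨![3, 1, 4, 2, 5, 0], ![5, 1, 3, 0, 2, 4], by decide, by decide⟩ ![k, i]).trans ?_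
  refine Finset.sum_congr rfl fun a _ => Finset.sum_congr rfl fun b _ => ?_
  refine Eq.trans (congrArg _ ?_) (pull_prodHead E (schoutenTensor G) T a b ![k, a, i, b])
  funext s; fin_cases s <;> rfl

lemma IsMetricOn.pull_covDeriv_schoutenContract (hG : IsMetricOn G Ω) (hy : y ∈ Ω)
    (hE : IsOrthonormalFrame (G y) E) {T : CoordTensor 4} (hT : SmoothTensor Ω T) (m k i : Fin 4) :
    pull E (covDeriv G (schoutenContract G T) y) ![m, k, i] =
      ∑ a, ∑ b, (pull E (covDeriv G (schoutenTensor G) y) ![m, a, b] * pull E (T y) ![k, a, i, b] +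
        pull E (schoutenTensor G y) ![a, b] * pull E (covDeriv G T y) ![m, k, a, i, b]) := by
  -- `σ` arranges `(c, d, a, b, k, i)` as `(b, d, k, a, i, c)`, that is `P_{bd} T_{kaic}`; `τ` does
  -- the same with the derivative index placed in front.
  let σ : Equiv.Perm (Fin 6) := ⟨![3, 1, 4, 2, 5, 0], ![5, 1, 3, 0, 2, 4], by decide, by decide⟩
  let τ : Equiv.Perm (Fin 7) :=
    ⟨![4, 3, 1, 5, 2, 6, 0], ![6, 2, 4, 1, 0, 3, 5], by decide, by decide⟩
  have hQ := hG.smooth_schoutenTensor.prodHead hT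
  have h1 : covDeriv G (schoutenContract G T) y = fun J => ∑ a, ∑ b, (G y)⁻¹ a b *
      ∑ c, ∑ d, (G y)⁻¹ c d * covDeriv G (prodHead (schoutenTensor G) T) y
      ((Fin.cons c (Fin.cons d (Fin.cons a (Fin.cons b J : Fin 4 → Fin 4) :
        Fin 5 → Fin 4) : Fin 6 → Fin 4) : Fin 7 → Fin 4) ∘ τ) := by
    funext J
    have hJ : J = Fin.cons (J 0) ![J 1, J 2] := by funext s; fin_cases s <;> rfl
    conv_lhs => rw [hJ]
    refine (covDeriv_traceHead ((hQ.reindex σ).traceHead hG) hG hy (J 0) ![J 1, J 2]).trans ?_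
    refine Finset.sum_congr rfl fun a _ => Finset.sum_congr rfl fun b _ => congrArg _ ?_
    refine (covDeriv_traceHead (hQ.reindex σ) hG hy (J 0) ![a, b, J 1, J 2]).trans ?_
    refine Finset.sum_congr rfl fun c _ => Finset.sum_congr rfl fun d _ => congrArg _ ?_
    rw [covDeriv_reindex]
    refine congrArg _ ?_
    funext s; fin_cases s <;> rfl
  have h2 : covDeriv G (prodHead (schoutenTensor G) T) y = fun J =>
      covDeriv G (schoutenTensor G) y (J ∘ ![0, 1, 2]) * T y (J ∘ ![3, 4, 5, 6]) +
      schoutenTensor G y (J ∘ ![1, 2]) * covDeriv G T y (J ∘ ![0, 3, 4, 5, 6]) := by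
    funext J
    have hJ : J = Fin.cons (J 0) (Fin.cons (J 1) (Fin.cons (J 2) ![J 3, J 4, J 5, J 6])) := by
      funext s; fin_cases s <;> rfl
    conv_lhs => rw [hJ]
    refine (covDeriv_prodHead hG.smooth_schoutenTensor hT hG.isOpen hy (J 0) (J 1) (J 2)
      ![J 3, J 4, J 5, J 6]).trans ?_
    refine congrArg₂ _ (congrArg₂ _ (congrArg _ ?_) (congrArg _ ?_))
      (congrArg₂ _ (congrArg _ ?_) (congrArg _ ?_)) <;>
    · funext s; fin_cases s <;> rfl
  rw [h1]
  refine (hE.pull_double_trace _ τ ![m, k, i]).trans ?_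
  refine Finset.sum_congr rfl fun a _ => Finset.sum_congr rfl fun b _ => ?_
  rw [h2, pull_add, pull_mul (covDeriv G (schoutenTensor G) y) (T y) _ _ (by decide),
    pull_mul (schoutenTensor G y) (covDeriv G T y) _ _ (by decide)]
  refine congrArg₂ _ (congrArg₂ _ (congrArg _ ?_) (congrArg _ ?_))
    (congrArg₂ _ (congrArg _ ?_) (congrArg _ ?_)) <;>
  · funext s; fin_cases s <;> rfl

namespace IsDstarKernelOn

/-- The equation `𝒟*u = 0` in an orthonormal frame. -/
lemma pull_dstar (h : IsDstarKernelOn G Ω u) (hy : y ∈ Ω) (hE : IsOrthonormalFrame (G y) E)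
    (i j : Fin 4) :
    ∑ k, ∑ l, pull E (covDeriv G (covDeriv G u) y) ![k, l, i, k, j, l] +
      ∑ k, ∑ l, pull E (schoutenTensor G y) ![k, l] * pull E (u y) ![i, k, j, l] = 0 := by
  let σ : Equiv.Perm (Fin 6) := ⟨![3, 1, 4, 2, 5, 0], ![5, 1, 3, 0, 2, 4], by decide, by decide⟩
  have h1 := hE.pull_double_trace (covDeriv G (covDeriv G u) y) σ ![i, j]
  have h2 := hE.pull_schoutenContract u i j
  have e1 : ∀ a b c d (I : Fin 2 → Fin 4), (Fin.cons c (Fin.cons d (Fin.cons a (Fin.cons b I :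
      Fin 3 → Fin 4) : Fin 4 → Fin 4) : Fin 5 → Fin 4) : Fin 6 → Fin 4) ∘ σ =
      ![b, d, I 0, a, I 1, c] := fun a b c d I => by funext s; fin_cases s <;> rfl
  simp only [e1] at h1
  refine Eq.trans (congrArg₂ _ h1.symm h2.symm) ?_
  rw [← pull_add, ← pull_zero E ![i, j]]
  congr 1
  funext I
  have h3 := h.dstar y hy (I 0) (I 1)
  rw [Dstar] at h3
  refine Eq.trans (congrArg₂ _ ?_ ?_) ((mul_eq_zero.mp h3).resolve_left two_ne_zero)
  · refine Finset.sum_congr rfl fun k _ => ?_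
    simp only [Finset.mul_sum]
    rw [Finset.sum_comm]
    refine Finset.sum_congr rfl fun l _ => Finset.sum_congr rfl fun a _ =>
      Finset.sum_congr rfl fun b _ => ?_
    rw [← mul_assoc]
    rfl
  · have e2 : ∀ a b c d, prodHead (schoutenTensor G) u y ((Fin.cons c (Fin.cons d (Fin.cons a
        (Fin.cons b I : Fin 3 → Fin 4) : Fin 4 → Fin 4) : Fin 5 → Fin 4) : Fin 6 → Fin 4) ∘
        ![3, 1, 4, 2, 5, 0]) = schouten G b d y * u y ![I 0, a, I 1, c] := fun a b c d => by
      refine congrArg₂ (· * ·) rfl (congrArg _ ?_)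
      funext s; fin_cases s <;> rfl
    simp only [schoutenContract, traceHead, e2, schoutenUp]
    refine Finset.sum_congr rfl fun k _ => ?_
    simp only [Finset.mul_sum, Finset.sum_mul]
    rw [Finset.sum_comm]
    refine Finset.sum_congr rfl fun l _ => Finset.sum_congr rfl fun a _ =>
      Finset.sum_congr rfl fun b _ => ?_
    simp only [Matrix.cons_val]
    ring

/-- `𝒟*U = 0` as an equality of coordinate tensors on all of `Ω`. A frame equation at one point
could not be differentiated, so it is transported back. -/
lemma trace_covDeriv_divergence (h : IsDstarKernelOn G Ω u) (hy : y ∈ Ω) (I : Fin 2 → Fin 4) :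
    ∑ a, ∑ b, (G y)⁻¹ a b * covDeriv G (divergence G u) y
      ((Fin.cons a (Fin.cons b I : Fin 3 → Fin 4) : Fin 4 → Fin 4) ∘ ![0, 2, 3, 1]) =
      schoutenContract G u y I := by
  obtain ⟨E, hE⟩ := exists_isOrthonormalFrame (h.metric.posDef y hy)
  rw [← sub_eq_zero]
  refine eq_zero_of_pull_eq_zero hE.isUnit_det (T := fun I => ∑ a, ∑ b, (G y)⁻¹ a b *
    covDeriv G (divergence G u) y ((Fin.cons a (Fin.cons b I : Fin 3 → Fin 4) : Fin 4 → Fin 4) ∘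
      ![0, 2, 3, 1]) - schoutenContract G u y I) (fun I => ?_) I
  have hI : I = ![I 0, I 1] := by funext s; fin_cases s <;> rfl
  rw [pull_sub, hI, hE.pull_schoutenContract, sub_eq_zero]
  refine (hE.pull_trace_eq (T := covDeriv G (divergence G u) y)
    ⟨![0, 2, 3, 1], ![0, 3, 1, 2], by decide, by decide⟩ (fun _ => rfl) ![I 0, I 1]).symm.trans ?_
  have e : ∀ a (i j : Fin 4), (Fin.cons a (Fin.cons a ![i, j] : Fin 3 → Fin 4) : Fin 4 → Fin 4) ∘
      ![0, 2, 3, 1] = ![a, i, j, a] := fun a i j => by funext s; fin_cases s <;> rfl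
  simp only [Equiv.coe_fn_mk, e, h.pull_covDeriv_divergence hy hE]
  have hd := h.pull_dstar hy hE (I 1) (I 0)
  have e1 : ∀ a m, pull E (covDeriv G (covDeriv G u) y) ![a, m, m, I 0, I 1, a] =
      - pull E (covDeriv G (covDeriv G u) y) ![a, m, I 1, a, I 0, m] := fun a m => by
    have hw := h.duality_covDeriv_covDeriv hy hE a m
    rw [← hw.symm m (I 0) (I 1) a, (hw.right _ _).skew (I 0) m]
  have e2 : ∑ a, ∑ m, pull E (schoutenTensor G y) ![a, m] * pull E (u y) ![I 0, a, I 1, m] =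
      ∑ a, ∑ m, pull E (schoutenTensor G y) ![a, m] * pull E (u y) ![I 1, a, I 0, m] := by
    rw [Finset.sum_comm]
    refine Finset.sum_congr rfl fun a _ => Finset.sum_congr rfl fun m _ => ?_
    rw [h.metric.pull_schouten_symm hy m a, (h.duality hy hE).symm]
  simp only [e1, Finset.sum_neg_distrib]
  rw [e2]
  linarith

/-- The covariant derivative of the previous equation, with the product rule applied to `P^{ab}
U_{kaib}`. -/
lemma pull_trace_covDeriv_covDeriv_divergence (h : IsDstarKernelOn G Ω u) (hy : y ∈ Ω)
    (hE : IsOrthonormalFrame (G y) E) (c k i : Fin 4) :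
    ∑ l, pull E (covDeriv G (covDeriv G (divergence G u)) y) ![c, l, k, i, l] =
      ∑ a, ∑ b, (pull E (covDeriv G (schoutenTensor G) y) ![c, a, b] * pull E (u y) ![k, a, i, b] +
        pull E (schoutenTensor G y) ![a, b] * pull E (covDeriv G u y) ![c, k, a, i, b]) := by
  rw [← h.metric.pull_covDeriv_schoutenContract hy hE h.smooth]
  have e : ∀ p q (I : Fin 3 → Fin 4), (Fin.cons p (Fin.cons q I : Fin 4 → Fin 4) :
      Fin 5 → Fin 4) ∘ ![2, 0, 3, 4, 1] = ![I 0, p, I 1, I 2, q] :=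
    fun p q I => by funext s; fin_cases s <;> rfl
  have := hE.pull_trace_eq (R := covDeriv G (schoutenContract G u) y)
    (T := covDeriv G (covDeriv G (divergence G u)) y)
    ⟨![2, 0, 3, 4, 1], ![1, 4, 0, 2, 3], by decide, by decide⟩ (fun I => by
      have h1 := covDeriv_trace_eq (h.smooth_divergence.covDeriv h.metric) h.metric
        ⟨![0, 2, 3, 1], ![0, 3, 1, 2], by decide, by decide⟩
        (fun z hz I => h.trace_covDeriv_divergence hz I) hy (I 0) ![I 1, I 2]
      rw [eta_three I]
      refine Eq.trans ?_ h1
      refine Finset.sum_congr rfl fun a _ => Finset.sum_congr rfl fun b _ => ?_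
      congr 2
      funext s; fin_cases s <;> rfl) ![c, k, i]
  simp only [Equiv.coe_fn_mk, e] at this
  exact this

end IsDstarKernelOn
end Coord

namespace Coord

variable {G : E4 → Matrix (Fin 4) (Fin 4) ℝ} {Ω : Set E4} {y : E4}
  {E : Matrix (Fin 4) (Fin 4) ℝ} {u : CoordTensor 4}

/-! ### The terms of the two formulas in an orthonormal frame -/

lemma IsOrthonormalFrame.pull_roughLaplacian (hE : IsOrthonormalFrame (G y) E) {k : ℕ}
    (T : CoordTensor k) (I : Fin k → Fin 4) :
    pull E (roughLaplacian G T y) I = ∑ a, pull E (covDeriv G (covDeriv G T) y)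
      (Fin.cons a (Fin.cons a I : Fin (k + 1) → Fin 4)) :=
  hE.pull_trace _ I

lemma IsOrthonormalFrame.traceJ_eq (hE : IsOrthonormalFrame (G y) E) :
    traceJ G y = ∑ a, pull E (schoutenTensor G y) ![a, a] := by
  have := hE.pull_trace (schoutenTensor G y) ![]
  rw [pull_zero_rank] at this
  exact this

lemma IsMetricOn.pull_pderiv4_traceJ (hG : IsMetricOn G Ω) (hy : y ∈ Ω)
    (hE : IsOrthonormalFrame (G y) E) (k : Fin 4) :
    pull E (fun I : Fin 1 → Fin 4 => pderiv4 (I 0) (traceJ G) y) ![k] =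
      ∑ a, pull E (covDeriv G (schoutenTensor G) y) ![k, a, a] := by
  have e : ∀ a b (I : Fin 1 → Fin 4), (Fin.cons a (Fin.cons b I : Fin 2 → Fin 4) :
      Fin 3 → Fin 4) ∘ ![2, 0, 1] = ![I 0, a, b] := fun a b I => by
    funext s; fin_cases s <;> rfl
  have := hE.pull_trace_eq (T := covDeriv G (schoutenTensor G) y)
    ⟨![2, 0, 1], ![1, 2, 0], by decide, by decide⟩ (fun _ => rfl) ![k]
  simp only [Equiv.coe_fn_mk, e] at this
  simp only [hG.pderiv4_traceJ hy]
  exact this.symm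

lemma IsOrthonormalFrame.pull_covDeriv_schoutenMixed (hE : IsOrthonormalFrame (G y) E)
    (T : CoordTensor 4) (l i j : Fin 4) :
    pull E (fun I : Fin 3 → Fin 4 => ∑ m, ∑ k, (∑ n, (G y)⁻¹ m n *
      covDeriv G T y ![n, I 1, I 2, k, I 0]) * schoutenMixed G m k y) ![l, i, j] =
      ∑ m, ∑ k, pull E (covDeriv G T y) ![m, i, j, k, l] *
        pull E (schoutenTensor G y) ![m, k] := by
  -- For `J = (c, k, m, n, l, i, j)` the two factors are `∇_n T_{ijkl}` and `P_{mc}`.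
  have h := hE.pull_double_trace (fun J : Fin 7 → Fin 4 => covDeriv G T y (J ∘ ![3, 5, 6, 1, 4]) *
    schoutenTensor G y (J ∘ ![2, 0])) (Equiv.refl _) ![l, i, j]
  refine Eq.trans (congrArg (fun A => pull E A ![l, i, j]) ?_) (h.trans ?_)
  · funext I
    refine Finset.sum_congr rfl fun m _ => ?_
    simp only [schoutenMixed, Finset.sum_mul, Finset.mul_sum]
    rw [Finset.sum_comm]
    conv_rhs => rw [Finset.sum_comm]
    refine Finset.sum_congr rfl fun c _ => ?_
    rw [Finset.sum_comm]
    refine Finset.sum_congr rfl fun n _ => Finset.sum_congr rfl fun k _ => ?_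
    have e : covDeriv G T y ![n, I 1, I 2, k, I 0] = covDeriv G T y
        (((Fin.cons c (Fin.cons k (Fin.cons m (Fin.cons n I : Fin 4 → Fin 4) : Fin 5 → Fin 4) :
          Fin 6 → Fin 4) : Fin 7 → Fin 4) ∘ Equiv.refl (Fin 7)) ∘ ![3, 5, 6, 1, 4]) :=
      congrArg _ (by funext s; fin_cases s <;> rfl)
    rw [e]
    change _ = _ * (_ * (_ * schouten G m c y))
    ring
  · refine Finset.sum_congr rfl fun m _ => Finset.sum_congr rfl fun k _ => ?_
    rw [pull_mul (covDeriv G T y) (schoutenTensor G y) _ _ (by decide)]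
    refine congrArg₂ _ (congrArg _ ?_) (congrArg _ ?_) <;>
    · funext s; fin_cases s <;> rfl

lemma IsMetricOn.pull_pderiv4_traceJ_mul (hG : IsMetricOn G Ω) (hy : y ∈ Ω)
    (hE : IsOrthonormalFrame (G y) E) (T : CoordTensor 4) (l i j : Fin 4) :
    pull E (fun I : Fin 3 → Fin 4 => ∑ k, T y ![I 1, I 2, k, I 0] *
      ∑ n, (G y)⁻¹ k n * pderiv4 n (traceJ G) y) ![l, i, j] =
      ∑ k, pull E (T y) ![i, j, k, l] *
        ∑ a, pull E (covDeriv G (schoutenTensor G) y) ![k, a, a] := by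
  have h := hE.pull_trace (fun J : Fin 5 → Fin 4 => T y (J ∘ ![3, 4, 0, 2]) *
    (fun I : Fin 1 → Fin 4 => pderiv4 (I 0) (traceJ G) y) (J ∘ ![1])) ![l, i, j]
  refine Eq.trans (congrArg (fun A => pull E A ![l, i, j]) ?_) (h.trans ?_)
  · funext I
    refine Finset.sum_congr rfl fun k _ => ?_
    rw [Finset.mul_sum]
    refine Finset.sum_congr rfl fun n _ => ?_
    have e : T y ![I 1, I 2, k, I 0] = T y
        ((Fin.cons k (Fin.cons n I : Fin 4 → Fin 4) : Fin 5 → Fin 4) ∘ ![3, 4, 0, 2]) :=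
      congrArg _ (by funext s; fin_cases s <;> rfl)
    rw [e]
    change _ = _ * (_ * pderiv4 n (traceJ G) y)
    ring
  · refine Finset.sum_congr rfl fun k _ => ?_
    rw [← hG.pull_pderiv4_traceJ hy hE]
    refine (pull_mul (T y) (fun I : Fin 1 → Fin 4 => pderiv4 (I 0) (traceJ G) y) _ _
      (by decide) _).trans ?_
    refine congrArg₂ _ (congrArg _ ?_) (congrArg _ ?_) <;>
    · funext s; fin_cases s <;> rfl

lemma IsOrthonormalFrame.pull_mul_schoutenMixed (hE : IsOrthonormalFrame (G y) E)
    (T : CoordTensor 4) (i j k l : Fin 4) :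
    pull E (fun I : Fin 4 → Fin 4 => ∑ m, T y ![I 0, I 1, I 2, m] * schoutenMixed G (I 3) m y)
      ![i, j, k, l] =
      ∑ m, pull E (T y) ![i, j, k, m] * pull E (schoutenTensor G y) ![l, m] := by
  have h := hE.pull_trace (fun J : Fin 6 → Fin 4 => T y (J ∘ ![2, 3, 4, 1]) *
    schoutenTensor G y (J ∘ ![5, 0])) ![i, j, k, l]
  refine Eq.trans (congrArg (fun A => pull E A ![i, j, k, l]) ?_) (h.trans ?_)
  · funext I
    simp only [schoutenMixed, Finset.mul_sum]
    rw [Finset.sum_comm]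
    refine Finset.sum_congr rfl fun c _ => Finset.sum_congr rfl fun m _ => ?_
    have e : T y ![I 0, I 1, I 2, m] = T y
        ((Fin.cons c (Fin.cons m I : Fin 5 → Fin 4) : Fin 6 → Fin 4) ∘ ![2, 3, 4, 1]) :=
      congrArg _ (by funext s; fin_cases s <;> rfl)
    rw [e]
    change _ = _ * (_ * schouten G (I 3) c y)
    ring
  · refine Finset.sum_congr rfl fun m _ => ?_
    rw [pull_mul (T y) (schoutenTensor G y) _ _ (by decide)]
    refine congrArg₂ _ (congrArg _ ?_) (congrArg _ ?_) <;>
    · funext s; fin_cases s <;> rfl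

namespace IsDstarKernelOn

/-- The formula for `Δ δu`, in coordinates. -/
theorem roughLaplacian_divergence (h : IsDstarKernelOn G Ω u) (hy : y ∈ Ω) (l i j : Fin 4) :
    roughLaplacian G (divergence G u) y ![l, i, j] =
      - 2 * (∑ m, ∑ k, (∑ n, (G y)⁻¹ m n * covDeriv G u y ![n, i, j, k, l]) *
          schoutenMixed G m k y)
      - (∑ k, u y ![i, j, k, l] * ∑ n, (G y)⁻¹ k n * pderiv4 n (traceJ G) y)
      + 3 * traceJ G y * divergence G u y ![l, i, j] := by
  obtain ⟨E, hE⟩ := exists_isOrthonormalFrame (h.metric.posDef y hy)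
  rw [← sub_eq_zero]
  -- The difference of the two sides, as an array in all its indices, is what vanishes in the frame.
  refine Eq.trans ?_ (eq_zero_of_pull_eq_zero hE.isUnit_det (T := fun I : Fin 3 → Fin 4 =>
    roughLaplacian G (divergence G u) y I -
      (- 2 * (∑ m, ∑ k, (∑ n, (G y)⁻¹ m n * covDeriv G u y ![n, I 1, I 2, k, I 0]) *
          schoutenMixed G m k y)
      - (∑ k, u y ![I 1, I 2, k, I 0] * ∑ n, (G y)⁻¹ k n * pderiv4 n (traceJ G) y)
      + 3 * traceJ G y * divergence G u y I)) (fun I => ?_) ![l, i, j])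
  · rfl
  · rw [eta_three I, pull_sub, pull_add, pull_sub, pull_const_mul, pull_const_mul,
      hE.pull_roughLaplacian, hE.pull_covDeriv_schoutenMixed,
      h.metric.pull_pderiv4_traceJ_mul hy hE, hE.traceJ_eq, sub_eq_zero]
    obtain ⟨hC1, hC2⟩ := h.cotton hy hE
    exact laplacian_divergence_formula_orthonormal
      (u := fun i j k l => pull E (u y) ![i, j, k, l])
      (W := fun i j k l => pull E (Coord.weyl G y) ![i, j, k, l])
      (P := fun a b => pull E (schoutenTensor G y) ![a, b])
      (Du := fun m i j k l => pull E (covDeriv G u y) ![m, i, j, k, l])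
      (DP := fun m a b => pull E (covDeriv G (schoutenTensor G) y) ![m, a, b])
      (w := fun l i j => pull E (divergence G u y) ![l, i, j])
      (X := fun a b l i j => pull E (covDeriv G (covDeriv G (divergence G u)) y) ![a, b, l, i, j])
      (h.duality hy hE) (h.duality_weyl hy hE) (h.metric.pull_schouten_symm hy)
      (h.duality_covDeriv hy hE) (h.metric.pull_covDeriv_schouten_symm hy) hC1 hC2
      (h.pull_divergence hy hE) (h.duality_covDeriv_covDeriv_divergence hy hE)
      (h.trace_covDeriv_covDeriv_divergence hy hE)
      (h.pull_trace_covDeriv_covDeriv_divergence hy hE)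
      (hE.ricci_identity_three h.smooth_divergence h.metric hy) (I 0) (I 1) (I 2)

/-- The formula for `Δ u`, in coordinates. -/
theorem roughLaplacian_eq (h : IsDstarKernelOn G Ω u) (hy : y ∈ Ω) (i j k l : Fin 4) :
    (1 / 2) * roughLaplacian G u y ![i, j, k, l] =
      covDeriv G (divergence G u) y ![k, l, i, j] - covDeriv G (divergence G u) y ![l, k, i, j]
      + (∑ m, u y ![i, j, k, m] * schoutenMixed G l m y)
      - (∑ m, u y ![i, j, l, m] * schoutenMixed G k m y)
      + traceJ G y * u y ![i, j, k, l] := by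
  obtain ⟨E, hE⟩ := exists_isOrthonormalFrame (h.metric.posDef y hy)
  -- The terms of the formula carry their indices in different orders; writing them as permutations
  -- of one `I` lets `pull_reindex` treat them uniformly.
  let σ : Equiv.Perm (Fin 4) := ⟨![2, 3, 0, 1], ![2, 3, 0, 1], by decide, by decide⟩
  let τ : Equiv.Perm (Fin 4) := ⟨![3, 2, 0, 1], ![2, 3, 1, 0], by decide, by decide⟩
  let ρ : Equiv.Perm (Fin 4) := ⟨![0, 1, 3, 2], ![0, 1, 3, 2], by decide, by decide⟩
  let B : (Fin 4 → Fin 4) → ℝ := fun I =>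
    ∑ m, u y ![I 0, I 1, I 2, m] * schoutenMixed G (I 3) m y
  have hσ : ∀ i j k l : Fin 4, (![i, j, k, l] : Fin 4 → Fin 4) ∘ σ = ![k, l, i, j] := by
    intro i j k l; funext s; fin_cases s <;> rfl
  have hτ : ∀ i j k l : Fin 4, (![i, j, k, l] : Fin 4 → Fin 4) ∘ τ = ![l, k, i, j] := by
    intro i j k l; funext s; fin_cases s <;> rfl
  have hρ : ∀ i j k l : Fin 4, (![i, j, k, l] : Fin 4 → Fin 4) ∘ ρ = ![i, j, l, k] := by
    intro i j k l; funext s; fin_cases s <;> rfl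
  have hB : ∀ i j k l, pull E B ![i, j, k, l] =
      ∑ m, pull E (u y) ![i, j, k, m] * pull E (schoutenTensor G y) ![l, m] :=
    hE.pull_mul_schoutenMixed u
  rw [← sub_eq_zero]
  refine Eq.trans ?_ (eq_zero_of_pull_eq_zero hE.isUnit_det (T := fun I : Fin 4 → Fin 4 =>
    (1 / 2) * roughLaplacian G u y I -
      (covDeriv G (divergence G u) y (I ∘ σ) - covDeriv G (divergence G u) y (I ∘ τ) + B I
      - B (I ∘ ρ) + traceJ G y * u y I)) (fun I => ?_) ![i, j, k, l])
  · simp only [hσ, hτ, hρ, B, Matrix.cons_val]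
  · rw [eta_four I, pull_sub, pull_add, pull_sub, pull_add, pull_sub, pull_const_mul,
      pull_const_mul, pull_reindex, pull_reindex, pull_reindex, hσ, hτ, hρ, hB, hB,
      hE.pull_roughLaplacian, hE.traceJ_eq, h.pull_covDeriv_divergence hy hE,
      h.pull_covDeriv_divergence hy hE, sub_eq_zero]
    exact laplacian_formula_orthonormal
      (u := fun i j k l => pull E (u y) ![i, j, k, l])
      (W := fun i j k l => pull E (Coord.weyl G y) ![i, j, k, l])
      (P := fun a b => pull E (schoutenTensor G y) ![a, b])
      (D2 := fun a b i j k l => pull E (covDeriv G (covDeriv G u) y) ![a, b, i, j, k, l])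
      (h.duality hy hE) (h.duality_weyl hy hE) (h.metric.pull_schouten_symm hy)
      (h.duality_covDeriv_covDeriv hy hE)
      (hE.ricci_identity_four h.smooth h.metric hy) (h.pull_dstar hy hE) (I 0) (I 1) (I 2) (I 3)

end IsDstarKernelOn
end Coord

/-! ### From charts of the manifold to the coordinate setting. -/

section Manifold

lemma mfderiv_symm_injective {M : Type*} [TopologicalSpace M] [ChartedSpace E4 M]
    {e : OpenPartialHomeomorph M E4}
    (he : e ∈ IsManifold.maximalAtlas (𝓡 4) ∞ M) {y : E4} (hy : y ∈ e.target) :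
    Function.Injective (mfderiv 𝓘(ℝ, E4) (𝓡 4) e.symm y) := by
  have h : e.MDifferentiable (𝓡 4) 𝓘(ℝ, E4) :=
    ⟨(contMDiffOn_of_mem_maximalAtlas he).mdifferentiableOn (by norm_num),
      (contMDiffOn_symm_of_mem_maximalAtlas he).mdifferentiableOn (by norm_num)⟩
  exact h.symm.mfderiv_injective hy

lemma bilin_sum_smul {V : Type*} [AddCommGroup V] [Module ℝ V] [TopologicalSpace V]
    (B : V →L[ℝ] V →L[ℝ] ℝ) (x : Fin 4 → ℝ) (w : Fin 4 → V) :
    B (∑ i, x i • w i) (∑ i, x i • w i) =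
      star x ⬝ᵥ ((Matrix.of fun i j => B (w i) (w j)) *ᵥ x) := by
  simp only [map_sum, map_smul, sum_apply, smul_apply, smul_eq_mul, dotProduct, Matrix.mulVec,
    Matrix.of_apply, star_trivial, Finset.mul_sum]
  rw [Finset.sum_comm]
  exact Finset.sum_congr rfl fun i _ => Finset.sum_congr rfl fun j _ => by ring

variable {M : Type*} [TopologicalSpace M] [ChartedSpace E4 M] [IsManifold (𝓡 4) ∞ M]

/-- A coordinate field is the tangent map of the inverse chart composed with a constant vector
field. -/
lemma contMDiffOn_coordVec {e : OpenPartialHomeomorph M E4}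
    (he : e ∈ IsManifold.maximalAtlas (𝓡 4) ∞ M) (i : Fin 4) :
    ContMDiffOn 𝓘(ℝ, E4) (𝓡 4).tangent ∞
      (fun y => (Bundle.TotalSpace.mk' E4 (e.symm y) (coordVec e y i) : TangentBundle (𝓡 4) M))
      e.target := by
  have h1 : ContMDiffOn 𝓘(ℝ, E4) (𝓡 4) ∞ e.symm e.target :=
    contMDiffOn_symm_of_mem_maximalAtlas he
  have h2 := h1.contMDiffOn_tangentMapWithin (m := ∞) (by norm_num) e.open_target.uniqueMDiffOn
  have h3 : ContMDiff 𝓘(ℝ, E4) 𝓘(ℝ, E4).tangent ∞ (fun y : E4 =>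
      (Bundle.TotalSpace.mk' E4 y (EuclideanSpace.single i 1 : E4) : TangentBundle 𝓘(ℝ,
        E4) E4)) := by
    intro y
    exact (contMDiffAt_vectorSpace_iff_contDiffAt (𝕜 := ℝ) (E := E4)
      (V := fun _ => (EuclideanSpace.single i 1 : E4))).mpr contDiffAt_const
  refine (h2.comp h3.contMDiffOn fun y hy => hy).congr fun y hy => ?_
  have h4 : MDifferentiableAt 𝓘(ℝ, E4) (𝓡 4) e.symm y :=
    (h1.contMDiffAt (e.open_target.mem_nhds hy)).mdifferentiableAt (by norm_num)
  simp only [Function.comp_apply, tangentMapWithin, coordVec]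
  rw [mfderivWithin_eq_mfderiv (e.open_target.uniqueMDiffOn y hy) h4]

/-- Smoothness comes from pairing the smooth metric with the smooth coordinate fields. The matrix is
a Gram matrix of vectors that are independent because the inverse chart has injective differential,
hence positive definite. -/
lemma isMetricOn_inChart (g : Metric4 M) {e : OpenPartialHomeomorph M E4}
    (he : e ∈ IsManifold.maximalAtlas (𝓡 4) ∞ M) :
    Coord.IsMetricOn (g.inChart e) e.target where
  isOpen := e.open_target
  smooth i j := by
    have h := ContMDiffOn.clm_bundle_apply₂ (F₃ := ℝ) (E₃ := Bundle.Trivial M ℝ)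
      (g.contMDiff.comp_contMDiffOn
      (contMDiffOn_symm_of_mem_maximalAtlas he)) (contMDiffOn_coordVec he i)
      (contMDiffOn_coordVec he j)
    intro y hy
    have h2 := h y hy
    simp only [Bundle.contMDiffWithinAt_totalSpace] at h2
    exact h2.2.contDiffWithinAt
  posDef y hy := by
    refine Matrix.PosDef.of_dotProduct_mulVec_pos ?_ fun x hx => ?_
    · ext i j
      simp [Metric4.inChart, g.symm (e.symm y) (coordVec e y i)]
    let v : E4 := WithLp.toLp 2 x
    have hv : v = ∑ i, x i • (EuclideanSpace.single i 1 : E4) := by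
      ext j
      simp [v, Finset.sum_apply, Pi.single_apply]
    have hv0 : v ≠ 0 := fun h => hx (by simpa [v] using h)
    let L := mfderiv 𝓘(ℝ, E4) (𝓡 4) e.symm y
    have hL : L v = ∑ i, x i • coordVec e y i := by
      rw [hv]
      refine (map_sum L _ _).trans ?_
      exact Finset.sum_congr rfl fun i _ => map_smul L _ _
    have hLv : L v ≠ 0 := fun h => hv0 (mfderiv_symm_injective he hy (h.trans (map_zero L).symm))
    have hpos := g.pos (e.symm y) (L v) hLv
    rw [hL] at hpos
    rw [bilin_sum_smul] at hpos
    exact hpos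

lemma IsInKerDstar.isDstarKernelOn_inChart {A : OrientedAtlas M} {g : Metric4 M} (hg : IsASD A g)
    {U : TensorField4 M} (hU : IsInKerDstar A g U) {e : OpenPartialHomeomorph M E4}
    (he : e ∈ A.charts) : Coord.IsDstarKernelOn (g.inChart e) e.target (U.inChart e) :=
  ⟨isMetricOn_inChart g (A.smooth he), hg e he, hU.isSection.smooth e he,
    hU.isSection.algebraic e he, hU.eq_zero e he⟩

end Manifold

end

theorem mainTheorem4 {M : Type*} [TopologicalSpace M] [ChartedSpace E4 M]
    [IsManifold (𝓡 4) ∞ M] (A : OrientedAtlas M) (g : Metric4 M) (hg : IsASD A g)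
    (U : TensorField4 M) (hU : IsInKerDstar A g U)
    (e : OpenPartialHomeomorph M E4) (he : e ∈ A.charts) (y : E4) (hy : y ∈ e.target) :
    let G := g.inChart e
    let u := U.inChart e
    let δu := Coord.divergence G u
    (∀ l i j : Fin 4,
      Coord.roughLaplacian G δu y ![l, i, j] =
        - 2 * (∑ m, ∑ k, (∑ n, (G y)⁻¹ m n * Coord.covDeriv G u y ![n, i, j, k, l]) *
            Coord.schoutenMixed G m k y)
        - (∑ k, u y ![i, j, k, l] * ∑ n, (G y)⁻¹ k n * pderiv4 n (Coord.traceJ G) y)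
        + 3 * Coord.traceJ G y * δu y ![l, i, j]) ∧
    (∀ i j k l : Fin 4,
      (1 / 2) * Coord.roughLaplacian G u y ![i, j, k, l] =
        Coord.covDeriv G δu y ![k, l, i, j] - Coord.covDeriv G δu y ![l, k, i, j]
        + (∑ m, u y ![i, j, k, m] * Coord.schoutenMixed G l m y)
        - (∑ m, u y ![i, j, l, m] * Coord.schoutenMixed G k m y)
        + Coord.traceJ G y * u y ![i, j, k, l]) := by
  have h := hU.isDstarKernelOn_inChart hg he
  exact ⟨h.roughLaplacian_divergence hy, h.roughLaplacian_eq hy⟩
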